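/- Let $M$ be a smooth manifold of dimension $s$ (Hausdorff, second countable, without boundary), and let $\mathcal A=\mathcal A_0\oplus\mathcal A_1$ be the superalgebra of smooth functions on a smooth supermanifold of dimension $(s,r)$ with body $M$. Let $\mathfrak g=\mathfrak g_0\oplus\mathfrak g_1$ be the real Lie superalgebra of its vector fields, that is, of the superderivations of $\mathcal A$ with the supercommutator. Let $V\to M$ be any smooth real vector bundle of rank $r$ and $\varphi\colon\mathcal A\simeq\Gamma(\Lambda^\bullet V^*)$ any isomorphism of superalgebras. (Only the superalgebra $\mathcal A$ and the existence of such a $\varphi$ are used.) Let $\mathcal A^k=\varphi^{-1}(\Gamma(\Lambda^kV^*))$, let $\epsilon\in\mathfrak g_0$ be the Euler vector field, $\epsilon(a)=ka$ for $a\in\mathcal A^k$, and for $k\in\mathbb Z$ let $\mathfrak g^k=\{X\in\mathfrak g\mid[\epsilon,X]=kX\}$. Assume that $r>2$, or that $s>0$ and $r>1$. Then the $\mathfrak g^k$ form a $\mathbb Z$-grading $\mathfrak g=\bigoplus_{k}\mathfrak g^k$ compatible with the bracket and the parity. Moreover, among the ideals of $\mathfrak g_0$ all of whose elements $X$ act ad-nilpotently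 on $\mathfrak g$ (that is, $\mathrm{ad}_X^m=0$ on $\mathfrak g$ for some $m$) there is exactly one maximal one, $\mathfrak g'$. Define $\mathfrak g^{(-1)}=\mathfrak g_1$, $\mathfrak g^{(0)}=\mathfrak g_0$ and inductively $\mathfrak g^{(p+2)}=[\mathfrak g',\mathfrak g^{(p)}]$ for $p\ge-1$, where $[\cdot,\cdot]$ of two subspaces is the linear span of the brackets. Then, for every choice of $V$ and $\varphi$: 1. $\mathfrak g^{(p)}=\bigoplus_{i\ge0}\mathfrak g^{p+2i}$ for all $p\ge-1$. 2. The subspaces $\mathfrak g^{(p)}$ are preserved by every automorphism of the Lie superalgebra $\mathfrak g$. They satisfy $\mathfrak g^{(p+2)}\subset\mathfrak g^{(p)}$ and $[\mathfrak g^{(p)},\mathfrak g^{(q)}]\subset\mathfrak g^{(p+q)}$ (where $\mathfrak g^{(-2)}=\mathfrak g_0$). 3. The graded Lie superalgebra $\mathfrak g^{\mathrm{gr}}=\bigoplus_{p\ge-1}\mathfrak g^{(p)}/\mathfrak g^{(p+2)}$, with the bracket induced by that of $\mathfrak g$, is isomorphic to $\mathfrak g=\bigoplus_{p\ge -1}\mathfrak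 g^p$ as a $\mathbb Z$-graded Lie superalgebra. 4. The formula $\mathrm p(\psi)([X])=[\psi(X)]$, for $X\in\mathfrak g^{(p)}$ with class $[X]\in\mathfrak g^{(p)}/\mathfrak g^{(p+2)}$, defines a group homomorphism $\mathrm p\colon\mathrm{Aut}_{\mathbb Z_2}(\mathfrak g)\to\mathrm{Aut}_{\mathbb Z}(\mathfrak g^{\mathrm{gr}})$ from the group of bracket-preserving linear automorphisms of $\mathfrak g$ that preserve the parity to the group of those of $\mathfrak g^{\mathrm{gr}}$ that preserve the $\mathbb Z$-grading. -/

import Mathlib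

open scoped Manifold ContDiff DirectSum

noncomputable section

namespace SuperVF

/-! ### Lie superalgebras -/

/-- The Koszul sign `(-1)^{ij}` for parities `i, j`. -/
def superSign (i j : ZMod 2) : ℝ := if i = 1 ∧ j = 1 then -1 else 1

@[simp] theorem superSign_zero_left (j : ZMod 2) : superSign 0 j = 1 := by simp [superSign]

@[simp] theorem superSign_zero_right (i : ZMod 2) : superSign i 0 = 1 := by simp [superSign]

@[simp] theorem superSign_one_one : superSign 1 1 = -1 := by simp [superSign]

theorem parity_cases (i : ZMod 2) : i = 0 ∨ i = 1 := by revert i; decide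

theorem parity_one_add_one : (1 : ZMod 2) + 1 = 0 := by decide

/-- The structure of a real Lie superalgebra on a real vector space `L`. -/
structure LieSuperalgebra (L : Type*) [AddCommGroup L] [Module ℝ L] where
  /-- the even part `parity 0` and the odd part `parity 1` -/
  parity : ZMod 2 → Submodule ℝ L
  isCompl_parity : IsCompl (parity 0) (parity 1)
  bracket : L →ₗ[ℝ] L →ₗ[ℝ] L
  bracket_mem : ∀ {i j : ZMod 2} {x y : L}, x ∈ parity i → y ∈ parity j →
    bracket x y ∈ parity (i + j)
  skew : ∀ {i j : ZMod 2} {x y : L}, x ∈ parity i → y ∈ parity j →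
    bracket x y = -(superSign i j • bracket y x)
  jacobi : ∀ {i j k : ZMod 2} {x y z : L}, x ∈ parity i → y ∈ parity j → z ∈ parity k →
    bracket x (bracket y z) = bracket (bracket x y) z + superSign i j • bracket y (bracket x z)

namespace LieSuperalgebra

variable {L : Type*} [AddCommGroup L] [Module ℝ L] (S : LieSuperalgebra L)

/-- `P` is a `ℤ`-grading of the Lie superalgebra, compatible with bracket and parity. -/
structure IsZGrading (P : ℤ → Submodule ℝ L) : Prop where
  isInternal : DirectSum.IsInternal P
  le_parity : ∀ p : ℤ, P p ≤ S.parity (p : ZMod 2)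
  bracket_mem : ∀ {p q : ℤ} {x y : L}, x ∈ P p → y ∈ P q → S.bracket x y ∈ P (p + q)

/-- The group of linear automorphisms that respect the bracket and every subspace `P i`.
With `P` the parity decomposition, these are the automorphisms of the Lie superalgebra; with `P`
a `ℤ`-grading, those of the `ℤ`-graded Lie algebra. -/
def aut {ι : Type*} (P : ι → Submodule ℝ L) : Subgroup (L ≃ₗ[ℝ] L) where
  carrier := {ψ | (∀ x y, ψ (S.bracket x y) = S.bracket (ψ x) (ψ y)) ∧
    ∀ i x, ψ x ∈ P i ↔ x ∈ P i}
  one_mem' := ⟨fun _ _ => rfl, fun _ _ => Iff.rfl⟩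
  mul_mem' := by
    rintro ψ χ ⟨h1, h2⟩ ⟨h3, h4⟩
    refine ⟨fun x y => ?_, fun i x => ?_⟩
    · simp only [LinearEquiv.mul_apply, h3, h1]
    · simp only [LinearEquiv.mul_apply, h2, h4]
  inv_mem' := by
    rintro ψ ⟨h1, h2⟩
    refine ⟨fun x y => ?_, fun i x => ?_⟩
    · apply ψ.injective
      rw [h1]
      simp
    · rw [← h2 i]
      simp

/-- `N` is an ideal of the even part, all of whose elements act ad-nilpotently on the whole
Lie superalgebra. -/
structure IsAdNilpotentIdeal (N : Submodule ℝ L) : Prop where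
  le_even : N ≤ S.parity 0
  bracket_mem : ∀ x ∈ S.parity 0, ∀ y ∈ N, S.bracket x y ∈ N
  nilpotent : ∀ x ∈ N, ∃ m : ℕ, ∀ y : L, (S.bracket x ^ m) y = 0

/-- The subspaces `𝔤⁽ᵖ⁾` with the index shifted by one: `𝔤⁽⁻¹⁾`, `𝔤⁽⁰⁾`, `𝔤⁽¹⁾`, ….
`Submodule.map₂ S.bracket A B` is the linear span of the brackets `[a, b]`. -/
def lowerAux (N : Submodule ℝ L) : ℕ → Submodule ℝ L
  | 0 => S.parity 1
  | 1 => S.parity 0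
  | n + 2 => Submodule.map₂ S.bracket N (lowerAux N n)

/-- The subspaces `𝔤⁽ᵖ⁾`: `𝔤⁽⁻¹⁾` is the odd part, `𝔤⁽⁰⁾` the even part and
`𝔤⁽ᵖ⁺²⁾ = [N, 𝔤⁽ᵖ⁾]` for `p ≥ -1`. For `p < -1`, which is not a genuine index, `𝔤⁽ᵖ⁾` is the full
part of parity `p`, so that `𝔤⁽ᵖ⁾/𝔤⁽ᵖ⁺²⁾ = 0` there. -/
def lower (N : Submodule ℝ L) (p : ℤ) : Submodule ℝ L :=
  if p < -1 then S.parity (p : ZMod 2) else S.lowerAux N (p + 1).toNat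

theorem lower_neg_one (N : Submodule ℝ L) : S.lower N (-1) = S.parity 1 := by
  simp [lower, lowerAux]

theorem lower_zero (N : Submodule ℝ L) : S.lower N 0 = S.parity 0 := by
  simp [lower, lowerAux]

theorem lower_add_two (N : Submodule ℝ L) {p : ℤ} (hp : -1 ≤ p) :
    S.lower N (p + 2) = Submodule.map₂ S.bracket N (S.lower N p) := by
  have h : (p + 2 + 1).toNat = (p + 1).toNat + 2 := by omega
  rw [lower, lower, if_neg (by omega), if_neg (by omega), h, lowerAux]

/-! ### Filtrations and the associated graded Lie superalgebra -/

/-- A bilinear map descended to quotients in both arguments. -/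
def descend {M N P : Type*} [AddCommGroup M] [Module ℝ M] [AddCommGroup N] [Module ℝ N]
    [AddCommGroup P] [Module ℝ P] (B : M →ₗ[ℝ] N →ₗ[ℝ] P) (M' : Submodule ℝ M)
    (N' : Submodule ℝ N) (hM : ∀ x ∈ M', ∀ y, B x y = 0) (hN : ∀ x, ∀ y ∈ N', B x y = 0) :
    (M ⧸ M') →ₗ[ℝ] (N ⧸ N') →ₗ[ℝ] P :=
  (N'.liftQ (M'.liftQ B fun x hx => LinearMap.mem_ker.2 (LinearMap.ext (hM x hx))).flip
    fun y hy => LinearMap.mem_ker.2 (LinearMap.ext fun x => by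
      obtain ⟨x, rfl⟩ := M'.mkQ_surjective x
      exact hN x y hy)).flip

theorem descend_mkQ {M N P : Type*} [AddCommGroup M] [Module ℝ M] [AddCommGroup N] [Module ℝ N]
    [AddCommGroup P] [Module ℝ P] (B : M →ₗ[ℝ] N →ₗ[ℝ] P) (M' : Submodule ℝ M)
    (N' : Submodule ℝ N) (hM : ∀ x ∈ M', ∀ y, B x y = 0) (hN : ∀ x, ∀ y ∈ N', B x y = 0)
    (x : M) (y : N) : descend B M' N' hM hN (M'.mkQ x) (N'.mkQ y) = B x y := rfl

/-- A filtration `F p ⊇ F (p + 2)` by subspaces of parity `p`, compatible with the bracket. -/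
structure Filtration where
  F : ℤ → Submodule ℝ L
  step : ∀ p : ℤ, F (p + 2) ≤ F p
  le_parity : ∀ p : ℤ, F p ≤ S.parity (p : ZMod 2)
  bracket_mem : ∀ {p q : ℤ} {x y : L}, x ∈ F p → y ∈ F q → S.bracket x y ∈ F (p + q)

namespace Filtration

variable {S} (𝓕 : S.Filtration)

/-- The quotient `F p / F (p + 2)`. -/
abbrev Piece (p : ℤ) : Type _ := 𝓕.F p ⧸ (𝓕.F (p + 2)).submoduleOf (𝓕.F p)

/-- The underlying vector space `⨁ₚ F p / F (p + 2)` of the associated graded algebra. -/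
abbrev Gr : Type _ := ⨁ p : ℤ, 𝓕.Piece p

/-- The class of `x ∈ F p` in `F p / F (p + 2)`, as a homogeneous element of `Gr`. -/
def cls (p : ℤ) : 𝓕.F p →ₗ[ℝ] 𝓕.Gr :=
  DirectSum.lof ℝ ℤ 𝓕.Piece p ∘ₗ Submodule.mkQ _

theorem cls_congr {p q : ℤ} (h : p = q) {x : L} (hx : x ∈ 𝓕.F p) {y : L} (hy : y ∈ 𝓕.F q)
    (hxy : x = y) : 𝓕.cls p ⟨x, hx⟩ = 𝓕.cls q ⟨y, hy⟩ := by
  subst h; subst hxy; rfl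

theorem cls_eq_zero {p : ℤ} {x : L} (hx : x ∈ 𝓕.F p) (hx' : x ∈ 𝓕.F (p + 2)) :
    𝓕.cls p ⟨x, hx⟩ = 0 := by
  have : Submodule.mkQ ((𝓕.F (p + 2)).submoduleOf (𝓕.F p)) ⟨x, hx⟩ = 0 := by
    rw [Submodule.mkQ_apply, Submodule.Quotient.mk_eq_zero]
    exact hx'
  rw [cls, LinearMap.comp_apply, this, map_zero]

/-- `(x, y) ↦ [x, y]` as a map `F p × F q → F (p + q) / F (p + q + 2)`. -/
def preBracket (p q : ℤ) : 𝓕.F p →ₗ[ℝ] 𝓕.F q →ₗ[ℝ] 𝓕.Gr :=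
  LinearMap.mk₂ ℝ
    (fun x y => 𝓕.cls (p + q) ⟨S.bracket x y, 𝓕.bracket_mem x.2 y.2⟩)
    (fun x x' y => by rw [← map_add]; congr 1; ext; simp)
    (fun c x y => by rw [← map_smul]; congr 1; ext; simp)
    (fun x y y' => by rw [← map_add]; congr 1; ext; simp)
    (fun c x y => by rw [← map_smul]; congr 1; ext; simp)

/-- The induced map `F p / F (p + 2) × F q / F (q + 2) → F (p + q) / F (p + q + 2)`. -/
def pieceBracket (p q : ℤ) : 𝓕.Piece p →ₗ[ℝ] 𝓕.Piece q →ₗ[ℝ] 𝓕.Gr :=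
  descend (P := 𝓕.Gr) (𝓕.preBracket p q) ((𝓕.F (p + 2)).submoduleOf (𝓕.F p))
    ((𝓕.F (q + 2)).submoduleOf (𝓕.F q))
    (fun x hx y => 𝓕.cls_eq_zero (𝓕.bracket_mem x.2 y.2) (by
      have h := 𝓕.bracket_mem (p := p + 2) (q := q) hx y.2
      rwa [show p + 2 + q = p + q + 2 by ring] at h))
    (fun x y hy => 𝓕.cls_eq_zero (𝓕.bracket_mem x.2 y.2) (by
      have h := 𝓕.bracket_mem (p := p) (q := q + 2) x.2 hy
      rwa [show p + (q + 2) = p + q + 2 by ring] at h))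

/-- The bracket of the associated graded algebra, induced by the bracket of `L`. -/
def grBracket : 𝓕.Gr →ₗ[ℝ] 𝓕.Gr →ₗ[ℝ] 𝓕.Gr :=
  DirectSum.toModule ℝ ℤ _ fun p =>
    (DirectSum.toModule ℝ ℤ _ fun q => (𝓕.pieceBracket p q).flip).flip

theorem grBracket_cls {p q : ℤ} (x : 𝓕.F p) (y : 𝓕.F q) :
    𝓕.grBracket (𝓕.cls p x) (𝓕.cls q y) =
      𝓕.cls (p + q) ⟨S.bracket x y, 𝓕.bracket_mem x.2 y.2⟩ := by
  simp only [grBracket, cls, LinearMap.comp_apply, DirectSum.toModule_lof, LinearMap.flip_apply,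
    pieceBracket]
  rfl

/-- The subspace `F p / F (p + 2)` of `Gr`. -/
def grPiece (p : ℤ) : Submodule ℝ 𝓕.Gr := LinearMap.range (DirectSum.lof ℝ ℤ 𝓕.Piece p)

/-- The even and odd part of `Gr`: all components of the other parity vanish. -/
def grParity (i : ZMod 2) : Submodule ℝ 𝓕.Gr where
  carrier := {x | ∀ p : ℤ, (p : ZMod 2) ≠ i → x p = 0}
  zero_mem' := fun _ _ => rfl
  add_mem' := fun {x y} hx hy p hp => by
    rw [DirectSum.add_apply, hx p hp, hy p hp, add_zero]
  smul_mem' := fun c x hx p hp => by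
    rw [DirectSum.smul_apply, hx p hp, smul_zero]

theorem cls_mem_grParity {p : ℤ} {i : ZMod 2} (h : (p : ZMod 2) = i) (x : 𝓕.F p) :
    𝓕.cls p x ∈ 𝓕.grParity i := by
  intro q hq
  have hpq : p ≠ q := by rintro rfl; exact hq h
  exact DirectSum.of_eq_of_ne _ _ _ hpq.symm

theorem grParity_induction {i : ZMod 2} (C : 𝓕.Gr → Prop) (h0 : C 0)
    (hadd : ∀ x y, C x → C y → C (x + y))
    (hcls : ∀ (p : ℤ), (p : ZMod 2) = i → ∀ x : 𝓕.F p, C (𝓕.cls p x))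
    {x : 𝓕.Gr} (hx : x ∈ 𝓕.grParity i) : C x := by
  classical
  rw [← DirectSum.sum_support_of x]
  refine Finset.sum_induction _ C hadd h0 fun p hp => ?_
  have hpi : (p : ZMod 2) = i := by
    by_contra hne
    exact (DFinsupp.mem_support_iff.1 hp) (hx p hne)
  obtain ⟨y, hy⟩ := Submodule.mkQ_surjective _ (x p)
  rw [← hy]
  exact hcls p hpi y

theorem isCompl_grParity : IsCompl (𝓕.grParity 0) (𝓕.grParity 1) := by
  classical
  constructor
  · rw [Submodule.disjoint_def]
    intro x h0 h1
    ext p : 1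
    by_cases h : (p : ZMod 2) = 0
    · exact h1 p (by rw [h]; decide)
    · exact h0 p h
  · rw [codisjoint_iff, Submodule.eq_top_iff']
    intro x
    induction x using DirectSum.induction_on with
    | zero => exact zero_mem _
    | add x y hx hy => exact add_mem hx hy
    | of p x =>
      obtain ⟨y, rfl⟩ := Submodule.mkQ_surjective _ x
      rcases parity_cases (p : ZMod 2) with h | h
      · exact Submodule.mem_sup_left (𝓕.cls_mem_grParity h y)
      · exact Submodule.mem_sup_right (𝓕.cls_mem_grParity h y)

/-- The Lie superalgebra associated with a filtration. -/
def gr : LieSuperalgebra 𝓕.Gr where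
  parity := 𝓕.grParity
  isCompl_parity := 𝓕.isCompl_grParity
  bracket := 𝓕.grBracket
  bracket_mem := by
    intro i j x y hx hy
    refine 𝓕.grParity_induction (fun x => 𝓕.grBracket x y ∈ 𝓕.grParity (i + j)) ?_ ?_ ?_ hx
    · simp
    · intro a b ha hb
      rw [map_add, LinearMap.add_apply]
      exact add_mem ha hb
    intro p hp a
    refine 𝓕.grParity_induction
      (fun y => 𝓕.grBracket (𝓕.cls p a) y ∈ 𝓕.grParity (i + j)) ?_ ?_ ?_ hy
    · simp
    · intro c d hc hd
      rw [map_add]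
      exact add_mem hc hd
    intro q hq b
    rw [𝓕.grBracket_cls]
    exact 𝓕.cls_mem_grParity (by push_cast; rw [hp, hq]) _
  skew := by
    intro i j x y hx hy
    refine 𝓕.grParity_induction
      (fun x => 𝓕.grBracket x y = -(superSign i j • 𝓕.grBracket y x)) ?_ ?_ ?_ hx
    · simp
    · intro a b ha hb
      simp only [map_add, LinearMap.add_apply, ha, hb, smul_add]
      abel
    intro p hp a
    refine 𝓕.grParity_induction
      (fun y => 𝓕.grBracket (𝓕.cls p a) y = -(superSign i j • 𝓕.grBracket y (𝓕.cls p a)))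
      ?_ ?_ ?_ hy
    · simp
    · intro c d hc hd
      simp only [map_add, LinearMap.add_apply, hc, hd, smul_add]
      abel
    intro q hq b
    rw [𝓕.grBracket_cls, 𝓕.grBracket_cls, ← map_smul, ← map_neg]
    refine 𝓕.cls_congr (add_comm p q) _ (Submodule.neg_mem _ (Submodule.smul_mem _ _
      (𝓕.bracket_mem b.2 a.2))) ?_
    exact S.skew (hp ▸ 𝓕.le_parity p a.2) (hq ▸ 𝓕.le_parity q b.2)
  jacobi := by
    intro i j k x y z hx hy hz
    refine 𝓕.grParity_induction
      (fun x => 𝓕.grBracket x (𝓕.grBracket y z) = 𝓕.grBracket (𝓕.grBracket x y) z +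
        superSign i j • 𝓕.grBracket y (𝓕.grBracket x z)) ?_ ?_ ?_ hx
    · simp
    · intro a b ha hb
      simp only [map_add, LinearMap.add_apply, ha, hb, smul_add]
      abel
    intro p hp a
    refine 𝓕.grParity_induction
      (fun y => 𝓕.grBracket (𝓕.cls p a) (𝓕.grBracket y z) =
        𝓕.grBracket (𝓕.grBracket (𝓕.cls p a) y) z +
        superSign i j • 𝓕.grBracket y (𝓕.grBracket (𝓕.cls p a) z)) ?_ ?_ ?_ hy
    · simp
    · intro c d hc hd
      simp only [map_add, LinearMap.add_apply, hc, hd, smul_add]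
      abel
    intro q hq b
    refine 𝓕.grParity_induction
      (fun z => 𝓕.grBracket (𝓕.cls p a) (𝓕.grBracket (𝓕.cls q b) z) =
        𝓕.grBracket (𝓕.grBracket (𝓕.cls p a) (𝓕.cls q b)) z +
        superSign i j • 𝓕.grBracket (𝓕.cls q b) (𝓕.grBracket (𝓕.cls p a) z)) ?_ ?_ ?_ hz
    · simp
    · intro c d hc hd
      simp only [map_add, hc, hd, smul_add]
      abel
    intro r hr c
    have hJ := S.jacobi (hp ▸ 𝓕.le_parity p a.2) (hq ▸ 𝓕.le_parity q b.2)
      (hr ▸ 𝓕.le_parity r c.2)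
    simp only [𝓕.grBracket_cls]
    rw [← map_smul]
    have h1 : p + q + r = p + (q + r) := by ring
    have h2 : q + (p + r) = p + (q + r) := by ring
    have m1 : S.bracket (S.bracket a b) c ∈ 𝓕.F (p + (q + r)) :=
      h1 ▸ 𝓕.bracket_mem (𝓕.bracket_mem a.2 b.2) c.2
    have m2 : superSign i j • S.bracket b (S.bracket a c) ∈ 𝓕.F (p + (q + r)) :=
      Submodule.smul_mem _ _ (h2 ▸ 𝓕.bracket_mem b.2 (𝓕.bracket_mem a.2 c.2))
    have e1 := 𝓕.cls_congr h1 (𝓕.bracket_mem (𝓕.bracket_mem a.2 b.2) c.2) m1 rfl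
    have e2 := 𝓕.cls_congr h2 (Submodule.smul_mem _ (superSign i j)
      (𝓕.bracket_mem b.2 (𝓕.bracket_mem a.2 c.2))) m2 rfl
    refine Eq.trans ?_ (congrArg₂ (· + ·) e1.symm e2.symm)
    rw [← map_add]
    exact 𝓕.cls_congr rfl _ (add_mem m1 m2) hJ

end Filtration

end LieSuperalgebra

/-! ### Superderivations -/

section Derivations

variable {A : Type*} [Ring A] [Algebra ℝ A] (𝒜 : ZMod 2 → Submodule ℝ A)

/-- The space of superderivations of parity `i` of a superalgebra. -/
def homogeneousDer (i : ZMod 2) : Submodule ℝ (Module.End ℝ A) where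
  carrier := {X | (∀ j, ∀ a ∈ 𝒜 j, X a ∈ 𝒜 (i + j)) ∧
    ∀ j, ∀ a ∈ 𝒜 j, ∀ b, X (a * b) = X a * b + superSign i j • (a * X b)}
  zero_mem' := ⟨fun j a _ => by simp, fun j a _ b => by simp⟩
  add_mem' := by
    rintro X Y ⟨hX, hX'⟩ ⟨hY, hY'⟩
    refine ⟨fun j a ha => add_mem (hX j a ha) (hY j a ha), fun j a ha b => ?_⟩
    simp only [LinearMap.add_apply, hX' j a ha, hY' j a ha, add_mul, mul_add, smul_add]
    abel
  smul_mem' := by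
    rintro c X ⟨hX, hX'⟩
    refine ⟨fun j a ha => Submodule.smul_mem _ _ (hX j a ha), fun j a ha b => ?_⟩
    simp only [LinearMap.smul_apply, hX' j a ha, smul_add, smul_mul_assoc, mul_smul_comm,
      smul_comm c]

/-- The space of all superderivations: sums of an even and an odd one. -/
def superDer : Submodule ℝ (Module.End ℝ A) := homogeneousDer 𝒜 0 ⊔ homogeneousDer 𝒜 1

theorem homogeneousDer_le (i : ZMod 2) : homogeneousDer 𝒜 i ≤ superDer 𝒜 := by
  fin_cases i
  · exact le_sup_left
  · exact le_sup_right

variable [GradedAlgebra 𝒜]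

/-- The component of parity `i` of an endomorphism. -/
def comp (i : ZMod 2) : Module.End ℝ A →ₗ[ℝ] Module.End ℝ A where
  toFun X := ∑ j : ZMod 2, GradedAlgebra.proj 𝒜 (i + j) ∘ₗ X ∘ₗ GradedAlgebra.proj 𝒜 j
  map_add' X Y := by
    simp only [LinearMap.add_comp, LinearMap.comp_add, Finset.sum_add_distrib]
  map_smul' c X := by
    simp only [LinearMap.smul_comp, LinearMap.comp_smul, Finset.smul_sum, RingHom.id_apply]

/-- The supercommutator: the bilinear extension of `[X, Y] = X Y - (-1)^{ij} Y X`, for `X` and `Y`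
of parity `i` and `j`. -/
def superComm : Module.End ℝ A →ₗ[ℝ] Module.End ℝ A →ₗ[ℝ] Module.End ℝ A :=
  LinearMap.mk₂ ℝ
    (fun X Y => ∑ i : ZMod 2, ∑ j : ZMod 2,
      (comp 𝒜 i X * comp 𝒜 j Y - superSign i j • (comp 𝒜 j Y * comp 𝒜 i X)))
    (fun X X' Y => by
      simp only [← Finset.sum_add_distrib]
      refine Finset.sum_congr rfl fun i _ => Finset.sum_congr rfl fun j _ => ?_
      simp only [map_add, add_mul, mul_add, smul_add]; abel)
    (fun c X Y => by
      simp only [Finset.smul_sum]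
      refine Finset.sum_congr rfl fun i _ => Finset.sum_congr rfl fun j _ => ?_
      simp only [map_smul, smul_mul_assoc, mul_smul_comm, smul_sub, smul_comm c])
    (fun X Y Y' => by
      simp only [← Finset.sum_add_distrib]
      refine Finset.sum_congr rfl fun i _ => Finset.sum_congr rfl fun j _ => ?_
      simp only [map_add, add_mul, mul_add, smul_add]; abel)
    (fun c X Y => by
      simp only [Finset.smul_sum]
      refine Finset.sum_congr rfl fun i _ => Finset.sum_congr rfl fun j _ => ?_
      simp only [map_smul, smul_mul_assoc, mul_smul_comm, smul_sub, smul_comm c])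

variable {𝒜}

theorem end_ext {X Y : Module.End ℝ A} (h : ∀ j, ∀ a ∈ 𝒜 j, X a = Y a) : X = Y := by
  ext a
  induction a using DirectSum.Decomposition.inductionOn 𝒜 with
  | zero => simp
  | homogeneous a => exact h _ _ a.2
  | add a b ha hb => rw [map_add, map_add, ha, hb]

theorem comp_eq {i : ZMod 2} {X : Module.End ℝ A} (hX : ∀ j, ∀ a ∈ 𝒜 j, X a ∈ 𝒜 (i + j))
    (k : ZMod 2) : comp 𝒜 k X = if k = i then X else 0 := by
  refine end_ext (𝒜 := 𝒜) fun j a ha => ?_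
  simp only [comp, LinearMap.coe_mk, AddHom.coe_mk, LinearMap.sum_apply, LinearMap.comp_apply,
    GradedAlgebra.proj_apply]
  rw [Finset.sum_eq_single j]
  · rw [DirectSum.decompose_of_mem_same _ ha]
    split_ifs with h
    · subst h
      rw [DirectSum.decompose_of_mem_same _ (hX j a ha)]
    · rw [DirectSum.decompose_of_mem_ne _ (hX j a ha) (fun e => h (add_right_cancel e).symm)]
      rfl
  · intro l _ hl
    rw [DirectSum.decompose_of_mem_ne _ ha hl.symm]
    simp
  · simp

theorem superComm_apply {i j : ZMod 2} {X Y : Module.End ℝ A}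
    (hX : X ∈ homogeneousDer 𝒜 i) (hY : Y ∈ homogeneousDer 𝒜 j) :
    superComm 𝒜 X Y = X * Y - superSign i j • (Y * X) := by
  rw [superComm, LinearMap.mk₂_apply, Finset.sum_eq_single i, Finset.sum_eq_single j]
  · simp [comp_eq hX.1, comp_eq hY.1]
  · intro k _ hk
    simp [comp_eq hY.1, hk]
  · simp
  · intro k _ hk
    simp [comp_eq hX.1, hk]
  · simp

theorem superComm_mem {i j : ZMod 2} {X Y : Module.End ℝ A}
    (hX : X ∈ homogeneousDer 𝒜 i) (hY : Y ∈ homogeneousDer 𝒜 j) :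
    superComm 𝒜 X Y ∈ homogeneousDer 𝒜 (i + j) := by
  rw [superComm_apply hX hY]
  refine ⟨fun k a ha => ?_, fun k a ha b => ?_⟩
  · have h1 := hX.1 _ _ (hY.1 _ _ ha)
    have h2 := hY.1 _ _ (hX.1 _ _ ha)
    rw [← add_assoc] at h1 h2
    rw [add_comm j i] at h2
    exact sub_mem h1 (Submodule.smul_mem _ _ h2)
  · simp only [LinearMap.sub_apply, LinearMap.smul_apply, Module.End.mul_apply, hX.2 _ _ ha,
      hY.2 _ _ ha, map_add, map_smul, hX.2 _ _ (hY.1 _ _ ha), hY.2 _ _ (hX.1 _ _ ha)]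
    rcases parity_cases i with rfl | rfl <;> rcases parity_cases j with rfl | rfl <;>
      rcases parity_cases k with rfl | rfl <;>
      simp [parity_one_add_one, sub_mul, mul_sub, add_mul, mul_add] <;> abel

theorem superComm_mem_superDer {X Y : Module.End ℝ A}
    (hX : X ∈ superDer 𝒜) (hY : Y ∈ superDer 𝒜) : superComm 𝒜 X Y ∈ superDer 𝒜 := by
  obtain ⟨X0, hX0, X1, hX1, rfl⟩ := Submodule.mem_sup.1 hX
  obtain ⟨Y0, hY0, Y1, hY1, rfl⟩ := Submodule.mem_sup.1 hY
  simp only [map_add, LinearMap.add_apply]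
  exact add_mem
    (add_mem (homogeneousDer_le 𝒜 _ (superComm_mem hX0 hY0))
      (homogeneousDer_le 𝒜 _ (superComm_mem hX1 hY0)))
    (add_mem (homogeneousDer_le 𝒜 _ (superComm_mem hX0 hY1))
      (homogeneousDer_le 𝒜 _ (superComm_mem hX1 hY1)))

theorem superComm_skew {i j : ZMod 2} {X Y : Module.End ℝ A}
    (hX : X ∈ homogeneousDer 𝒜 i) (hY : Y ∈ homogeneousDer 𝒜 j) :
    superComm 𝒜 X Y = -(superSign i j • superComm 𝒜 Y X) := by
  rw [superComm_apply hX hY, superComm_apply hY hX]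
  refine LinearMap.ext fun a => ?_
  rcases parity_cases i with rfl | rfl <;> rcases parity_cases j with rfl | rfl <;>
    simp

theorem superComm_jacobi {i j k : ZMod 2} {X Y Z : Module.End ℝ A}
    (hX : X ∈ homogeneousDer 𝒜 i) (hY : Y ∈ homogeneousDer 𝒜 j) (hZ : Z ∈ homogeneousDer 𝒜 k) :
    superComm 𝒜 X (superComm 𝒜 Y Z) = superComm 𝒜 (superComm 𝒜 X Y) Z +
      superSign i j • superComm 𝒜 Y (superComm 𝒜 X Z) := by
  rw [superComm_apply hX (superComm_mem hY hZ), superComm_apply (superComm_mem hX hY) hZ,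
    superComm_apply hY (superComm_mem hX hZ), superComm_apply hX hY, superComm_apply hY hZ,
    superComm_apply hX hZ]
  refine LinearMap.ext fun a => ?_
  rcases parity_cases i with rfl | rfl <;> rcases parity_cases j with rfl | rfl <;>
    rcases parity_cases k with rfl | rfl <;>
    simp [parity_one_add_one] <;> abel

variable (𝒜)

/-- The Lie superalgebra of superderivations of a superalgebra `A`, with the supercommutator. If
`A` is the superalgebra of functions on a supermanifold, this is the Lie superalgebra of its
vector fields. -/
def vectorFields : LieSuperalgebra (superDer 𝒜) where
  parity i := (homogeneousDer 𝒜 i).submoduleOf (superDer 𝒜)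
  isCompl_parity := by
    constructor
    · rw [Submodule.disjoint_def]
      intro X h0 h1
      have h := comp_eq (𝒜 := 𝒜) h0.1 1
      rw [comp_eq (𝒜 := 𝒜) h1.1 1] at h
      simpa using h
    · rw [codisjoint_iff, Submodule.eq_top_iff']
      rintro ⟨X, hX⟩
      obtain ⟨X0, hX0, X1, hX1, rfl⟩ := Submodule.mem_sup.1 hX
      exact Submodule.mem_sup.2 ⟨⟨X0, homogeneousDer_le 𝒜 0 hX0⟩, hX0,
        ⟨X1, homogeneousDer_le 𝒜 1 hX1⟩, hX1, rfl⟩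
  bracket := LinearMap.mk₂ ℝ
    (fun X Y => ⟨superComm 𝒜 X Y, superComm_mem_superDer X.2 Y.2⟩)
    (fun X X' Y => by ext1; simp) (fun c X Y => by ext1; simp)
    (fun X Y Y' => by ext1; simp) (fun c X Y => by ext1; simp)
  bracket_mem hX hY := superComm_mem hX hY
  skew hX hY := Subtype.ext (superComm_skew hX hY)
  jacobi hX hY hZ := Subtype.ext (superComm_jacobi hX hY hZ)

end Derivations

/-! ### The exterior algebra and its degree operator -/

section Exterior

variable (W : Type*) [AddCommGroup W] [Module ℝ W]

/-- The operator on the exterior algebra that multiplies `⋀ᵏ W` by `k`. -/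
def degreeOp : ExteriorAlgebra ℝ W →ₗ[ℝ] ExteriorAlgebra ℝ W :=
  DirectSum.toModule ℝ ℕ _ (fun k : ℕ => (k : ℝ) • (⋀[ℝ]^k W).subtype) ∘ₗ
    (DirectSum.decomposeLinearEquiv (fun k : ℕ => ⋀[ℝ]^k W)).toLinearMap

/-- The even (`i = 0`) and the odd (`i = 1`) part of the exterior algebra. -/
def extParity (i : ZMod 2) : Submodule ℝ (ExteriorAlgebra ℝ W) :=
  ⨆ k : {k : ℕ // (k : ZMod 2) = i}, ⋀[ℝ]^(k : ℕ) W

variable {W}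

theorem degreeOp_of_mem {k : ℕ} {a : ExteriorAlgebra ℝ W} (ha : a ∈ ⋀[ℝ]^k W) :
    degreeOp W a = (k : ℝ) • a := by
  rw [degreeOp, LinearMap.comp_apply, LinearEquiv.coe_coe, DirectSum.decomposeLinearEquiv_apply,
    DirectSum.decompose_of_mem (fun k : ℕ => ⋀[ℝ]^k W) ha, ← DirectSum.lof_eq_of ℝ, DirectSum.toModule_lof]
  rfl

theorem ext_induction {C : ExteriorAlgebra ℝ W → Prop} (h0 : C 0)
    (hadd : ∀ a b, C a → C b → C (a + b)) (hk : ∀ (k : ℕ) (a), a ∈ ⋀[ℝ]^k W → C a)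
    (a : ExteriorAlgebra ℝ W) : C a := by
  induction a using DirectSum.Decomposition.inductionOn (fun k : ℕ => ⋀[ℝ]^k W) with
  | zero => exact h0
  | homogeneous a => exact hk _ _ a.2
  | add a b ha hb => exact hadd a b ha hb

theorem degreeOp_mul (a b : ExteriorAlgebra ℝ W) :
    degreeOp W (a * b) = degreeOp W a * b + a * degreeOp W b := by
  induction a using ext_induction with
  | h0 => simp
  | hadd a a' ha ha' => simp only [add_mul, map_add, ha, ha']; abel
  | hk k a ha =>
    induction b using ext_induction with
    | h0 => simp
    | hadd b b' hb hb' => simp only [mul_add, map_add, hb, hb']; abel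
    | hk l b hb =>
      have hab : a * b ∈ ⋀[ℝ]^(k + l) W := SetLike.mul_mem_graded ha hb
      rw [degreeOp_of_mem ha, degreeOp_of_mem hb, degreeOp_of_mem hab]
      push_cast
      rw [add_smul, smul_mul_assoc, mul_smul_comm]

theorem map_mem_exteriorPower {W' : Type*} [AddCommGroup W'] [Module ℝ W'] (f : W →ₗ[ℝ] W')
    {k : ℕ} {a : ExteriorAlgebra ℝ W} (ha : a ∈ ⋀[ℝ]^k W) :
    ExteriorAlgebra.map f a ∈ ⋀[ℝ]^k W' := by
  have h : Submodule.map (ExteriorAlgebra.map f).toLinearMap (⋀[ℝ]^k W) ≤ ⋀[ℝ]^k W' := by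
    rw [ExteriorAlgebra.exteriorPower, ExteriorAlgebra.exteriorPower, Submodule.map_pow]
    refine pow_le_pow_left' ?_ k
    rintro _ ⟨_, ⟨w, rfl⟩, rfl⟩
    exact ⟨f w, (ExteriorAlgebra.map_apply_ι f w).symm⟩
  exact h ⟨a, ha, rfl⟩

theorem degreeOp_map {W' : Type*} [AddCommGroup W'] [Module ℝ W'] (f : W →ₗ[ℝ] W')
    (a : ExteriorAlgebra ℝ W) :
    degreeOp W' (ExteriorAlgebra.map f a) = ExteriorAlgebra.map f (degreeOp W a) := by
  induction a using ext_induction with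
  | h0 => simp
  | hadd a b ha hb => simp only [map_add, ha, hb]
  | hk k a ha =>
    rw [degreeOp_of_mem ha, degreeOp_of_mem (map_mem_exteriorPower f ha), map_smul]

theorem degreeOp_mem_extParity {i : ZMod 2} {a : ExteriorAlgebra ℝ W} (ha : a ∈ extParity W i) :
    degreeOp W a ∈ extParity W i := by
  have h : extParity W i ≤ (extParity W i).comap (degreeOp W) := by
    refine iSup_le fun k b hb => ?_
    rw [Submodule.mem_comap, degreeOp_of_mem hb]
    exact Submodule.smul_mem _ _
      (le_iSup (fun k : {k : ℕ // (k : ZMod 2) = i} => ⋀[ℝ]^(k : ℕ) W) k hb)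
  exact h ha

end Exterior

/-! ### Functions on `ΠV` -/

section Bundles

open Bundle

variable (s : ℕ) {M : Type*} [TopologicalSpace M] [ChartedSpace (EuclideanSpace ℝ (Fin s)) M]
  (F : Type*) [NormedAddCommGroup F] [NormedSpace ℝ F] [FiniteDimensional ℝ F]
  (V : M → Type*) [∀ x, AddCommGroup (V x)] [∀ x, Module ℝ (V x)]
  [TopologicalSpace (TotalSpace F V)] [∀ x, TopologicalSpace (V x)] [FiberBundle F V]
  [VectorBundle ℝ F V]

/-- The map `⋀ Vₓ* → ⋀ F*` given by the trivialization of `V` around `x₀`, for `x` in its domain. -/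
def localRep (x₀ x : M) :
    ExteriorAlgebra ℝ (Module.Dual ℝ (V x)) →ₐ[ℝ] ExteriorAlgebra ℝ (Module.Dual ℝ F) :=
  ExteriorAlgebra.map ((trivializationAt F V x₀).symmₗ ℝ x).dualMap

/-- The algebra `Γ(⋀ V*)` of smooth sections of the exterior bundle of the dual of `V`, with
the pointwise product. A section is smooth if all its coefficients with respect to the local
trivializations of `V` are smooth. -/
def exteriorSections : Subalgebra ℝ (∀ x : M, ExteriorAlgebra ℝ (Module.Dual ℝ (V x))) where
  carrier := {a | ∀ (x₀ : M) (ℓ : Module.Dual ℝ (ExteriorAlgebra ℝ (Module.Dual ℝ F))),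
    ContMDiffOn (𝓡 s) 𝓘(ℝ, ℝ) ∞ (fun x => ℓ (localRep F V x₀ x (a x)))
      (trivializationAt F V x₀).baseSet}
  mul_mem' := by
    intro a b ha hb x₀ ℓ
    let B := (Module.finBasis ℝ (Module.Dual ℝ F)).ExteriorAlgebra
    have key : ∀ u v : ExteriorAlgebra ℝ (Module.Dual ℝ F),
        ℓ (u * v) = ∑ i, ∑ j, B.coord i u * B.coord j v * ℓ (B i * B j) := by
      intro u v
      conv_lhs => rw [← B.sum_repr u, ← B.sum_repr v]
      simp only [Finset.sum_mul, Finset.mul_sum, map_sum, smul_mul_assoc, mul_smul_comm, map_smul,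
        smul_eq_mul, Module.Basis.coord_apply, mul_assoc]
      rw [Finset.sum_comm]
      refine Finset.sum_congr rfl fun i _ => Finset.sum_congr rfl fun j _ => ?_
      ring
    have hmul : (fun x => ℓ (localRep F V x₀ x ((a * b) x))) = fun x => ∑ i, ∑ j,
        B.coord i (localRep F V x₀ x (a x)) * B.coord j (localRep F V x₀ x (b x)) *
          ℓ (B i * B j) := by
      funext x
      rw [Pi.mul_apply, map_mul, key]
    rw [hmul]
    refine contMDiffOn_finsetSum fun i _ => contMDiffOn_finsetSum fun j _ => ?_
    exact ((ha x₀ (B.coord i)).mul (hb x₀ (B.coord j))).mul contMDiffOn_const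
  add_mem' := by
    intro a b ha hb x₀ ℓ
    simp only [Pi.add_apply, map_add]
    exact (ha x₀ ℓ).add (hb x₀ ℓ)
  algebraMap_mem' := by
    intro c x₀ ℓ
    simp only [Pi.algebraMap_apply, AlgHom.commutes]
    exact contMDiffOn_const

/-- The sections of parity `i`: those with values in the even (odd) part of the exterior algebra. -/
def sectionParity (i : ZMod 2) : Submodule ℝ (exteriorSections s F V) where
  carrier := {a | ∀ x, a.1 x ∈ extParity (Module.Dual ℝ (V x)) i}
  zero_mem' := fun _ => zero_mem _
  add_mem' := fun ha hb x => add_mem (ha x) (hb x)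
  smul_mem' := fun c _ ha x => Submodule.smul_mem _ c (ha x)

/-- The operator on `Γ(⋀ V*)` that multiplies `Γ(⋀ᵏ V*)` by `k`. -/
def sectionDegreeOp : exteriorSections s F V →ₗ[ℝ] exteriorSections s F V where
  toFun a := ⟨fun x => degreeOp _ (a.1 x), fun x₀ ℓ => by
    have h := a.2 x₀ (ℓ ∘ₗ degreeOp (Module.Dual ℝ F))
    simpa only [LinearMap.comp_apply, localRep, degreeOp_map] using h⟩
  map_add' a b := Subtype.ext (funext fun x => map_add (degreeOp _) (a.1 x) (b.1 x))
  map_smul' c a := Subtype.ext (funext fun x => map_smul (degreeOp _) c (a.1 x))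

variable {A : Type*} [Ring A] [Algebra ℝ A] (𝒜 : ZMod 2 → Submodule ℝ A)

/-- An isomorphism of superalgebras `A ≃ Γ(⋀ V*)`, where `A = 𝒜 0 ⊕ 𝒜 1`. -/
structure Splitting where
  iso : A ≃ₐ[ℝ] exteriorSections s F V
  mem_parity_iff : ∀ (i : ZMod 2) (a : A), iso a ∈ sectionParity s F V i ↔ a ∈ 𝒜 i

namespace Splitting

variable {s F V 𝒜} (φ : Splitting s F V 𝒜)

/-- The Euler vector field of a splitting: it multiplies the functions of degree `k` by `k`. -/
def eulerField : superDer 𝒜 :=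
  ⟨φ.iso.symm.toLinearMap ∘ₗ sectionDegreeOp s F V ∘ₗ φ.iso.toLinearMap,
    homogeneousDer_le 𝒜 0 ⟨by
      intro j a ha
      rw [zero_add, ← φ.mem_parity_iff]
      have h := (φ.mem_parity_iff j a).2 ha
      simp only [LinearMap.comp_apply, AlgEquiv.toLinearMap_apply, AlgEquiv.apply_symm_apply]
      exact fun x => degreeOp_mem_extParity (h x), by
      intro j a _ b
      rw [superSign_zero_left, one_smul]
      apply φ.iso.injective
      simp only [LinearMap.comp_apply, AlgEquiv.toLinearMap_apply, map_add, map_mul,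
        AlgEquiv.apply_symm_apply]
      exact Subtype.ext (funext fun x => degreeOp_mul _ _)⟩⟩

variable [GradedAlgebra 𝒜]

/-- The vector fields of degree `k`: the `X` with `[ε, X] = k X`, for the Euler field `ε`. -/
def degreePart (k : ℤ) : Submodule ℝ (superDer 𝒜) where
  carrier := {X | (vectorFields 𝒜).bracket φ.eulerField X = (k : ℝ) • X}
  zero_mem' := by simp
  add_mem' := by
    intro X Y hX hY
    simp only [Set.mem_ofPred_eq] at hX hY ⊢
    rw [map_add, hX, hY, smul_add]
  smul_mem' := by
    intro c X hX
    simp only [Set.mem_ofPred_eq] at hX ⊢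
    rw [map_smul, hX, smul_comm]

end Splitting

end Bundles

end SuperVF

end

open SuperVF

/-!
The canonical filtration of the Lie superalgebra of vector fields of a supermanifold is the
filtration `𝔤⁽ᵖ⁾ = 𝔤ᵖ ⊕ 𝔤ᵖ⁺² ⊕ …` by the degrees of *any* Euler field. All assertions follow once
three facts about the components `𝔤ᵏ` are known (`EulerGrading`): they span `𝔤` and vanish for
`k < -1` and for `k > r`; `𝔤ᑫ⁺² = [𝔤², 𝔤ᑫ]` for `q ≥ -1`; and an ad-nilpotent ideal of `𝔤₀` contains
no nonzero element of `𝔤⁰`.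

Indeed, an ideal is stable under polynomials in `ad ε`, hence contains the degree `0` components of
its elements, so that all ad-nilpotent ideals are contained in `𝔤² ⊕ 𝔤⁴ ⊕ …`
(`EulerGrading.le_tail_of_isAdNilpotentIdeal`). This sum is itself an ad-nilpotent ideal, as it
raises degrees. It is therefore the greatest ad-nilpotent ideal, which does not depend on the Euler
field, and brackets with it lead from the parity parts to the `𝔤⁽ᵖ⁾` (`EulerGrading.lower_tail`).
Automorphisms preserve a filtration defined in this way, and since `𝔤ᵖ` is a complement of `𝔤⁽ᵖ⁺²⁾`
in `𝔤⁽ᵖ⁾`, the associated graded algebra is `𝔤` (`EulerGrading.grEquivSelf`).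

The three facts are proved by algebra from an `EulerFrame`: finitely many even coordinates `y` and
odd coordinates `η` of degrees `0` and `1`, with vector fields `D` and `E` of degrees `0` and `-1`,
such that `X = ∑ X(y) D + ∑ X(η) E` for every vector field `X`, and with traces `∑ D(y) = s` and
`∑ E(η) = r`. The coordinates need not be independent; only the expansion and the traces are used.

* The equality `𝔤ᑫ⁺² = [𝔤², 𝔤ᑫ]` (`EulerFrame.eulerDer_add_two_le`). Brackets of multiples of `e`,
  of `D` and of `E` are computed explicitly and summed over the coordinates. The traces turn the
  sums into scalar multiples of the desired vector field modulo known brackets, with the factors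
  `r - 2` or `s` for multiples of fields of degree `-1` and `r - 1` or `s + 1` for multiples of
  fields of degree `0`. This is where the assumption `r > 2`, or `s > 0` and `r > 1`, enters. For
  `q = 2` one of the auxiliary brackets degenerates, and `EulerFrame.smul_mem_commutatorSpan_two`
  replaces it.
* The statement about ideals (`EulerFrame.eq_zero_of_mem_adNilpotent`). The functions of degree `0`
  form a reduced ring, on which a nilpotent derivation vanishes, since `Xᵐ(gᵐ) = m! (X g)ᵐ` if
  `X² g = 0`. The coefficients of the action on functions of degree `1` are treated by brackets with
  the fields `a D`.

Euler frames exist on every supermanifold, compact or not (`Splitting.exists_eulerFrame`). A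
manifold of dimension `s` is covered by `s + 1` open sets, each a disjoint union of open pieces
contained in the domains of a chart and of a trivialization (`exists_finite_colouring`): generic
level sets of the functions of a bump covering cut the manifold into such pieces, and what is cut
out has one dimension less in the sense of Hausdorff measure, by an inequality of Eilenberg. The
local coordinates and frames over the pieces of one set, multiplied by cutoff functions, form a
single system of global coordinates, in which superderivations are expanded by Hadamard's lemma
(`FramePatch.expansion`). A partition of unity with `s + 1` members adds up the systems.
-/

noncomputable section

namespace SuperVF

/-! ### Colouring a manifold with finitely many colours -/

section Colouring

open MeasureTheory Set Filter Topology
open scoped NNReal ENNReal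

/-- The null case of the coarea inequality of Eilenberg. The functions
`t ↦ ∑ₖ (diam Tₖ)ᵈ · 1[t ∈ Iₖ]`, with `T` a fine covering of `E` and `Iₖ ⊇ g(Tₖ)` an interval of
length comparable to `diam Tₖ`, bound the measures of the fibres and have integrals tending to zero,
so that Fatou's lemma applies. -/
theorem ae_hausdorffMeasure_inter_fiber_eq_zero {X : Type*} [MetricSpace X] [MeasurableSpace X]
    [BorelSpace X] {E : Set X} {g : X → ℝ} {K : ℝ≥0} (hg : LipschitzOnWith K g E) {d : ℝ}
    (hd : 0 ≤ d) (hE : μH[d + 1] E = 0) : ∀ᵐ t : ℝ, μH[d] (E ∩ g ⁻¹' {t}) = 0 := by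
  have hcov : ∀ r : ℝ≥0∞, 0 < r → ∃ T : ℕ → Set X, E ⊆ ⋃ n, T n ∧ (∀ n, T n ⊆ E) ∧
      (∀ n, Metric.ediam (T n) ≤ r) ∧
      ∑' n, (⨆ _ : (T n).Nonempty, Metric.ediam (T n) ^ (d + 1)) ≤ r := by
    intro r hr
    rw [Measure.hausdorffMeasure_apply] at hE
    have h1 := (iSup₂_eq_bot.1 hE) r hr
    have h2 : (⨅ (t : ℕ → Set X) (_ : E ⊆ ⋃ n, t n) (_ : ∀ n, Metric.ediam (t n) ≤ r),
          ∑' n, ⨆ _ : (t n).Nonempty, Metric.ediam (t n) ^ (d + 1)) < r := by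
      rw [h1]; exact hr
    simp only [iInf_lt_iff] at h2
    obtain ⟨T, hT1, hT2, hT3⟩ := h2
    refine ⟨fun n => T n ∩ E, fun x hx => ?_, fun n => inter_subset_right, fun n =>
      (Metric.ediam_mono inter_subset_left).trans (hT2 n), le_trans ?_ hT3.le⟩
    · obtain ⟨n, hn⟩ := mem_iUnion.1 (hT1 hx)
      exact mem_iUnion.2 ⟨n, hn, hx⟩
    · refine ENNReal.tsum_le_tsum fun n => iSup_le fun hne => ?_
      exact le_trans (ENNReal.rpow_le_rpow (Metric.ediam_mono inter_subset_left) (by linarith))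
        (le_iSup (fun _ : (T n).Nonempty => Metric.ediam (T n) ^ (d + 1))
          (hne.mono inter_subset_left))
  have hr0 : ∀ n : ℕ, (0 : ℝ≥0∞) < ((n : ℝ≥0∞) + 1)⁻¹ := fun n =>
    ENNReal.inv_pos.2 (by finiteness)
  choose T hT1 hT2 hT3 hT4 using fun n : ℕ => hcov _ (hr0 n)
  have hlim : Tendsto (fun n : ℕ => ((n : ℝ≥0∞) + 1)⁻¹) atTop (𝓝 0) := by
    have := (tendsto_add_atTop_iff_nat 1).2 ENNReal.tendsto_inv_nat_nhds_zero
    simpa using this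
  -- an interval that contains the image of `T n k`
  have hI : ∀ n k, ∃ I : Set ℝ, MeasurableSet I ∧ g '' T n k ⊆ I ∧
      volume I * Metric.ediam (T n k) ^ d ≤
        2 * K * ⨆ _ : (T n k).Nonempty, Metric.ediam (T n k) ^ (d + 1) := by
    intro n k
    rcases (T n k).eq_empty_or_nonempty with h | ⟨p, hp⟩
    · exact ⟨∅, MeasurableSet.empty, by simp [h], by simp⟩
    · refine ⟨Metric.closedEBall (g p) (K * Metric.ediam (T n k)),
        Metric.isClosed_closedEBall.measurableSet, ?_, ?_⟩
      · rintro _ ⟨q, hq, rfl⟩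
        refine (hg (hT2 n k hq) (hT2 n k hp)).trans ?_
        gcongr
        exact Metric.edist_le_ediam_of_mem hq hp
      · rw [Real.volume_closedEBall, ciSup_pos ⟨p, hp⟩, add_comm d,
          ENNReal.rpow_add_of_nonneg _ _ zero_le_one hd, ENNReal.rpow_one]
        apply le_of_eq; ring
  choose I hIm hIs hIv using hI
  set h : ℕ → ℝ → ℝ≥0∞ := fun n t => ∑' k, (I n k).indicator (fun _ => Metric.ediam (T n k) ^ d) t
  have hm : ∀ n, Measurable (h n) := fun n =>
    Measurable.tsum fun k => measurable_const.indicator (hIm n k)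
  have hint : ∀ n, ∫⁻ t, h n t ≤ 2 * K * ((n : ℝ≥0∞) + 1)⁻¹ := by
    intro n
    rw [lintegral_tsum fun k => (measurable_const.indicator (hIm n k)).aemeasurable]
    calc _ ≤ ∑' k, 2 * K * ⨆ _ : (T n k).Nonempty, Metric.ediam (T n k) ^ (d + 1) := by
          refine ENNReal.tsum_le_tsum fun k => ?_
          rw [lintegral_indicator_const (hIm n k), mul_comm]
          exact hIv n k
      _ ≤ _ := by
          rw [ENNReal.tsum_mul_left]
          gcongr
          exact hT4 n
  have hlim2 : Tendsto (fun n : ℕ => 2 * K * ((n : ℝ≥0∞) + 1)⁻¹) atTop (𝓝 0) := by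
    have := ENNReal.Tendsto.const_mul (a := 2 * (K : ℝ≥0∞)) hlim (Or.inr (by finiteness))
    simpa using this
  have hzero : ∫⁻ t, liminf (fun n => h n t) atTop = 0 := by
    refine le_antisymm ((lintegral_liminf_le hm).trans ?_) (zero_le)
    rw [← hlim2.liminf_eq]
    exact liminf_le_liminf (Eventually.of_forall hint)
  rw [lintegral_eq_zero_iff (Measurable.liminf hm)] at hzero
  filter_upwards [hzero] with t ht
  refine le_antisymm (le_trans ?_ (le_of_eq ht)) zero_le
  refine (Measure.hausdorffMeasure_le_liminf_tsum (ι := fun n => {k // t ∈ I n k}) d _ _ hlim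
    (fun n k => T n k) (Eventually.of_forall fun n k => hT3 n k)
    (Eventually.of_forall fun n => ?_)).trans (liminf_le_liminf (Eventually.of_forall fun n => ?_))
  · rintro x ⟨hx, rfl⟩
    obtain ⟨k, hk⟩ := mem_iUnion.1 (hT1 n hx)
    exact mem_iUnion.2 ⟨⟨k, hIs n k ⟨x, hk, rfl⟩⟩, hk⟩
  · refine (tsum_subtype {k | t ∈ I n k} fun k => Metric.ediam (T n k) ^ d).le.trans
      (ENNReal.tsum_le_tsum fun k => ?_)
    by_cases hk : t ∈ I n k <;> simp [indicator, hk]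

/-- The statement for functions that are only locally Lipschitz, by a countable covering. -/
theorem ae_hausdorffMeasure_inter_fiber_eq_zero_of_local {X : Type*} [MetricSpace X]
    [MeasurableSpace X] [BorelSpace X] [SecondCountableTopology X] {E : Set X} {g : X → ℝ}
    (hg : ∀ x ∈ E, ∃ K : ℝ≥0, ∃ u ∈ 𝓝[E] x, LipschitzOnWith K g u) {d : ℝ}
    (hd : 0 ≤ d) (hE : μH[d + 1] E = 0) : ∀ᵐ t : ℝ, μH[d] (E ∩ g ⁻¹' {t}) = 0 := by
  choose! K u hu hL using hg
  obtain ⟨t, htE, htc, ht⟩ := TopologicalSpace.countable_cover_nhdsWithin hu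
  have key : ∀ x ∈ t, ∀ᵐ a : ℝ, μH[d] ((E ∩ u x) ∩ g ⁻¹' {a}) = 0 := fun x hx =>
    ae_hausdorffMeasure_inter_fiber_eq_zero ((hL x (htE hx)).mono inter_subset_right) hd
      (measure_mono_null inter_subset_left hE)
  filter_upwards [(ae_ball_iff htc).2 key] with a ha
  refine measure_mono_null ?_ ((measure_biUnion_null_iff htc).2 ha)
  rintro x ⟨hx, hxa⟩
  obtain ⟨y, hy, hxy⟩ := mem_iUnion₂.1 (ht hx)
  exact mem_iUnion₂.2 ⟨y, hy, ⟨hx, hxy⟩, hxa⟩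

variable {s : ℕ} {M : Type*} [TopologicalSpace M] [ChartedSpace (EuclideanSpace ℝ (Fin s)) M]

/-- The sets whose images in the charts centred at the points of `Q` have vanishing
`d`-dimensional Hausdorff measure. It is of interest for countable `Q` whose charts cover `M`. -/
def ChartNull (s : ℕ) {M : Type*} [TopologicalSpace M]
    [ChartedSpace (EuclideanSpace ℝ (Fin s)) M] (Q : Set M) (d : ℝ) (S : Set M) : Prop :=
  ∀ x ∈ Q, μH[d] (chartAt (EuclideanSpace ℝ (Fin s)) x ''
    (S ∩ (chartAt (EuclideanSpace ℝ (Fin s)) x).source)) = 0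

/-- A generic level set of a smooth function meets a null set in a set that is null in one dimension
less. -/
theorem ChartNull.ae_fiber [IsManifold (𝓡 s) ∞ M] {Q : Set M} (hQ : Q.Countable) {d : ℝ}
    (hd : 0 ≤ d) {S : Set M} (hS : ChartNull s Q (d + 1) S) {f : M → ℝ}
    (hf : ContMDiff (𝓡 s) 𝓘(ℝ, ℝ) ∞ f) : ∀ᵐ t : ℝ, ChartNull s Q d (S ∩ f ⁻¹' {t}) := by
  refine (ae_ball_iff hQ).2 fun x hx => ?_
  set e := chartAt (EuclideanSpace ℝ (Fin s)) x
  have hc : ContDiffOn ℝ ∞ (f ∘ e.symm) e.target := by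
    rw [← contMDiffOn_iff_contDiffOn]
    exact hf.comp_contMDiffOn (contMDiffOn_chart_symm (I := 𝓡 s) (x := x))
  have key := ae_hausdorffMeasure_inter_fiber_eq_zero_of_local (g := f ∘ e.symm)
    (E := e '' (S ∩ e.source)) (by
      rintro _ ⟨y, ⟨-, hy⟩, rfl⟩
      obtain ⟨K, u, hu, hL⟩ := ((hc.contDiffAt (e.open_target.mem_nhds
        (e.map_source hy))).of_le (by simp)).exists_lipschitzOnWith
      exact ⟨K, u, mem_nhdsWithin_of_mem_nhds hu, hL⟩) hd (hS x hx)
  filter_upwards [key] with t ht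
  refine measure_mono_null ?_ ht
  rintro _ ⟨y, ⟨⟨hy1, hy2⟩, hy3⟩, rfl⟩
  refine ⟨⟨y, ⟨hy1, hy3⟩, rfl⟩, ?_⟩
  simpa [e.left_inv hy3] using hy2

theorem ChartNull.iUnion {Q : Set M} {d : ℝ} {ι : Type*} [Countable ι] {S : ι → Set M}
    (h : ∀ i, ChartNull s Q d (S i)) : ChartNull s Q d (⋃ i, S i) := by
  intro x hx
  rw [iUnion_inter, image_iUnion, measure_iUnion_null_iff]
  exact fun i => h i x hx

variable [T2Space M] [SecondCountableTopology M] [IsManifold (𝓡 s) ∞ M]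

/-- Removing generic level sets of the functions of a bump covering leaves an open set that is a
disjoint union of pieces contained in sets `O x`, with `x` constant on each piece. -/
theorem ChartNull.exists_isOpen_diff {Q : Set M} (hQ : Q.Countable) {d : ℝ}
    (hd : 0 ≤ d) {S : Set M} (hS : ChartNull s Q (d + 1) S) {O : M → Set M}
    (hO : ∀ x, O x ∈ 𝓝 x) : ∃ (W : Set M) (j : M → M), IsOpen W ∧
      (∀ x ∈ W, x ∈ O (j x) ∧ ∀ᶠ y in 𝓝 x, j y = j x) ∧ ChartNull s Q d (S \ W) := by
  classical
  have : LocallyCompactSpace M := ChartedSpace.locallyCompactSpace (EuclideanSpace ℝ (Fin s)) M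
  obtain ⟨ι, ρ, hρ⟩ := SmoothBumpCovering.exists_isSubordinate (𝓡 s) isClosed_univ
    (U := O) (fun x _ => hO x)
  have hlf := ρ.locallyFinite
  have : Countable ι := by
    have h := hlf.countable_univ fun i => ⟨ρ.c i, by simp⟩
    exact countable_univ_iff.1 h
  have hae : ∀ i, ∃ t ∈ Ioo (0 : ℝ) 1, ChartNull s Q d (S ∩ ρ i ⁻¹' {t}) := by
    intro i
    have h1 := hS.ae_fiber hQ hd (f := ρ i) (ρ i).contMDiff
    have h2 : (volume.restrict (Ioo (0 : ℝ) 1)) ≠ 0 := by simp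
    have : (ae (volume.restrict (Ioo (0 : ℝ) 1))).NeBot := ae_neBot.2 h2
    obtain ⟨t, ht⟩ := ((ae_restrict_mem (μ := volume)
      (measurableSet_Ioo (a := (0 : ℝ)) (b := 1))).and (ae_restrict_of_ae h1)).exists
    exact ⟨t, ht⟩
  choose t ht htS using hae
  -- near every point outside the level sets the set of indices with `ρ i > t i` is constant
  let P : M → Set ι := fun x => {i | t i < ρ i x}
  let W : Set M := {x | ∀ i, ρ i x ≠ t i}
  have hev : ∀ x ∈ W, ∀ᶠ y in 𝓝 x, (∀ i, ρ i y ≠ t i) ∧ P y = P x := by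
    intro x hx
    obtain ⟨u, hu, hfin⟩ := hlf x
    have h1 : ∀ᶠ y in 𝓝 x, ∀ i ∈ {i | (Function.support (ρ i) ∩ u).Nonempty},
        ρ i y ≠ t i ∧ (t i < ρ i y ↔ t i < ρ i x) := by
      refine (Filter.eventually_all_finite hfin).2 fun i _ => ?_
      have hc : ContinuousAt (ρ i) x := (ρ i).continuous.continuousAt
      rcases lt_or_gt_of_ne (hx i) with h | h
      · filter_upwards [hc.eventually_lt continuousAt_const h] with y hy
        exact ⟨hy.ne, iff_of_false hy.le.not_gt h.le.not_gt⟩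
      · filter_upwards [continuousAt_const.eventually_lt hc h] with y hy
        exact ⟨hy.ne', iff_of_true hy h⟩
    filter_upwards [h1, hu] with y hy hyu
    have hxu := mem_of_mem_nhds hu
    have hz : ∀ i, ¬ (Function.support (ρ i) ∩ u).Nonempty → ρ i y = 0 ∧ ρ i x = 0 := by
      intro i hi
      constructor
      · by_contra h; exact hi ⟨y, h, hyu⟩
      · by_contra h; exact hi ⟨x, h, hxu⟩
    refine ⟨fun i => ?_, ?_⟩
    · by_cases hi : (Function.support (ρ i) ∩ u).Nonempty
      · exact (hy i hi).1
      · rw [(hz i hi).1]; exact (ht i).1.ne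
    · ext i
      by_cases hi : (Function.support (ρ i) ∩ u).Nonempty
      · exact (hy i hi).2
      · simp [P, (hz i hi).1, (hz i hi).2]
  refine ⟨W, fun x => if h : (P x).Nonempty then ρ.c h.some else x, ?_, ?_, ?_⟩
  · rw [isOpen_iff_mem_nhds]
    intro x hx
    filter_upwards [hev x hx] with y hy
    exact hy.1
  · intro x hx
    have hne : ∀ y, (P y).Nonempty := by
      intro y
      refine ⟨ρ.ind y (mem_univ y), ?_⟩
      simp only [P, mem_ofPred_eq, ρ.apply_ind]
      exact (ht _).2
    simp only [dif_pos (hne _)]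
    constructor
    · refine hρ.support_subset ?_ (i := (hne x).some)
      have h := (hne x).some_mem
      exact ((ht _).1.trans h).ne'
    · filter_upwards [hev x hx] with y hy
      congr 1
      have : ∀ (A B : Set ι) (hA : A.Nonempty) (hB : B.Nonempty), A = B → hA.some = hB.some := by
        rintro A B hA hB rfl; rfl
      exact this _ _ _ _ hy.2
  · have : S \ W = ⋃ i, S ∩ ρ i ⁻¹' {t i} := by
      ext x
      simp [W]
    rw [this]
    exact ChartNull.iUnion htS

/-- A manifold of dimension `s` is covered by `s + 1` open sets, each of which is a disjoint union
of open pieces contained in prescribed neighbourhoods; the function `j c` selects, on the `c`-th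
set, the centre of the neighbourhood. Each set leaves uncovered a set of a dimension smaller by one,
in the sense of Hausdorff measure, and nothing is left after `s + 1` steps. -/
theorem exists_finite_colouring (O : M → Set M) (hO : ∀ x, O x ∈ 𝓝 x) :
    ∃ (W : Fin (s + 1) → Set M) (j : Fin (s + 1) → M → M), (∀ c, IsOpen (W c)) ∧
      (∀ c, ∀ x ∈ W c, x ∈ O (j c x) ∧ ∀ᶠ y in 𝓝 x, j c y = j c x) ∧ ⋃ c, W c = univ := by
  obtain ⟨Q, hQc, hQ⟩ := TopologicalSpace.countable_cover_nhds
    fun x : M => (chartAt (EuclideanSpace ℝ (Fin s)) x).open_source.mem_nhds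
      (mem_chart_source (EuclideanSpace ℝ (Fin s)) x)
  have step : ∀ n : ℕ, ∀ S : Set M, ChartNull s Q n S →
      ∃ (W : Fin n → Set M) (j : Fin n → M → M), (∀ c, IsOpen (W c)) ∧
      (∀ c, ∀ x ∈ W c, x ∈ O (j c x) ∧ ∀ᶠ y in 𝓝 x, j c y = j c x) ∧ S ⊆ ⋃ c, W c := by
    intro n
    induction n with
    | zero =>
      intro S hS
      refine ⟨Fin.elim0, Fin.elim0, fun c => c.elim0, fun c => c.elim0, fun x hx => ?_⟩
      exfalso
      have hxQ : x ∈ ⋃ x ∈ Q, (chartAt (EuclideanSpace ℝ (Fin s)) x).source := by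
        rw [hQ]; trivial
      obtain ⟨y, hy, hxy⟩ := mem_iUnion₂.1 hxQ
      have hxS : x ∈ S ∩ (chartAt (EuclideanSpace ℝ (Fin s)) y).source := ⟨hx, hxy⟩
      -- the Hausdorff measure of dimension `0` counts points, so only the empty set is null
      have h := measure_mono_null (singleton_subset_iff.2 (mem_image_of_mem
        (chartAt (EuclideanSpace ℝ (Fin s)) y) hxS)) (hS y hy)
      simp at h
    | succ n ih =>
      intro S hS
      obtain ⟨W0, j0, hW0, hj0, hS0⟩ := ChartNull.exists_isOpen_diff hQc (d := n) (by positivity)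
        (by exact_mod_cast hS) hO
      obtain ⟨W, j, hW, hj, hSW⟩ := ih _ hS0
      refine ⟨Fin.cons W0 W, Fin.cons j0 j, Fin.cases hW0 hW, Fin.cases hj0 hj, fun x hx => ?_⟩
      by_cases h : x ∈ W0
      · exact mem_iUnion.2 ⟨0, h⟩
      · obtain ⟨c, hc⟩ := mem_iUnion.1 (hSW ⟨hx, h⟩)
        exact mem_iUnion.2 ⟨c.succ, hc⟩
  -- in `ℝˢ` the Hausdorff measure of dimension `s + 1` vanishes
  obtain ⟨W, j, h1, h2, h3⟩ := step (s + 1) univ fun x _ => by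
    rw [Real.hausdorffMeasure_of_finrank_lt (by simp)]
    rfl
  exact ⟨W, j, h1, h2, univ_subset_iff.1 h3⟩

end Colouring

/-! ### Hadamard's lemma -/

section Hadamard

open MeasureTheory Set Filter Topology

/-- Differentiation under the integral sign, to any order. The induction on `n` replaces the
integrand by its derivative, so that the target space has to vary; `E` and `F` lie in `Type` to
allow this. -/
theorem contDiff_intervalIntegral_param {E : Type} [NormedAddCommGroup E] [NormedSpace ℝ E]
    [FiniteDimensional ℝ E] (n : ℕ) : ∀ {F : Type} [NormedAddCommGroup F] [NormedSpace ℝ F]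
    [CompleteSpace F] {h : E × ℝ → F}, ContDiff ℝ n h →
    ContDiff ℝ n fun y => ∫ t in (0 : ℝ)..1, h (y, t) := by
  induction n with
  | zero =>
    intro F _ _ _ h hh
    rw [CharP.cast_eq_zero, contDiff_zero] at hh ⊢
    exact intervalIntegral.continuous_parametric_intervalIntegral_of_continuous'
      (f := fun y t => h (y, t)) (hh : Continuous fun z : E × ℝ => h (z.1, z.2)) 0 1
  | succ n ih =>
    intro F _ _ _ h hh
    have hproper : ProperSpace E := FiniteDimensional.proper_real E
    set h' : E × ℝ → E →L[ℝ] F := fun z => (fderiv ℝ h z).comp (ContinuousLinearMap.inl ℝ E ℝ)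
    have hh' : ContDiff ℝ n h' :=
      (hh.fderiv_right (by push_cast; rfl)).clm_comp contDiff_const
    have hdiff : Differentiable ℝ h := hh.differentiable (by simp)
    have hd : ∀ y : E, HasFDerivAt (fun y => ∫ t in (0 : ℝ)..1, h (y, t))
        (∫ t in (0 : ℝ)..1, h' (y, t)) y := by
      intro y
      obtain ⟨C, hC⟩ := ((isCompact_closedBall y 1).prod
        (isCompact_Icc (a := (0 : ℝ)) (b := 1))).exists_bound_of_continuousOn
        hh'.continuous.continuousOn
      refine (intervalIntegral.hasFDerivAt_integral_of_dominated_of_fderiv_le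
        (F := fun y t => h (y, t)) (F' := fun y t => h' (y, t)) (bound := fun _ => C)
        (s := Metric.ball y 1) (Metric.ball_mem_nhds y one_pos) ?_ ?_ ?_ ?_ ?_ ?_)
      · exact Eventually.of_forall fun z =>
          (hh.continuous.comp (by fun_prop : Continuous fun t : ℝ => (z, t))).aestronglyMeasurable
      · exact (hh.continuous.comp (by fun_prop : Continuous fun t : ℝ => (y, t))).intervalIntegrable
          _ _
      · exact (hh'.continuous.comp
          (by fun_prop : Continuous fun t : ℝ => (y, t))).aestronglyMeasurable
      · refine Eventually.of_forall fun t ht z hz => hC (z, t)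
          ⟨Metric.ball_subset_closedBall hz, ?_⟩
        rw [uIoc_of_le zero_le_one] at ht
        exact Ioc_subset_Icc_self ht
      · exact intervalIntegrable_const
      · refine Eventually.of_forall fun t _ z _ => ?_
        exact (hdiff (z, t)).hasFDerivAt.comp z (hasFDerivAt_prodMk_left z t)
    push_cast
    rw [contDiff_succ_iff_fderiv]
    refine ⟨fun y => (hd y).differentiableAt, by simp, ?_⟩
    have : fderiv ℝ (fun y => ∫ t in (0 : ℝ)..1, h (y, t)) =
        fun y => ∫ t in (0 : ℝ)..1, h' (y, t) :=
      funext fun y => (hd y).fderiv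
    rw [this]
    exact ih hh'

/-- Hadamard's lemma: `gᵢ(y)` is the integral of `∂ᵢ f` along the segment from `p` to `y`. -/
theorem exists_contDiff_hadamard {s : ℕ} {f : EuclideanSpace ℝ (Fin s) → ℝ} (hf : ContDiff ℝ ∞ f)
    (p : EuclideanSpace ℝ (Fin s)) : ∃ g : Fin s → EuclideanSpace ℝ (Fin s) → ℝ,
      (∀ i, ContDiff ℝ ∞ (g i)) ∧ ∀ y, f y = f p + ∑ i, (y i - p i) * g i y := by
  have hf' : ContDiff ℝ ∞ (fderiv ℝ f) := hf.fderiv_right (by simp)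
  set b := EuclideanSpace.basisFun (Fin s) ℝ
  set h : Fin s → EuclideanSpace ℝ (Fin s) × ℝ → ℝ := fun i z =>
    fderiv ℝ f (p + z.2 • (z.1 - p)) (b i)
  have hh : ∀ i, ContDiff ℝ ∞ (h i) := by
    intro i
    refine ContDiff.clm_apply (hf'.comp ?_) contDiff_const
    fun_prop
  refine ⟨fun i y => ∫ t in (0 : ℝ)..1, h i (y, t), fun i => ?_, fun y => ?_⟩
  · exact contDiff_infty.2 fun n => contDiff_intervalIntegral_param n
      ((contDiff_infty.1 (hh i)) n)
  · have hderiv : ∀ t : ℝ, HasDerivAt (fun t : ℝ => f (p + t • (y - p)))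
        (∑ i, (y i - p i) * h i (y, t)) t := by
      intro t
      have h1 : HasDerivAt (fun t : ℝ => p + t • (y - p)) (y - p) t := by
        simpa using ((hasDerivAt_id t).smul_const (y - p)).const_add p
      have h2 := ((hf.differentiable (by simp)) (p + t • (y - p))).hasFDerivAt.comp_hasDerivAt t h1
      have h3 : ∀ A : EuclideanSpace ℝ (Fin s) →L[ℝ] ℝ,
          A (y - p) = ∑ i, (y i - p i) * A (b i) := by
        intro A
        conv_lhs => rw [← b.sum_repr (y - p), map_sum]
        simp [b]
      rwa [h3] at h2
    have hint : ∀ i, Continuous fun t : ℝ => h i (y, t) := fun i =>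
      (hh i).continuous.comp (by fun_prop)
    have := intervalIntegral.integral_eq_sub_of_hasDerivAt (a := 0) (b := 1)
      (fun t _ => hderiv t) (Continuous.intervalIntegrable (by fun_prop) _ _)
    rw [intervalIntegral.integral_finsetSum fun i _ =>
      (Continuous.intervalIntegrable (by fun_prop) _ _)] at this
    simp only [intervalIntegral.integral_const_mul, one_smul, zero_smul, add_zero,
      add_sub_cancel] at this
    rw [this]; ring

end Hadamard

/-! ### Partial derivatives in charts and cutoff functions -/

section ChartDerivatives

open Set Filter Topology

variable {s : ℕ} {M : Type*} [TopologicalSpace M] [ChartedSpace (EuclideanSpace ℝ (Fin s)) M]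

/-- The `i`-th coordinate of the chart centred at `x₀`, meaningful on the domain of that chart. -/
def chartCoord (x₀ : M) (i : Fin s) (x : M) : ℝ := (chartAt (EuclideanSpace ℝ (Fin s)) x₀ x) i

/-- The `i`-th partial derivative at `x` of a function, in the chart centred at `x₀`, for `x` in the
domain of that chart. -/
def chartDeriv (x₀ : M) (i : Fin s) (x : M) (g : M → ℝ) : ℝ :=
  fderiv ℝ (g ∘ (chartAt (EuclideanSpace ℝ (Fin s)) x₀).symm)
    (chartAt (EuclideanSpace ℝ (Fin s)) x₀ x) (EuclideanSpace.basisFun (Fin s) ℝ i)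

theorem chartDeriv_congr {x₀ x : M} {i : Fin s} {g g' : M → ℝ}
    (hx : x ∈ (chartAt (EuclideanSpace ℝ (Fin s)) x₀).source) (h : g =ᶠ[𝓝 x] g') :
    chartDeriv x₀ i x g = chartDeriv x₀ i x g' := by
  unfold chartDeriv
  rw [Filter.EventuallyEq.fderiv_eq]
  have h1 := (chartAt (EuclideanSpace ℝ (Fin s)) x₀).tendsto_symm hx
  exact h.comp_tendsto h1

theorem chartDeriv_const (x₀ x : M) (i : Fin s) (c : ℝ) :
    chartDeriv x₀ i x (fun _ => c) = 0 := by
  have : (fun _ : M => c) ∘ (chartAt (EuclideanSpace ℝ (Fin s)) x₀).symm = fun _ => c := rfl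
  simp [chartDeriv, this]

theorem chartDeriv_coord {x₀ x : M} (hx : x ∈ (chartAt (EuclideanSpace ℝ (Fin s)) x₀).source)
    (i k : Fin s) : chartDeriv x₀ i x (chartCoord x₀ k) = if i = k then 1 else 0 := by
  set e := chartAt (EuclideanSpace ℝ (Fin s)) x₀
  have h : chartCoord x₀ k ∘ e.symm =ᶠ[𝓝 (e x)] fun y => EuclideanSpace.proj (𝕜 := ℝ) k y := by
    filter_upwards [e.open_target.mem_nhds (e.map_source hx)] with y hy
    simp [chartCoord, e, e.right_inv hy]
  rw [chartDeriv, h.fderiv_eq, ContinuousLinearMap.fderiv]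
  simp [eq_comm]

theorem contMDiff_mul_of_eventually_zero {W : Set M} {χ g : M → ℝ}
    (hχ : ContMDiff (𝓡 s) 𝓘(ℝ, ℝ) ∞ χ) (h0 : ∀ᶠ x in 𝓝ˢ Wᶜ, χ x = 0)
    (hg : ∀ x ∈ W, ContMDiffAt (𝓡 s) 𝓘(ℝ, ℝ) ∞ g x) :
    ContMDiff (𝓡 s) 𝓘(ℝ, ℝ) ∞ fun x => χ x * g x := by
  intro x
  by_cases hx : x ∈ W
  · exact (hχ x).mul (hg x hx)
  · refine (contMDiffAt_const (c := (0 : ℝ))).congr_of_eventuallyEq ?_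
    filter_upwards [eventually_nhdsSet_iff_forall.1 h0 x hx] with y hy
    rw [hy, zero_mul]

variable [IsManifold (𝓡 s) ∞ M]

theorem contMDiffOn_chartCoord (x₀ : M) (i : Fin s) :
    ContMDiffOn (𝓡 s) 𝓘(ℝ, ℝ) ∞ (chartCoord x₀ i)
      (chartAt (EuclideanSpace ℝ (Fin s)) x₀).source := by
  have h := contMDiffOn_chart (I := 𝓡 s) (n := ∞) (x := x₀)
  have h2 : ContMDiff (𝓡 s) 𝓘(ℝ, ℝ) ∞ fun y : EuclideanSpace ℝ (Fin s) =>
    EuclideanSpace.proj (𝕜 := ℝ) i y := (ContinuousLinearMap.contDiff _).contMDiff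
  exact h2.comp_contMDiffOn h

theorem contDiffOn_comp_chart_symm {x₀ : M} {O : Set M} {g : M → ℝ}
    (hg : ContMDiffOn (𝓡 s) 𝓘(ℝ, ℝ) ∞ g O) :
    ContDiffOn ℝ ∞ (g ∘ (chartAt (EuclideanSpace ℝ (Fin s)) x₀).symm)
      ((chartAt (EuclideanSpace ℝ (Fin s)) x₀).target ∩
        (chartAt (EuclideanSpace ℝ (Fin s)) x₀).symm ⁻¹' O) := by
  rw [← contMDiffOn_iff_contDiffOn]
  exact hg.comp ((contMDiffOn_chart_symm (I := 𝓡 s) (x := x₀)).mono inter_subset_left)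
    fun x hx => hx.2

theorem differentiableAt_comp_chart_symm {x₀ x : M} {O : Set M} (hO : IsOpen O) {g : M → ℝ}
    (hg : ContMDiffOn (𝓡 s) 𝓘(ℝ, ℝ) ∞ g O) (hxO : x ∈ O)
    (hx : x ∈ (chartAt (EuclideanSpace ℝ (Fin s)) x₀).source) :
    DifferentiableAt ℝ (g ∘ (chartAt (EuclideanSpace ℝ (Fin s)) x₀).symm)
      (chartAt (EuclideanSpace ℝ (Fin s)) x₀ x) := by
  set e := chartAt (EuclideanSpace ℝ (Fin s)) x₀
  refine ((contDiffOn_comp_chart_symm (x₀ := x₀) hg).contDiffAt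
    ((e.isOpen_inter_preimage_symm hO).mem_nhds ⟨e.map_source hx, ?_⟩)).differentiableAt (by simp)
  simpa [e.left_inv hx] using hxO

theorem chartDeriv_mul {x₀ x : M} (i : Fin s) {O : Set M} (hO : IsOpen O) {g g' : M → ℝ}
    (hg : ContMDiffOn (𝓡 s) 𝓘(ℝ, ℝ) ∞ g O) (hg' : ContMDiffOn (𝓡 s) 𝓘(ℝ, ℝ) ∞ g' O)
    (hxO : x ∈ O) (hx : x ∈ (chartAt (EuclideanSpace ℝ (Fin s)) x₀).source) :
    chartDeriv x₀ i x (fun y => g y * g' y) =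
      chartDeriv x₀ i x g * g' x + g x * chartDeriv x₀ i x g' := by
  have h1 := differentiableAt_comp_chart_symm hO hg hxO hx
  have h2 := differentiableAt_comp_chart_symm hO hg' hxO hx
  have h3 := fderiv_mul h1 h2
  have h4 : (fun y => g y * g' y) ∘ (chartAt (EuclideanSpace ℝ (Fin s)) x₀).symm =
    (g ∘ (chartAt (EuclideanSpace ℝ (Fin s)) x₀).symm) *
      (g' ∘ (chartAt (EuclideanSpace ℝ (Fin s)) x₀).symm) := rfl
  rw [chartDeriv, h4, h3]
  simp [chartDeriv, (chartAt (EuclideanSpace ℝ (Fin s)) x₀).left_inv hx]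
  ring

theorem chartDeriv_sum_mul_const {x₀ x : M} (i : Fin s) {O : Set M} (hO : IsOpen O) {κ : Type*}
    (t : Finset κ) {g : κ → M → ℝ} (c : κ → ℝ)
    (hg : ∀ k, ContMDiffOn (𝓡 s) 𝓘(ℝ, ℝ) ∞ (g k) O)
    (hxO : x ∈ O) (hx : x ∈ (chartAt (EuclideanSpace ℝ (Fin s)) x₀).source) :
    chartDeriv x₀ i x (fun y => ∑ k ∈ t, g k y * c k) =
      ∑ k ∈ t, chartDeriv x₀ i x (g k) * c k := by
  have h1 := fun k => differentiableAt_comp_chart_symm hO (hg k) hxO hx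
  have h4 : (fun y => ∑ k ∈ t, g k y * c k) ∘ (chartAt (EuclideanSpace ℝ (Fin s)) x₀).symm =
    fun y => ∑ k ∈ t, (g k ∘ (chartAt (EuclideanSpace ℝ (Fin s)) x₀).symm) y * c k := rfl
  rw [chartDeriv, h4, fderiv_fun_sum fun k _ => (h1 k).mul_const (c k)]
  simp only [_root_.sum_apply]
  refine Finset.sum_congr rfl fun k _ => ?_
  rw [fderiv_mul_const (h1 k)]
  simp [chartDeriv, mul_comm]

theorem contMDiffOn_chartDeriv {x₀ : M} (i : Fin s) {O : Set M} (hO : IsOpen O) {g : M → ℝ}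
    (hg : ContMDiffOn (𝓡 s) 𝓘(ℝ, ℝ) ∞ g O) :
    ContMDiffOn (𝓡 s) 𝓘(ℝ, ℝ) ∞ (fun x => chartDeriv x₀ i x g)
      (O ∩ (chartAt (EuclideanSpace ℝ (Fin s)) x₀).source) := by
  set e := chartAt (EuclideanSpace ℝ (Fin s)) x₀
  have h1 := (contDiffOn_comp_chart_symm (x₀ := x₀) hg).fderiv_of_isOpen (m := ∞)
    (e.isOpen_inter_preimage_symm hO) (by simp)
  have h2 := h1.clm_apply (contDiffOn_const (c := EuclideanSpace.basisFun (Fin s) ℝ i))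
  exact (contMDiffOn_iff_contDiffOn.2 h2).comp
    ((contMDiffOn_chart (I := 𝓡 s) (n := ∞) (x := x₀)).mono inter_subset_right)
    fun x hx => ⟨e.map_source hx.2, by simpa [e, e.left_inv hx.2] using hx.1⟩

variable [T2Space M] [SecondCountableTopology M]

variable (s) in
/-- Smooth cutoff functions, constant near `T` and near the complement of `W`. -/
theorem exists_cutoff {W T : Set M} (hW : IsOpen W) (hT : IsClosed T) (h : T ⊆ W) :
    ∃ χ : M → ℝ, ContMDiff (𝓡 s) 𝓘(ℝ, ℝ) ∞ χ ∧ (∀ᶠ x in 𝓝ˢ Wᶜ, χ x = 0) ∧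
      ∀ᶠ x in 𝓝ˢ T, χ x = 1 := by
  have : LocallyCompactSpace M := ChartedSpace.locallyCompactSpace (EuclideanSpace ℝ (Fin s)) M
  obtain ⟨f, h1, h2, -⟩ := exists_contMDiffMap_zero_one_nhds_of_isClosed (𝓡 s) (n := ⊤)
    hW.isClosed_compl hT (disjoint_compl_left_iff_subset.2 h)
  exact ⟨f, f.contMDiff, h1, h2⟩

/-- Germs of smooth functions are germs of global smooth functions. -/
theorem exists_contMDiff_eventuallyEq {O : Set M} (hO : IsOpen O) {x : M} (hx : x ∈ O)
    {g : M → ℝ} (hg : ContMDiffOn (𝓡 s) 𝓘(ℝ, ℝ) ∞ g O) :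
    ∃ g' : M → ℝ, ContMDiff (𝓡 s) 𝓘(ℝ, ℝ) ∞ g' ∧ g' =ᶠ[𝓝 x] g := by
  obtain ⟨χ, h1, h2, h3⟩ := exists_cutoff s hO isClosed_singleton (singleton_subset_iff.2 hx)
  refine ⟨fun y => χ y * g y, contMDiff_mul_of_eventually_zero h1 h2
    fun y hy => hg.contMDiffAt (hO.mem_nhds hy), ?_⟩
  rw [nhdsSet_singleton] at h3
  filter_upwards [h3] with y hy
  rw [hy, one_mul]

/-- Hadamard's lemma in a chart, with coefficients extended to the whole manifold. -/
theorem exists_hadamard {O : Set M} (hO : IsOpen O) {x x₀ : M} (hxO : x ∈ O)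
    (hx : x ∈ (chartAt (EuclideanSpace ℝ (Fin s)) x₀).source) {f : M → ℝ}
    (hf : ContMDiffOn (𝓡 s) 𝓘(ℝ, ℝ) ∞ f O) :
    ∃ g : Fin s → M → ℝ, (∀ i, ContMDiff (𝓡 s) 𝓘(ℝ, ℝ) ∞ (g i)) ∧ ∀ᶠ y in 𝓝 x,
      f y = f x + ∑ i, (chartCoord x₀ i y - chartCoord x₀ i x) * g i y := by
  set e := chartAt (EuclideanSpace ℝ (Fin s)) x₀
  have h1 := contDiffOn_comp_chart_symm (x₀ := x₀) hf
  have hopen := e.isOpen_inter_preimage_symm hO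
  have hmem : e x ∈ e.target ∩ e.symm ⁻¹' O :=
    ⟨e.map_source hx, by simpa [e.left_inv hx] using hxO⟩
  obtain ⟨f', hf', hff'⟩ := exists_contMDiff_eventuallyEq (s := s) hopen hmem
    (contMDiffOn_iff_contDiffOn.2 h1)
  obtain ⟨g, hg, hgf⟩ := exists_contDiff_hadamard (contMDiff_iff_contDiff.1 hf') (e x)
  have hge : ∀ i, ∃ g' : M → ℝ, ContMDiff (𝓡 s) 𝓘(ℝ, ℝ) ∞ g' ∧ g' =ᶠ[𝓝 x] fun y => g i (e y) :=
    fun i => exists_contMDiff_eventuallyEq e.open_source hx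
      ((hg i).contMDiff.comp_contMDiffOn (contMDiffOn_chart (I := 𝓡 s) (n := ∞) (x := x₀)))
  choose g' hg' hgg' using hge
  refine ⟨g', hg', ?_⟩
  filter_upwards [eventually_all.2 hgg', e.open_source.mem_nhds hx,
    (e.continuousAt hx).eventually hff'] with y hy1 hy2 hy3
  have h2 := hff'.self_of_nhds
  rw [Function.comp_apply, e.left_inv hx] at h2
  rw [Function.comp_apply, e.left_inv hy2] at hy3
  rw [← h2, ← hy3, hgf (e y)]
  simp only [hy1]
  rfl

end ChartDerivatives

/-! ### Parity, degree and contractions on an exterior algebra -/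

section ExteriorCalculus

open CliffordAlgebra (contractLeft involute)

variable {W : Type*} [AddCommGroup W] [Module ℝ W]

theorem involute_of_mem_exteriorPower {k : ℕ} {a : ExteriorAlgebra ℝ W} (ha : a ∈ ⋀[ℝ]^k W) :
    involute a = superSign 1 (k : ZMod 2) • a := by
  have hsign : ∀ k : ℕ, superSign 1 ((k + 1 : ℕ) : ZMod 2) = -superSign 1 (k : ZMod 2) := by
    intro k
    push_cast
    rcases parity_cases (k : ZMod 2) with h | h <;> rw [h] <;> simp [parity_one_add_one]
  induction ha using Submodule.pow_induction_on_left' with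
  | algebraMap r => simp
  | add x y i hx hy h1 h2 => rw [map_add, h1, h2, smul_add]
  | mem_mul m hm i x hx ih =>
    obtain ⟨m, rfl⟩ := hm
    rw [map_mul, ih, hsign]
    simp

theorem mem_extParity_of_mem {k : ℕ} {a : ExteriorAlgebra ℝ W} (ha : a ∈ ⋀[ℝ]^k W) :
    a ∈ extParity W k :=
  le_iSup (fun l : {l : ℕ // (l : ZMod 2) = (k : ZMod 2)} => ⋀[ℝ]^(l : ℕ) W) ⟨k, rfl⟩ ha

theorem extParity_induction {i : ZMod 2} {C : ExteriorAlgebra ℝ W → Prop} (h0 : C 0)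
    (hadd : ∀ a b, C a → C b → C (a + b))
    (hk : ∀ (k : ℕ), (k : ZMod 2) = i → ∀ a ∈ ⋀[ℝ]^k W, C a)
    {a : ExteriorAlgebra ℝ W} (ha : a ∈ extParity W i) : C a :=
  Submodule.iSup_induction _ (motive := C) ha (fun k a h => hk k k.2 a h) h0 hadd

theorem involute_of_mem_extParity {i : ZMod 2} {a : ExteriorAlgebra ℝ W} (ha : a ∈ extParity W i) :
    involute a = superSign 1 i • a := by
  refine extParity_induction (C := fun a => involute a = superSign 1 i • a) (by simp) ?_ ?_ ha
  · intro a b ha hb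
    rw [map_add, ha, hb, smul_add]
  · rintro k rfl a ha
    exact involute_of_mem_exteriorPower ha

theorem ι_mul_eq_involute_mul (m : W) (b : ExteriorAlgebra ℝ W) :
    ExteriorAlgebra.ι ℝ m * b = involute b * ExteriorAlgebra.ι ℝ m := by
  induction b using ExteriorAlgebra.induction with
  | algebraMap r => simp [Algebra.commutes]
  | ι n =>
    rw [CliffordAlgebra.involute_ι, neg_mul]
    exact eq_neg_of_add_eq_zero_left (ExteriorAlgebra.ι_add_mul_swap m n)
  | mul a b ha hb => rw [← mul_assoc, ha, mul_assoc, hb, map_mul, mul_assoc]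
  | add a b ha hb => rw [mul_add, ha, hb, map_add, add_mul]

/-- The exterior algebra is supercommutative. As `b` commutes with generators up to the sign
`(-1)ʲ`, it commutes with `a` or with `involute a`. -/
theorem mul_eq_superSign_smul_mul {i j : ZMod 2} {a b : ExteriorAlgebra ℝ W}
    (ha : a ∈ extParity W i) (hb : b ∈ extParity W j) : a * b = superSign i j • (b * a) := by
  have hι : ∀ m : W, ExteriorAlgebra.ι ℝ m * b = superSign 1 j • (b * ExteriorAlgebra.ι ℝ m) := by
    intro m
    rw [ι_mul_eq_involute_mul, involute_of_mem_extParity hb, smul_mul_assoc]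
  rcases parity_cases j with rfl | rfl
  · have h : ∀ a, a * b = b * a := by
      intro a
      induction a using ExteriorAlgebra.induction with
      | algebraMap r => exact Algebra.commutes r b
      | ι m => simpa using hι m
      | mul x y hx hy => rw [mul_assoc, hy, ← mul_assoc, hx, mul_assoc]
      | add x y hx hy => rw [add_mul, hx, hy, mul_add]
    simpa using h a
  · have h : ∀ a, a * b = b * involute a := by
      intro a
      induction a using ExteriorAlgebra.induction with
      | algebraMap r => simpa using Algebra.commutes r b
      | ι m => simpa using hι m
      | mul x y hx hy => rw [mul_assoc, hy, ← mul_assoc, hx, mul_assoc, map_mul]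
      | add x y hx hy => rw [add_mul, hx, hy, map_add, mul_add]
    rw [h, involute_of_mem_extParity ha, mul_smul_comm]
    rcases parity_cases i with rfl | rfl <;> simp

theorem contractLeft_mul_eq (d : Module.Dual ℝ W) (a b : ExteriorAlgebra ℝ W) :
    contractLeft d (a * b) = contractLeft d a * b + involute a * contractLeft d b := by
  induction a using ExteriorAlgebra.induction generalizing b with
  | algebraMap r =>
    rw [CliffordAlgebra.contractLeft_algebraMap_mul, CliffordAlgebra.contractLeft_algebraMap]
    simp
  | ι m =>
    rw [CliffordAlgebra.contractLeft_ι_mul, CliffordAlgebra.contractLeft_ι,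
      CliffordAlgebra.involute_ι, neg_mul, ← sub_eq_add_neg, Algebra.smul_def]
  | mul x y hx hy =>
    rw [mul_assoc, hx, hy, hx y, map_mul]
    noncomm_ring
  | add x y hx hy =>
    rw [add_mul, map_add, hx, hy, map_add, map_add]
    noncomm_ring

theorem contractLeft_mul_of_mem (d : Module.Dual ℝ W) {i : ZMod 2} {a : ExteriorAlgebra ℝ W}
    (ha : a ∈ extParity W i) (b : ExteriorAlgebra ℝ W) :
    contractLeft d (a * b) = contractLeft d a * b + superSign 1 i • (a * contractLeft d b) := by
  rw [contractLeft_mul_eq, involute_of_mem_extParity ha, smul_mul_assoc]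

/-- The instances of `map_smul`, `map_add` and `map_sub` for homomorphisms between exterior algebras
have the types spelled out for the unifier. -/
theorem extAlgHom_smul {W' : Type*} [AddCommGroup W'] [Module ℝ W']
    (f : ExteriorAlgebra ℝ W →ₐ[ℝ] ExteriorAlgebra ℝ W') (c : ℝ) (a : ExteriorAlgebra ℝ W) :
    f (c • a) = c • f a := f.toLinearMap.map_smul c a

theorem extAlgHom_add {W' : Type*} [AddCommGroup W'] [Module ℝ W']
    (f : ExteriorAlgebra ℝ W →ₐ[ℝ] ExteriorAlgebra ℝ W') (a b : ExteriorAlgebra ℝ W) :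
    f (a + b) = f a + f b := f.toLinearMap.map_add a b

theorem extAlgHom_sub {W' : Type*} [AddCommGroup W'] [Module ℝ W']
    (f : ExteriorAlgebra ℝ W →ₐ[ℝ] ExteriorAlgebra ℝ W') (a b : ExteriorAlgebra ℝ W) :
    f (a - b) = f a - f b := map_sub f a b

theorem degreeOp_algebraMap (c : ℝ) : degreeOp W (algebraMap ℝ _ c) = 0 := by
  have h : algebraMap ℝ (ExteriorAlgebra ℝ W) c ∈ ⋀[ℝ]^0 W := by
    rw [ExteriorAlgebra.exteriorPower, pow_zero]
    exact Submodule.mem_one.2 ⟨c, rfl⟩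
  rw [degreeOp_of_mem h]; simp

theorem degreeOp_ι (m : W) : degreeOp W (ExteriorAlgebra.ι ℝ m) = ExteriorAlgebra.ι ℝ m := by
  have h : ExteriorAlgebra.ι ℝ m ∈ ⋀[ℝ]^1 W := by
    rw [ExteriorAlgebra.exteriorPower, pow_one]
    exact ⟨m, rfl⟩
  rw [degreeOp_of_mem h]; simp

theorem degreeOp_involute (a : ExteriorAlgebra ℝ W) :
    degreeOp W (involute a) = involute (degreeOp W a) := by
  induction a using ext_induction with
  | h0 => simp
  | hadd a b ha hb => simp only [map_add, ha, hb]
  | hk k a ha =>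
    rw [degreeOp_of_mem ha, map_smul, involute_of_mem_exteriorPower ha, map_smul,
      degreeOp_of_mem ha, smul_comm]

theorem degreeOp_contractLeft (d : Module.Dual ℝ W) (a : ExteriorAlgebra ℝ W) :
    degreeOp W (contractLeft d a) = contractLeft d (degreeOp W a) - contractLeft d a := by
  induction a using ExteriorAlgebra.induction with
  | algebraMap r =>
    rw [CliffordAlgebra.contractLeft_algebraMap, degreeOp_algebraMap]
    simp
  | ι m => rw [CliffordAlgebra.contractLeft_ι, degreeOp_ι, degreeOp_algebraMap,
      CliffordAlgebra.contractLeft_ι, sub_self]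
  | mul x y hx hy =>
    rw [contractLeft_mul_eq, map_add, degreeOp_mul, degreeOp_mul, hx, hy, degreeOp_mul, map_add,
      contractLeft_mul_eq, contractLeft_mul_eq, degreeOp_involute]
    noncomm_ring
  | add x y hx hy => simp only [map_add, hx, hy]; abel

theorem exists_add_extParity (a : ExteriorAlgebra ℝ W) :
    ∃ a₀ ∈ extParity W 0, ∃ a₁ ∈ extParity W 1, a = a₀ + a₁ := by
  induction a using ext_induction with
  | h0 => exact ⟨0, zero_mem _, 0, zero_mem _, by simp⟩
  | hadd a b ha hb =>
    obtain ⟨a₀, h₀, a₁, h₁, rfl⟩ := ha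
    obtain ⟨b₀, h₀', b₁, h₁', rfl⟩ := hb
    exact ⟨a₀ + b₀, add_mem h₀ h₀', a₁ + b₁, add_mem h₁ h₁', by abel⟩
  | hk k a ha =>
    have h := mem_extParity_of_mem ha
    rcases parity_cases (k : ZMod 2) with hk | hk <;> rw [hk] at h
    · exact ⟨a, h, 0, zero_mem _, by simp⟩
    · exact ⟨0, zero_mem _, a, h, by simp⟩

theorem mem_extParity_of_involute {i : ZMod 2} {a : ExteriorAlgebra ℝ W}
    (ha : involute a = superSign 1 i • a) : a ∈ extParity W i := by
  obtain ⟨a₀, h₀, a₁, h₁, rfl⟩ := exists_add_extParity a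
  rw [map_add, involute_of_mem_extParity h₀, involute_of_mem_extParity h₁] at ha
  rcases parity_cases i with rfl | rfl
  · simp only [superSign_zero_right, one_smul, superSign_one_one, neg_smul] at ha
    have h2 : (2 : ℝ) • a₁ = 0 := by
      rw [two_smul]
      have := add_left_cancel ha
      nth_rewrite 1 [← this]
      simp
    rw [(smul_eq_zero.1 h2).resolve_left two_ne_zero, add_zero]
    exact h₀
  · simp only [superSign_zero_right, one_smul, superSign_one_one, neg_smul, neg_add] at ha
    have h2 : (2 : ℝ) • a₀ = 0 := by
      rw [two_smul]
      have := add_right_cancel ha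
      nth_rewrite 1 [this]
      simp
    rw [(smul_eq_zero.1 h2).resolve_left two_ne_zero, zero_add]
    exact h₁

theorem map_mem_extParity {W' : Type*} [AddCommGroup W'] [Module ℝ W'] (f : W →ₗ[ℝ] W')
    {i : ZMod 2} {a : ExteriorAlgebra ℝ W} (ha : a ∈ extParity W i) :
    ExteriorAlgebra.map f a ∈ extParity W' i := by
  refine extParity_induction (C := fun a => ExteriorAlgebra.map f a ∈ extParity W' i) ?_ ?_ ?_ ha
  · rw [map_zero]; exact zero_mem _
  · intro a b ha hb
    rw [map_add]; exact add_mem ha hb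
  · rintro k rfl a ha
    exact mem_extParity_of_mem (map_mem_exteriorPower f ha)

theorem mul_mem_extParity {i j : ZMod 2} {a b : ExteriorAlgebra ℝ W} (ha : a ∈ extParity W i)
    (hb : b ∈ extParity W j) : a * b ∈ extParity W (i + j) := by
  refine extParity_induction (C := fun a => a * b ∈ extParity W (i + j)) ?_ ?_ ?_ ha
  · rw [zero_mul]; exact zero_mem _
  · intro a a' h h'
    rw [add_mul]; exact add_mem h h'
  rintro k rfl a ha
  refine extParity_induction (C := fun b => a * b ∈ extParity W ((k : ZMod 2) + j)) ?_ ?_ ?_ hb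
  · rw [mul_zero]; exact zero_mem _
  · intro b b' h h'
    rw [mul_add]; exact add_mem h h'
  rintro l rfl b hb
  have hab : a * b ∈ ⋀[ℝ]^(k + l) W := SetLike.mul_mem_graded ha hb
  simpa using mem_extParity_of_mem hab

/-- Eigenvectors of the degree operator are homogeneous. -/
theorem mem_exteriorPower_of_degreeOp_eq {c : ℝ} {a : ExteriorAlgebra ℝ W}
    (ha : degreeOp W a = c • a) : a = 0 ∨ ∃ k : ℕ, (k : ℝ) = c ∧ a ∈ ⋀[ℝ]^k W := by
  classical
  have hcomp : ∀ (b : ExteriorAlgebra ℝ W) (k : ℕ),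
      GradedAlgebra.proj (fun k : ℕ => ⋀[ℝ]^k W) k (degreeOp W b) =
        (k : ℝ) • GradedAlgebra.proj (fun k : ℕ => ⋀[ℝ]^k W) k b := by
    intro b k
    induction b using ext_induction with
    | h0 => simp
    | hadd a b ha hb => simp only [map_add, ha, hb, smul_add]
    | hk l b hb =>
      rw [degreeOp_of_mem hb, map_smul]
      by_cases h : l = k
      · rw [h]
      · rw [GradedAlgebra.proj_apply,
          DirectSum.decompose_of_mem_ne (fun k : ℕ => ⋀[ℝ]^k W) hb h, smul_zero, smul_zero]
  have h1 : ∀ k : ℕ, (k : ℝ) ≠ c → GradedAlgebra.proj (fun k : ℕ => ⋀[ℝ]^k W) k a = 0 := by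
    intro k hk
    have h := hcomp a k
    rw [ha, map_smul, ← sub_eq_zero, ← sub_smul] at h
    exact (smul_eq_zero.1 h).resolve_left (sub_ne_zero.2 hk.symm)
  rw [← DirectSum.sum_support_decompose (fun k : ℕ => ⋀[ℝ]^k W) a]
  by_cases hc : ∃ k : ℕ, (k : ℝ) = c
  · obtain ⟨k, rfl⟩ := hc
    refine Or.inr ⟨k, rfl, Submodule.sum_mem _ fun l _ => ?_⟩
    by_cases hl : l = k
    · rw [← hl]; exact (DirectSum.decompose (fun k : ℕ => ⋀[ℝ]^k W) a l).2
    · have := h1 l (by exact_mod_cast hl)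
      rw [GradedAlgebra.proj_apply] at this
      rw [this]; exact zero_mem _
  · push Not at hc
    exact Or.inl (Finset.sum_eq_zero fun l _ => h1 l (hc l))

theorem mem_extParity_of_degreeOp_eq {k : ℤ} {a : ExteriorAlgebra ℝ W}
    (ha : degreeOp W a = (k : ℝ) • a) : a ∈ extParity W (k : ZMod 2) := by
  rcases mem_exteriorPower_of_degreeOp_eq ha with rfl | ⟨l, hl, h⟩
  · exact zero_mem _
  · have : (l : ℤ) = k := by exact_mod_cast hl
    rw [← this, Int.cast_natCast]
    exact mem_extParity_of_mem h

theorem algebraMap_mem_extParity (c : ℝ) : algebraMap ℝ (ExteriorAlgebra ℝ W) c ∈ extParity W 0 :=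
  mem_extParity_of_degreeOp_eq (k := 0) (by rw [degreeOp_algebraMap]; simp)

theorem ι_mem_extParity (m : W) : ExteriorAlgebra.ι ℝ m ∈ extParity W 1 :=
  mem_extParity_of_degreeOp_eq (k := 1) (by rw [degreeOp_ι]; simp)

theorem contractLeft_mem_extParity (d : Module.Dual ℝ W) {i : ZMod 2} {a : ExteriorAlgebra ℝ W}
    (ha : a ∈ extParity W i) : contractLeft d a ∈ extParity W (1 + i) := by
  refine extParity_induction (C := fun a => contractLeft d a ∈ extParity W (1 + i)) ?_ ?_ ?_ ha
  · rw [map_zero]; exact zero_mem _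
  · intro a b ha hb
    rw [map_add]; exact add_mem ha hb
  · rintro k rfl a ha
    have h := mem_extParity_of_degreeOp_eq (k := (k : ℤ) - 1) (a := contractLeft d a) (by
      rw [degreeOp_contractLeft, degreeOp_of_mem ha, map_smul]
      push_cast
      rw [sub_smul, one_smul])
    have h1 : (((k : ℤ) - 1 : ℤ) : ZMod 2) = 1 + k := by
      push_cast
      rcases parity_cases (k : ZMod 2) with h | h <;> rw [h] <;> decide
    rwa [h1] at h

/-- In degree `0` the exterior algebra is the field of scalars, which has no nilpotent elements. -/
theorem eq_zero_of_degreeOp_eq_zero_of_mul_self {a : ExteriorAlgebra ℝ W}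
    (ha : degreeOp W a = 0) (h : a * a = 0) : a = 0 := by
  rcases mem_exteriorPower_of_degreeOp_eq (c := 0) (a := a) (by simpa using ha) with
    rfl | ⟨l, hl, h'⟩
  · rfl
  · have : l = 0 := by exact_mod_cast hl
    subst this
    rw [ExteriorAlgebra.exteriorPower, pow_zero] at h'
    obtain ⟨c, rfl⟩ := Submodule.mem_one.1 h'
    rw [← map_mul, map_eq_zero_iff _ (ExteriorAlgebra.algebraMap_leftInverse W).injective] at h
    simp [mul_self_eq_zero.1 h]

open Polynomial in
/-- The degree operator has the eigenvalues `0, …, r` at most, on the exterior algebra of a space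
of dimension `r`. -/
theorem aeval_degreeOp_eq_zero [FiniteDimensional ℝ W] {r : ℕ} (hr : Module.finrank ℝ W ≤ r) :
    aeval (degreeOp W) (∏ k ∈ Finset.range (r + 1), (X - C (k : ℝ))) = 0 := by
  refine LinearMap.ext fun a => ?_
  induction a using ext_induction with
  | h0 => simp
  | hadd a b ha hb => rw [map_add, ha, hb, map_add]
  | hk k a ha =>
    by_cases hk : k ≤ r
    · rw [← Finset.prod_erase_mul _ _ (Finset.mem_range.2 (Nat.lt_succ_of_le hk)), map_mul,
        Module.End.mul_apply]
      have h0 : aeval (degreeOp W) (X - C (k : ℝ)) a = 0 := by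
        simp only [map_sub, aeval_X, aeval_C, LinearMap.sub_apply, degreeOp_of_mem ha,
          Module.algebraMap_end_apply, sub_self]
      rw [h0, map_zero, LinearMap.zero_apply]
    · have h0 : Module.finrank ℝ (⋀[ℝ]^k W) = 0 := by
        rw [exteriorPower.finrank_eq, Nat.choose_eq_zero_of_lt (by omega)]
      have h1 : (⟨a, ha⟩ : ⋀[ℝ]^k W) = 0 := by
        have := Module.finrank_zero_iff.1 h0
        exact Subsingleton.elim _ _
      rw [show a = 0 from congrArg Subtype.val h1]
      simp

end ExteriorCalculus

/-! ### Smooth sections of the exterior bundle in local frames -/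

section LocalFrames

open Bundle Set Filter Topology

variable {s : ℕ} {M : Type*} [TopologicalSpace M] [ChartedSpace (EuclideanSpace ℝ (Fin s)) M]
  {F : Type*} [NormedAddCommGroup F] [NormedSpace ℝ F] [FiniteDimensional ℝ F]
  {V : M → Type*} [∀ x, AddCommGroup (V x)] [∀ x, Module ℝ (V x)]
  [TopologicalSpace (TotalSpace F V)] [∀ x, TopologicalSpace (V x)] [FiberBundle F V]
  [VectorBundle ℝ F V]

variable (F V) in
/-- The map `⋀ F* → ⋀ Vₓ*` given by the trivialization of `V` around `x₀`, the inverse of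
`localRep` over the domain of the trivialization. -/
def localCorep (x₀ x : M) :
    ExteriorAlgebra ℝ (Module.Dual ℝ F) →ₐ[ℝ] ExteriorAlgebra ℝ (Module.Dual ℝ (V x)) :=
  ExteriorAlgebra.map ((trivializationAt F V x₀).linearMapAt ℝ x).dualMap

theorem localRep_localCorep {x₀ x : M} (hx : x ∈ (trivializationAt F V x₀).baseSet)
    (w : ExteriorAlgebra ℝ (Module.Dual ℝ F)) :
    localRep F V x₀ x (localCorep F V x₀ x w) = w := by
  rw [localRep, localCorep, ← AlgHom.comp_apply, ExteriorAlgebra.map_comp_map,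
    LinearMap.dualMap_comp_dualMap]
  have : ((trivializationAt F V x₀).linearMapAt ℝ x) ∘ₗ ((trivializationAt F V x₀).symmₗ ℝ x)
      = LinearMap.id := LinearMap.ext fun y => Trivialization.linearMapAt_symmₗ _ hx y
  rw [this, LinearMap.dualMap_id, ExteriorAlgebra.map_id]
  rfl

theorem localCorep_localRep {x₀ x : M} (hx : x ∈ (trivializationAt F V x₀).baseSet)
    (w : ExteriorAlgebra ℝ (Module.Dual ℝ (V x))) :
    localCorep F V x₀ x (localRep F V x₀ x w) = w := by
  rw [localRep, localCorep, ← AlgHom.comp_apply, ExteriorAlgebra.map_comp_map,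
    LinearMap.dualMap_comp_dualMap]
  have : ((trivializationAt F V x₀).symmₗ ℝ x) ∘ₗ ((trivializationAt F V x₀).linearMapAt ℝ x)
      = LinearMap.id := LinearMap.ext fun y => Trivialization.symmₗ_linearMapAt _ hx y
  rw [this, LinearMap.dualMap_id, ExteriorAlgebra.map_id]
  rfl

variable (F) in
/-- The basis of `⋀ F*` built from a basis of `F*`. -/
def extBasis : Module.Basis (Finset (Fin (Module.finrank ℝ (Module.Dual ℝ F)))) ℝ
    (ExteriorAlgebra ℝ (Module.Dual ℝ F)) :=
  (Module.finBasis ℝ (Module.Dual ℝ F)).ExteriorAlgebra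

theorem dual_apply_eq_sum (ℓ : Module.Dual ℝ (ExteriorAlgebra ℝ (Module.Dual ℝ F)))
    (u : ExteriorAlgebra ℝ (Module.Dual ℝ F)) :
    ℓ u = ∑ i, (extBasis F).coord i u * ℓ (extBasis F i) := by
  conv_lhs => rw [← (extBasis F).sum_repr u, map_sum]
  simp only [map_smul, smul_eq_mul, Module.Basis.coord_apply]

theorem dual_mul_eq_sum (ℓ : Module.Dual ℝ (ExteriorAlgebra ℝ (Module.Dual ℝ F)))
    (u v : ExteriorAlgebra ℝ (Module.Dual ℝ F)) :
    ℓ (u * v) = ∑ p : Finset (Fin (Module.finrank ℝ (Module.Dual ℝ F))) ×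
        Finset (Fin (Module.finrank ℝ (Module.Dual ℝ F))),
      (extBasis F).coord p.1 u * (extBasis F).coord p.2 v *
        ℓ (extBasis F p.1 * extBasis F p.2) := by
  conv_lhs => rw [← (extBasis F).sum_repr u, ← (extBasis F).sum_repr v]
  rw [Fintype.sum_prod_type, Finset.sum_mul_sum]
  simp only [map_sum, smul_mul_assoc, mul_smul_comm, map_smul, smul_eq_mul,
    Module.Basis.coord_apply]
  refine Finset.sum_congr rfl fun i _ => Finset.sum_congr rfl fun j _ => ?_
  ring

variable (s) in
/-- A function with values in `⋀ F*` has smooth coefficients on a set. Composition with all linear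
forms stands for the coefficients, since `⋀ F*` carries no norm. -/
def SmoothCoeffOn (u : M → ExteriorAlgebra ℝ (Module.Dual ℝ F)) (O : Set M) : Prop :=
  ∀ ℓ : Module.Dual ℝ (ExteriorAlgebra ℝ (Module.Dual ℝ F)),
    ContMDiffOn (𝓡 s) 𝓘(ℝ, ℝ) ∞ (fun x => ℓ (u x)) O

theorem SmoothCoeffOn.mul {u v : M → ExteriorAlgebra ℝ (Module.Dual ℝ F)} {O : Set M}
    (hu : SmoothCoeffOn s u O) (hv : SmoothCoeffOn s v O) :
    SmoothCoeffOn s (fun x => u x * v x) O := by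
  intro ℓ
  rw [funext fun x => dual_mul_eq_sum ℓ (u x) (v x)]
  exact contMDiffOn_finsetSum fun p _ => ((hu _).mul (hv _)).mul contMDiffOn_const

theorem SmoothCoeffOn.linear {u : M → ExteriorAlgebra ℝ (Module.Dual ℝ F)} {O : Set M}
    (hu : SmoothCoeffOn s u O)
    (T : ExteriorAlgebra ℝ (Module.Dual ℝ F) →ₗ[ℝ] ExteriorAlgebra ℝ (Module.Dual ℝ F)) :
    SmoothCoeffOn s (fun x => T (u x)) O := fun ℓ => hu (ℓ ∘ₗ T)

theorem SmoothCoeffOn.const (w : ExteriorAlgebra ℝ (Module.Dual ℝ F)) (O : Set M) :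
    SmoothCoeffOn s (fun _ => w) O := fun _ => contMDiffOn_const

variable [ContMDiffVectorBundle ∞ F V (𝓡 s)]

/-- The transition functions of `⋀ V*` are smooth, since they are multiplicative and are on
generators the transposes of the transition functions of `V`. -/
theorem smoothCoeffOn_transition (x₀ x₁ : M) (w : ExteriorAlgebra ℝ (Module.Dual ℝ F)) :
    SmoothCoeffOn s (fun y => localRep F V x₁ y (localCorep F V x₀ y w))
      ((trivializationAt F V x₁).baseSet ∩ (trivializationAt F V x₀).baseSet) := by
  induction w using ExteriorAlgebra.induction with
  | algebraMap r => simpa only [AlgHom.commutes] using SmoothCoeffOn.const _ _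
  | mul u v hu hv => simpa only [map_mul] using hu.mul hv
  | add u v hu hv =>
    intro ℓ
    have h : ∀ y, ℓ (localRep F V x₁ y (localCorep F V x₀ y (u + v))) =
        ℓ (localRep F V x₁ y (localCorep F V x₀ y u)) +
          ℓ (localRep F V x₁ y (localCorep F V x₀ y v)) := fun y =>
      LinearMap.map_add (ℓ ∘ₗ (localRep F V x₁ y).toLinearMap ∘ₗ
        (localCorep F V x₀ y).toLinearMap) u v
    rw [funext h]
    exact (hu ℓ).add (hv ℓ)
  | ι α =>
    intro ℓ
    -- on `F*` the linear form `ℓ` is the evaluation at a vector `v`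
    obtain ⟨v, hv⟩ := (Module.evalEquiv ℝ F).surjective (ℓ ∘ₗ ExteriorAlgebra.ι ℝ)
    have hev : ∀ β : Module.Dual ℝ F, ℓ (ExteriorAlgebra.ι ℝ β) = β v := fun β => by
      rw [← LinearMap.comp_apply, ← hv]; rfl
    have h1 := ContMDiffVectorBundle.contMDiffOn_coordChangeL (n := ∞) (IB := 𝓡 s)
      (trivializationAt F V x₁) (trivializationAt F V x₀) (𝕜 := ℝ)
    have h2 := h1.clm_apply (contMDiffOn_const (c := v))
    have h3 : ContMDiff 𝓘(ℝ, F) 𝓘(ℝ, ℝ) ∞ fun z : F => LinearMap.toContinuousLinearMap α z :=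
      (LinearMap.toContinuousLinearMap α).contDiff.contMDiff
    refine (h3.comp_contMDiffOn h2).congr fun y hy => ?_
    have h4 : localRep F V x₁ y (localCorep F V x₀ y (ExteriorAlgebra.ι ℝ α)) =
        ExteriorAlgebra.ι ℝ (((trivializationAt F V x₁).symmₗ ℝ y).dualMap
          (((trivializationAt F V x₀).linearMapAt ℝ y).dualMap α)) := by
      rw [localCorep, ExteriorAlgebra.map_apply_ι, localRep, ExteriorAlgebra.map_apply_ι]
    refine (congrArg ℓ h4).trans ?_
    rw [hev]
    simp only [LinearMap.dualMap_apply]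
    simp only [LinearMap.coe_toContinuousLinearMap', Function.comp_apply,
      ContinuousLinearEquiv.coe_coe]
    rw [Trivialization.coordChangeL_apply _ _ hy, Trivialization.symmₗ_apply _ hy.1,
      Trivialization.coe_linearMapAt_of_mem _ hy.2]

/-- Smoothness of a section of `⋀ V*` can be checked in one trivialization around each point. -/
theorem mem_exteriorSections_of_local {a : ∀ x : M, ExteriorAlgebra ℝ (Module.Dual ℝ (V x))}
    (h : ∀ x, ∃ (x₀ : M) (O : Set M), IsOpen O ∧ x ∈ O ∧
      O ⊆ (trivializationAt F V x₀).baseSet ∧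
      SmoothCoeffOn s (fun y => localRep F V x₀ y (a y)) O) :
    a ∈ exteriorSections s F V := by
  intro x₁ ℓ x hx
  obtain ⟨x₀, O, hO, hxO, hOb, hs⟩ := h x
  refine ContMDiffAt.contMDiffWithinAt ?_
  have hmem : (trivializationAt F V x₁).baseSet ∩ O ∈ 𝓝 x :=
    ((trivializationAt F V x₁).open_baseSet.inter hO).mem_nhds ⟨hx, hxO⟩
  have key : ContMDiffOn (𝓡 s) 𝓘(ℝ, ℝ) ∞ (fun y => ∑ i,
      (extBasis F).coord i (localRep F V x₀ y (a y)) *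
        ℓ (localRep F V x₁ y (localCorep F V x₀ y (extBasis F i))))
      ((trivializationAt F V x₁).baseSet ∩ O) := by
    refine contMDiffOn_finsetSum fun i _ => ?_
    exact ((hs ((extBasis F).coord i)).mono inter_subset_right).mul
      ((smoothCoeffOn_transition x₀ x₁ (extBasis F i) ℓ).mono
        (inter_subset_inter_right _ hOb))
  refine (key.contMDiffAt hmem).congr_of_eventuallyEq ?_
  filter_upwards [hmem] with y hy
  have h1 := localCorep_localRep (hOb hy.2) (a y)
  have h2 := dual_apply_eq_sum (ℓ ∘ₗ (localRep F V x₁ y).toLinearMap ∘ₗ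
    (localCorep F V x₀ y).toLinearMap) (localRep F V x₀ y (a y))
  simp only [LinearMap.comp_apply, AlgHom.toLinearMap_apply, h1] at h2
  exact h2

end LocalFrames

section CoefficientDerivatives

open Bundle Set Filter Topology

variable {s : ℕ} {M : Type*} [TopologicalSpace M] [ChartedSpace (EuclideanSpace ℝ (Fin s)) M]
  {F : Type*} [NormedAddCommGroup F] [NormedSpace ℝ F] [FiniteDimensional ℝ F]

/-- The coefficientwise partial derivative at `x` of a function with values in `⋀ F*`, in the chart
centred at `x₀`. -/
def coeffDeriv (x₀ : M) (i : Fin s) (x : M) (u : M → ExteriorAlgebra ℝ (Module.Dual ℝ F)) :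
    ExteriorAlgebra ℝ (Module.Dual ℝ F) :=
  ∑ k, chartDeriv x₀ i x (fun y => (extBasis F).coord k (u y)) • extBasis F k

theorem coeffDeriv_congr {x₀ x : M} {i : Fin s}
    {u v : M → ExteriorAlgebra ℝ (Module.Dual ℝ F)}
    (hx : x ∈ (chartAt (EuclideanSpace ℝ (Fin s)) x₀).source) (h : u =ᶠ[𝓝 x] v) :
    coeffDeriv x₀ i x u = coeffDeriv x₀ i x v := by
  refine Finset.sum_congr rfl fun k _ => ?_
  rw [chartDeriv_congr hx]
  filter_upwards [h] with y hy
  rw [hy]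

theorem coeffDeriv_const (x₀ x : M) (i : Fin s) (w : ExteriorAlgebra ℝ (Module.Dual ℝ F)) :
    coeffDeriv x₀ i x (fun _ => w) = 0 := by
  simp [coeffDeriv, chartDeriv_const]

variable [IsManifold (𝓡 s) ∞ M]

theorem dual_coeffDeriv {x₀ x : M} (i : Fin s) {O : Set M} (hO : IsOpen O) (hxO : x ∈ O)
    (hx : x ∈ (chartAt (EuclideanSpace ℝ (Fin s)) x₀).source)
    {u : M → ExteriorAlgebra ℝ (Module.Dual ℝ F)} (hu : SmoothCoeffOn s u O)
    (ℓ : Module.Dual ℝ (ExteriorAlgebra ℝ (Module.Dual ℝ F))) :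
    ℓ (coeffDeriv x₀ i x u) = chartDeriv x₀ i x fun y => ℓ (u y) := by
  have h : (fun y => ℓ (u y)) = fun y => ∑ k, (extBasis F).coord k (u y) * ℓ (extBasis F k) :=
    funext fun y => dual_apply_eq_sum ℓ (u y)
  rw [h, chartDeriv_sum_mul_const i hO _ _ (fun k => hu _) hxO hx, coeffDeriv, map_sum]
  simp

theorem ext_of_dual {u v : ExteriorAlgebra ℝ (Module.Dual ℝ F)}
    (h : ∀ ℓ : Module.Dual ℝ (ExteriorAlgebra ℝ (Module.Dual ℝ F)), ℓ u = ℓ v) : u = v :=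
  (extBasis F).ext_elem fun k => h ((extBasis F).coord k)

theorem coeffDeriv_linear {x₀ x : M} (i : Fin s) {O : Set M} (hO : IsOpen O) (hxO : x ∈ O)
    (hx : x ∈ (chartAt (EuclideanSpace ℝ (Fin s)) x₀).source)
    {u : M → ExteriorAlgebra ℝ (Module.Dual ℝ F)} (hu : SmoothCoeffOn s u O)
    (T : ExteriorAlgebra ℝ (Module.Dual ℝ F) →ₗ[ℝ] ExteriorAlgebra ℝ (Module.Dual ℝ F)) :
    coeffDeriv x₀ i x (fun y => T (u y)) = T (coeffDeriv x₀ i x u) := by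
  refine ext_of_dual fun ℓ => ?_
  rw [dual_coeffDeriv i hO hxO hx (hu.linear T), ← LinearMap.comp_apply,
    dual_coeffDeriv i hO hxO hx hu]
  rfl

theorem coeffDeriv_mul {x₀ x : M} (i : Fin s) {O : Set M} (hO : IsOpen O) (hxO : x ∈ O)
    (hx : x ∈ (chartAt (EuclideanSpace ℝ (Fin s)) x₀).source)
    {u v : M → ExteriorAlgebra ℝ (Module.Dual ℝ F)} (hu : SmoothCoeffOn s u O)
    (hv : SmoothCoeffOn s v O) :
    coeffDeriv x₀ i x (fun y => u y * v y) =
      coeffDeriv x₀ i x u * v x + u x * coeffDeriv x₀ i x v := by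
  refine ext_of_dual fun ℓ => ?_
  rw [dual_coeffDeriv i hO hxO hx (hu.mul hv)]
  have h := funext fun y => dual_mul_eq_sum ℓ (u y) (v y)
  have h' := chartDeriv_sum_mul_const (x₀ := x₀) i hO Finset.univ
    (g := fun (p : Finset (Fin (Module.finrank ℝ (Module.Dual ℝ F))) ×
        Finset (Fin (Module.finrank ℝ (Module.Dual ℝ F)))) y =>
      (extBasis F).coord p.1 (u y) * (extBasis F).coord p.2 (v y))
    (fun p => ℓ (extBasis F p.1 * extBasis F p.2))
    (fun p => (hu ((extBasis F).coord p.1)).mul (hv ((extBasis F).coord p.2))) hxO hx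
  rw [h, h', map_add,
    dual_mul_eq_sum ℓ (coeffDeriv x₀ i x u), dual_mul_eq_sum ℓ (u x), ← Finset.sum_add_distrib]
  refine Finset.sum_congr rfl fun p _ => ?_
  rw [chartDeriv_mul i hO (hu _) (hv _) hxO hx, dual_coeffDeriv i hO hxO hx hu,
    dual_coeffDeriv i hO hxO hx hv, add_mul]

theorem coeffDeriv_add {x₀ x : M} (i : Fin s) {O : Set M} (hO : IsOpen O) (hxO : x ∈ O)
    (hx : x ∈ (chartAt (EuclideanSpace ℝ (Fin s)) x₀).source)
    {u v : M → ExteriorAlgebra ℝ (Module.Dual ℝ F)} (hu : SmoothCoeffOn s u O)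
    (hv : SmoothCoeffOn s v O) :
    coeffDeriv x₀ i x (fun y => u y + v y) = coeffDeriv x₀ i x u + coeffDeriv x₀ i x v := by
  rw [coeffDeriv, coeffDeriv, coeffDeriv, ← Finset.sum_add_distrib]
  refine Finset.sum_congr rfl fun k _ => ?_
  rw [← add_smul]
  congr 1
  have h := chartDeriv_sum_mul_const i hO (Finset.univ : Finset Bool)
    (g := fun b y => (extBasis F).coord k (if b then u y else v y)) (fun _ => 1)
    (fun b => by cases b <;> [exact hv _; exact hu _]) hxO hx
  simpa using h

theorem SmoothCoeffOn.coeffDeriv {x₀ : M} (i : Fin s) {O : Set M} (hO : IsOpen O)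
    {u : M → ExteriorAlgebra ℝ (Module.Dual ℝ F)} (hu : SmoothCoeffOn s u O) :
    SmoothCoeffOn s (fun x => coeffDeriv x₀ i x u)
      (O ∩ (chartAt (EuclideanSpace ℝ (Fin s)) x₀).source) := by
  intro ℓ
  refine (contMDiffOn_chartDeriv i hO (hu ℓ)).congr fun x hx => ?_
  exact dual_coeffDeriv i hO hx.1 hx.2 hu ℓ

theorem coeffDeriv_mem_extParity {x₀ x : M} (i : Fin s) {O : Set M} (hO : IsOpen O) (hxO : x ∈ O)
    (hx : x ∈ (chartAt (EuclideanSpace ℝ (Fin s)) x₀).source)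
    {u : M → ExteriorAlgebra ℝ (Module.Dual ℝ F)} (hu : SmoothCoeffOn s u O) {j : ZMod 2}
    (hj : ∀ y ∈ O, u y ∈ extParity (Module.Dual ℝ F) j) :
    coeffDeriv x₀ i x u ∈ extParity (Module.Dual ℝ F) j := by
  apply mem_extParity_of_involute
  have h1 := coeffDeriv_linear i hO hxO hx hu (CliffordAlgebra.involute (Q := 0)).toLinearMap
  have h2 := coeffDeriv_linear i hO hxO hx hu (superSign 1 j • LinearMap.id)
  rw [LinearMap.smul_apply, LinearMap.id_apply] at h2
  rw [← h2]
  refine h1.symm.trans (coeffDeriv_congr hx ?_)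
  filter_upwards [hO.mem_nhds hxO] with y hy
  exact involute_of_mem_extParity (hj y hy)

end CoefficientDerivatives

/-! ### Coordinates and coordinate vector fields of a patch -/

section PatchFrames

open Bundle Set Filter Topology
open CliffordAlgebra (contractLeft)

variable (s : ℕ) {M : Type*} [TopologicalSpace M] [ChartedSpace (EuclideanSpace ℝ (Fin s)) M]
  (F : Type*) [NormedAddCommGroup F] [NormedSpace ℝ F] [FiniteDimensional ℝ F]
  (V : M → Type*) [∀ x, AddCommGroup (V x)] [∀ x, Module ℝ (V x)]
  [TopologicalSpace (TotalSpace F V)] [∀ x, TopologicalSpace (V x)] [FiberBundle F V]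
  [VectorBundle ℝ F V]

/-- An open set `W` that is a disjoint union of open pieces, each contained in the domains of the
chart and of the trivialization centred at a point `j x`, together with a function `χ` supported in
`W` and a function `θ` supported in `W` that is `1` around all points where `χ` does not vanish. As
`j` is locally constant on `W`, the charts and trivializations form a single smooth frame over `W`.
-/
structure FramePatch where
  /-- the open set -/
  W : Set M
  /-- the centre of the chart and of the trivialization used around a point of `W` -/
  j : M → M
  mem_chart : ∀ x ∈ W, x ∈ (chartAt (EuclideanSpace ℝ (Fin s)) (j x)).source
  mem_base : ∀ x ∈ W, x ∈ (trivializationAt F V (j x)).baseSet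
  j_eventually : ∀ x ∈ W, ∀ᶠ y in 𝓝 x, j y = j x
  /-- the weight of the patch -/
  χ : M → ℝ
  /-- the cutoff function for the coordinates -/
  θ : M → ℝ
  contMDiff_χ : ContMDiff (𝓡 s) 𝓘(ℝ, ℝ) ∞ χ
  contMDiff_θ : ContMDiff (𝓡 s) 𝓘(ℝ, ℝ) ∞ θ
  χ_zero : ∀ᶠ x in 𝓝ˢ Wᶜ, χ x = 0
  θ_zero : ∀ᶠ x in 𝓝ˢ Wᶜ, θ x = 0
  θ_one : ∀ x, χ x ≠ 0 → ∀ᶠ y in 𝓝 x, θ y = 1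

variable {s F V}

/-- A smooth function as an element of `Γ(⋀ V*)`. -/
def scalarSection (f : M → ℝ) (hf : ContMDiff (𝓡 s) 𝓘(ℝ, ℝ) ∞ f) : exteriorSections s F V :=
  ⟨fun x => algebraMap ℝ _ (f x), fun x₀ ℓ => by
    refine ((hf.contMDiffOn (s := (trivializationAt F V x₀).baseSet)).mul
      (contMDiffOn_const (c := ℓ 1))).congr fun x _ => ?_
    simp only [AlgHom.commutes]
    rw [Algebra.algebraMap_eq_smul_one, map_smul, smul_eq_mul]
    rfl⟩

theorem scalarSection_mem (f : M → ℝ) (hf : ContMDiff (𝓡 s) 𝓘(ℝ, ℝ) ∞ f) :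
    scalarSection f hf ∈ sectionParity s F V 0 := fun _ => algebraMap_mem_extParity _

theorem sectionParity_mul_mem {i k : ZMod 2} {a b : exteriorSections s F V}
    (ha : a ∈ sectionParity s F V i) (hb : b ∈ sectionParity s F V k) :
    a * b ∈ sectionParity s F V (i + k) := fun x => mul_mem_extParity (ha x) (hb x)

theorem sectionParity_mul_comm {i k : ZMod 2} {a b : exteriorSections s F V}
    (ha : a ∈ sectionParity s F V i) (hb : b ∈ sectionParity s F V k) :
    a * b = superSign i k • (b * a) :=
  Subtype.ext (funext fun x => mul_eq_superSign_smul_mul (ha x) (hb x))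

namespace FramePatch

variable (P : FramePatch s F V)

theorem mem_of_χ_ne {x : M} (hx : P.χ x ≠ 0) : x ∈ P.W := by
  by_contra h
  exact hx (P.χ_zero.self_of_nhdsSet x h)

variable [ContMDiffVectorBundle ∞ F V (𝓡 s)]

theorem localSection_mem {ψ : M → ℝ} (hψ : ContMDiff (𝓡 s) 𝓘(ℝ, ℝ) ∞ ψ)
    (h0 : ∀ᶠ x in 𝓝ˢ P.Wᶜ, ψ x = 0) {u : M → ExteriorAlgebra ℝ (Module.Dual ℝ F)}
    (hu : ∀ x ∈ P.W, ∃ O, IsOpen O ∧ x ∈ O ∧ ∃ v : M → ExteriorAlgebra ℝ (Module.Dual ℝ F),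
      (∀ᶠ y in 𝓝 x, u y = v y) ∧ SmoothCoeffOn s v O) :
    (fun x => ψ x • localCorep F V (P.j x) x (u x)) ∈ exteriorSections s F V := by
  refine mem_exteriorSections_of_local fun x => ?_
  by_cases hx : x ∈ P.W
  · obtain ⟨O, hO, hxO, v, huv, hv⟩ := hu x hx
    have hev : ∀ᶠ y in 𝓝 x, y ∈ O ∧ P.j y = P.j x ∧ u y = v y ∧
        y ∈ (trivializationAt F V (P.j x)).baseSet := by
      filter_upwards [hO.mem_nhds hxO, P.j_eventually x hx, huv,
        (trivializationAt F V (P.j x)).open_baseSet.mem_nhds (P.mem_base x hx)] with y h1 h2 h3 h4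
      exact ⟨h1, h2, h3, h4⟩
    obtain ⟨O', hO's, hO', hxO'⟩ := eventually_nhds_iff.1 hev
    refine ⟨P.j x, O', hO', hxO', fun y hy => (hO's y hy).2.2.2, fun ℓ => ?_⟩
    have h1 : ContMDiffOn (𝓡 s) 𝓘(ℝ, ℝ) ∞ (fun y => ψ y * ℓ (v y)) O' :=
      hψ.contMDiffOn.mul ((hv ℓ).mono fun y hy => (hO's y hy).1)
    refine h1.congr fun y hy => ?_
    obtain ⟨-, h2, h3, h4⟩ := hO's y hy
    beta_reduce
    rw [extAlgHom_smul, map_smul, smul_eq_mul, h2, h3, localRep_localCorep h4]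
  · obtain ⟨O, hOs, hO, hxO⟩ := eventually_nhds_iff.1 (eventually_nhdsSet_iff_forall.1 h0 x hx)
    refine ⟨x, O ∩ (trivializationAt F V x).baseSet,
      hO.inter (trivializationAt F V x).open_baseSet,
      ⟨hxO, mem_baseSet_trivializationAt F V x⟩, inter_subset_right, fun ℓ => ?_⟩
    refine (contMDiffOn_const (c := (0 : ℝ))).congr fun y hy => ?_
    beta_reduce
    rw [hOs y hy.1, zero_smul, map_zero, map_zero]

/-- The odd coordinates of a patch: the cut off local frame of `V*`. -/
def oddCoord (k : Fin (Module.finrank ℝ (Module.Dual ℝ F))) : exteriorSections s F V :=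
  ⟨fun x => P.θ x • localCorep F V (P.j x) x
      (ExteriorAlgebra.ι ℝ (Module.finBasis ℝ (Module.Dual ℝ F) k)),
    P.localSection_mem P.contMDiff_θ P.θ_zero fun x _ =>
      ⟨univ, isOpen_univ, mem_univ x, fun _ => _, Eventually.of_forall fun _ => rfl,
        SmoothCoeffOn.const _ _⟩⟩

/-- The odd coordinate vector fields of a patch, multiplied by the weight `χ`: contractions with
the local frame of `V`. -/
def oddDer (k : Fin (Module.finrank ℝ (Module.Dual ℝ F))) :
    Module.End ℝ (exteriorSections s F V) where
  toFun a := ⟨fun x => P.χ x • localCorep F V (P.j x) x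
      (contractLeft ((Module.finBasis ℝ (Module.Dual ℝ F)).coord k)
        (localRep F V (P.j x) x (a.1 x))),
    P.localSection_mem P.contMDiff_χ P.χ_zero fun x hx =>
      ⟨_, (trivializationAt F V (P.j x)).open_baseSet, P.mem_base x hx,
        fun y => contractLeft ((Module.finBasis ℝ (Module.Dual ℝ F)).coord k)
          (localRep F V (P.j x) y (a.1 y)), by
        filter_upwards [P.j_eventually x hx] with y hy
        rw [hy], SmoothCoeffOn.linear (fun ℓ => a.2 (P.j x) ℓ) _⟩⟩
  map_add' a b := Subtype.ext (funext fun x => by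
    change P.χ x • localCorep F V (P.j x) x (contractLeft _ (localRep F V (P.j x) x
      (a.1 x + b.1 x))) = P.χ x • localCorep F V (P.j x) x _ + P.χ x • localCorep F V (P.j x) x _
    rw [extAlgHom_add, map_add, extAlgHom_add, smul_add])
  map_smul' c a := Subtype.ext (funext fun x => by
    change P.χ x • localCorep F V (P.j x) x (contractLeft _ (localRep F V (P.j x) x
      (c • a.1 x))) = c • P.χ x • localCorep F V (P.j x) x _
    rw [extAlgHom_smul, map_smul, extAlgHom_smul, smul_comm])

theorem oddCoord_apply (k) (x : M) : (P.oddCoord k).1 x = P.θ x • localCorep F V (P.j x) x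
      (ExteriorAlgebra.ι ℝ (Module.finBasis ℝ (Module.Dual ℝ F) k)) := rfl

theorem oddDer_apply (k) (a : exteriorSections s F V) (x : M) : (P.oddDer k a).1 x =
    P.χ x • localCorep F V (P.j x) x
      (contractLeft ((Module.finBasis ℝ (Module.Dual ℝ F)).coord k)
        (localRep F V (P.j x) x (a.1 x))) := rfl

variable [IsManifold (𝓡 s) ∞ M]

/-- The even coordinates of a patch: the cut off coordinates of the charts. -/
def evenCoord (i : Fin s) : exteriorSections s F V :=
  scalarSection (fun x => P.θ x * chartCoord (P.j x) i x)
    (contMDiff_mul_of_eventually_zero P.contMDiff_θ P.θ_zero fun x hx => by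
      refine ((contMDiffOn_chartCoord (P.j x) i).contMDiffAt
        ((chartAt (EuclideanSpace ℝ (Fin s)) (P.j x)).open_source.mem_nhds
          (P.mem_chart x hx))).congr_of_eventuallyEq ?_
      filter_upwards [P.j_eventually x hx] with y hy
      rw [hy])

/-- The even coordinate vector fields of a patch, multiplied by the weight `χ`: partial derivatives
of the coefficients with respect to the local frame of `⋀ V*`. -/
def evenDer (i : Fin s) : Module.End ℝ (exteriorSections s F V) where
  toFun a := ⟨fun x => P.χ x • localCorep F V (P.j x) x
      (coeffDeriv (P.j x) i x fun y => localRep F V (P.j x) y (a.1 y)),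
    P.localSection_mem P.contMDiff_χ P.χ_zero fun x hx =>
      ⟨_, (trivializationAt F V (P.j x)).open_baseSet.inter
        (chartAt (EuclideanSpace ℝ (Fin s)) (P.j x)).open_source,
        ⟨P.mem_base x hx, P.mem_chart x hx⟩,
        fun z => coeffDeriv (P.j x) i z fun y => localRep F V (P.j x) y (a.1 y), by
        filter_upwards [P.j_eventually x hx] with y hy
        rw [hy], SmoothCoeffOn.coeffDeriv i (trivializationAt F V (P.j x)).open_baseSet
          (fun ℓ => a.2 (P.j x) ℓ)⟩⟩
  map_add' a b := Subtype.ext (funext fun x => by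
    change P.χ x • localCorep F V (P.j x) x (coeffDeriv (P.j x) i x fun y =>
      localRep F V (P.j x) y (a.1 y + b.1 y)) =
      P.χ x • localCorep F V (P.j x) x _ + P.χ x • localCorep F V (P.j x) x _
    by_cases hx : P.χ x = 0
    · simp only [hx, zero_smul, add_zero]
    have hxW := P.mem_of_χ_ne hx
    simp only [extAlgHom_add]
    rw [coeffDeriv_add i (trivializationAt F V (P.j x)).open_baseSet (P.mem_base x hxW)
      (P.mem_chart x hxW) (fun ℓ => a.2 (P.j x) ℓ) (fun ℓ => b.2 (P.j x) ℓ), extAlgHom_add,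
      smul_add])
  map_smul' c a := Subtype.ext (funext fun x => by
    change P.χ x • localCorep F V (P.j x) x (coeffDeriv (P.j x) i x fun y =>
      localRep F V (P.j x) y (c • a.1 y)) = c • P.χ x • localCorep F V (P.j x) x _
    by_cases hx : P.χ x = 0
    · simp only [hx, zero_smul, smul_zero]
    have hxW := P.mem_of_χ_ne hx
    have h := coeffDeriv_linear i (trivializationAt F V (P.j x)).open_baseSet (P.mem_base x hxW)
      (P.mem_chart x hxW) (fun ℓ => a.2 (P.j x) ℓ) (c • LinearMap.id)
    simp only [LinearMap.smul_apply, LinearMap.id_apply] at h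
    simp only [extAlgHom_smul]
    rw [h, extAlgHom_smul, smul_comm])

theorem evenCoord_apply (i) (x : M) : (P.evenCoord i).1 x =
    algebraMap ℝ _ (P.θ x * chartCoord (P.j x) i x) := rfl

theorem evenDer_apply (i) (a : exteriorSections s F V) (x : M) : (P.evenDer i a).1 x =
    P.χ x • localCorep F V (P.j x) x
      (coeffDeriv (P.j x) i x fun y => localRep F V (P.j x) y (a.1 y)) := rfl

theorem evenDer_mem (i : Fin s) : P.evenDer i ∈ homogeneousDer (sectionParity s F V) 0 := by
  refine ⟨fun k a ha x => ?_, fun k a _ b => Subtype.ext (funext fun x => ?_)⟩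
  · rw [evenDer_apply, zero_add]
    by_cases hx : P.χ x = 0
    · rw [hx, zero_smul]; exact zero_mem _
    have hxW := P.mem_of_χ_ne hx
    refine Submodule.smul_mem _ _ (map_mem_extParity _ ?_)
    exact coeffDeriv_mem_extParity i (trivializationAt F V (P.j x)).open_baseSet
      (P.mem_base x hxW) (P.mem_chart x hxW) (fun ℓ => a.2 (P.j x) ℓ)
      fun y _ => map_mem_extParity _ (ha y)
  · rw [superSign_zero_left, one_smul]
    change (P.evenDer i (a * b)).1 x = (P.evenDer i a).1 x * b.1 x + a.1 x * (P.evenDer i b).1 x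
    simp only [evenDer_apply]
    by_cases hx : P.χ x = 0
    · simp only [hx, zero_smul, zero_mul, mul_zero, add_zero]
    have hxW := P.mem_of_χ_ne hx
    have h1 : ∀ y, localRep F V (P.j x) y ((a * b).1 y) =
        localRep F V (P.j x) y (a.1 y) * localRep F V (P.j x) y (b.1 y) := fun y =>
      map_mul (localRep F V (P.j x) y) (a.1 y) (b.1 y)
    simp only [h1]
    rw [coeffDeriv_mul i (trivializationAt F V (P.j x)).open_baseSet (P.mem_base x hxW)
      (P.mem_chart x hxW) (fun ℓ => a.2 (P.j x) ℓ) (fun ℓ => b.2 (P.j x) ℓ), extAlgHom_add,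
      map_mul, map_mul, localCorep_localRep (P.mem_base x hxW),
      localCorep_localRep (P.mem_base x hxW), smul_add, smul_mul_assoc, mul_smul_comm]

theorem oddDer_mem (k) : P.oddDer k ∈ homogeneousDer (sectionParity s F V) 1 := by
  refine ⟨fun l a ha x => ?_, fun l a ha b => Subtype.ext (funext fun x => ?_)⟩
  · rw [oddDer_apply]
    exact Submodule.smul_mem _ _ (map_mem_extParity _
      (contractLeft_mem_extParity _ (map_mem_extParity _ (ha x))))
  · change (P.oddDer k (a * b)).1 x = (P.oddDer k a).1 x * b.1 x +
      superSign 1 l • (a.1 x * (P.oddDer k b).1 x)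
    simp only [oddDer_apply]
    by_cases hx : P.χ x = 0
    · simp only [hx, zero_smul, zero_mul, mul_zero, smul_zero, add_zero]
    have hxW := P.mem_of_χ_ne hx
    have h1 : localRep F V (P.j x) x ((a * b).1 x) =
        localRep F V (P.j x) x (a.1 x) * localRep F V (P.j x) x (b.1 x) :=
      map_mul (localRep F V (P.j x) x) (a.1 x) (b.1 x)
    have h2 : localRep F V (P.j x) x (a.1 x) ∈ extParity (Module.Dual ℝ F) l :=
      map_mem_extParity _ (ha x)
    rw [h1, contractLeft_mul_of_mem _ h2, extAlgHom_add, extAlgHom_smul,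
      map_mul, map_mul, localCorep_localRep (P.mem_base x hxW),
      localCorep_localRep (P.mem_base x hxW), smul_add, smul_mul_assoc, mul_smul_comm, smul_comm]

theorem evenCoord_mem (i : Fin s) : P.evenCoord i ∈ sectionParity s F V 0 := scalarSection_mem _ _

theorem oddCoord_mem (k) : P.oddCoord k ∈ sectionParity s F V 1 := fun _ =>
  Submodule.smul_mem _ _ (map_mem_extParity _ (ι_mem_extParity _))

theorem degreeOp_evenCoord (i : Fin s) : sectionDegreeOp s F V (P.evenCoord i) = 0 :=
  Subtype.ext (funext fun _ => degreeOp_algebraMap _)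

theorem degreeOp_oddCoord (k) : sectionDegreeOp s F V (P.oddCoord k) = P.oddCoord k :=
  Subtype.ext (funext fun x => by
    change degreeOp _ ((P.oddCoord k).1 x) = _
    rw [oddCoord_apply, map_smul, localCorep, degreeOp_map, degreeOp_ι])

theorem degreeOp_evenDer (i : Fin s) (a : exteriorSections s F V) :
    sectionDegreeOp s F V (P.evenDer i a) = P.evenDer i (sectionDegreeOp s F V a) :=
  Subtype.ext (funext fun x => by
    change degreeOp _ ((P.evenDer i a).1 x) = _
    rw [evenDer_apply, evenDer_apply]
    by_cases hx : P.χ x = 0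
    · simp only [hx, zero_smul, map_zero]
    have hxW := P.mem_of_χ_ne hx
    have h := coeffDeriv_linear i (trivializationAt F V (P.j x)).open_baseSet (P.mem_base x hxW)
      (P.mem_chart x hxW) (fun ℓ => a.2 (P.j x) ℓ) (degreeOp _)
    rw [map_smul, localCorep, degreeOp_map, ← h]
    congr 3
    funext y
    exact degreeOp_map _ _)

theorem degreeOp_oddDer (k) (a : exteriorSections s F V) :
    sectionDegreeOp s F V (P.oddDer k a) =
      P.oddDer k (sectionDegreeOp s F V a) - P.oddDer k a :=
  Subtype.ext (funext fun x => by
    change degreeOp _ ((P.oddDer k a).1 x) =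
      (P.oddDer k (sectionDegreeOp s F V a)).1 x - (P.oddDer k a).1 x
    have h : localRep F V (P.j x) x ((sectionDegreeOp s F V a).1 x) =
      degreeOp _ (localRep F V (P.j x) x (a.1 x)) := (degreeOp_map _ _).symm
    rw [oddDer_apply, oddDer_apply, map_smul, localCorep, degreeOp_map, degreeOp_contractLeft, h,
      ← smul_sub]
    congr 1
    exact extAlgHom_sub _ _ _)

theorem evenDer_evenCoord (i l : Fin s) : P.evenDer i (P.evenCoord l) =
    if i = l then scalarSection P.χ P.contMDiff_χ else 0 := by
  refine Subtype.ext (funext fun x => ?_)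
  rw [evenDer_apply]
  have hrhs : (if i = l then scalarSection P.χ P.contMDiff_χ else 0 : exteriorSections s F V).1 x =
      P.χ x • algebraMap ℝ _ (if i = l then 1 else 0) := by
    split_ifs
    · simp [scalarSection, Algebra.algebraMap_eq_smul_one]
    · simp
  rw [hrhs]
  by_cases hx : P.χ x = 0
  · simp only [hx, zero_smul]
  have hxW := P.mem_of_χ_ne hx
  congr 1
  have h1 : (fun y => localRep F V (P.j x) y ((P.evenCoord l).1 y)) =ᶠ[𝓝 x]
      fun y => algebraMap ℝ _ (chartCoord (P.j x) l y) := by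
    filter_upwards [P.j_eventually x hxW, P.θ_one x hx] with y h2 h3
    rw [evenCoord_apply, AlgHom.commutes, h2, h3, one_mul]
  have h2 : coeffDeriv (P.j x) i x
      (fun y => algebraMap ℝ (ExteriorAlgebra ℝ (Module.Dual ℝ F)) (chartCoord (P.j x) l y)) =
      algebraMap ℝ _ (if i = l then 1 else 0) := by
    have hopen := (chartAt (EuclideanSpace ℝ (Fin s)) (P.j x)).open_source
    have hc := contMDiffOn_chartCoord (P.j x) l
    have hsm : SmoothCoeffOn s (fun y => algebraMap ℝ (ExteriorAlgebra ℝ (Module.Dual ℝ F))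
        (chartCoord (P.j x) l y)) (chartAt (EuclideanSpace ℝ (Fin s)) (P.j x)).source := by
      intro ℓ
      refine (hc.mul (contMDiffOn_const (c := ℓ 1))).congr fun y _ => ?_
      beta_reduce
      rw [Algebra.algebraMap_eq_smul_one, map_smul, smul_eq_mul]
      rfl
    refine ext_of_dual fun ℓ => ?_
    rw [dual_coeffDeriv i hopen (P.mem_chart x hxW) (P.mem_chart x hxW) hsm]
    have h3 : (fun y => ℓ (algebraMap ℝ _ (chartCoord (P.j x) l y))) =
        fun y => chartCoord (P.j x) l y * ℓ 1 := by
      funext y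
      rw [Algebra.algebraMap_eq_smul_one, map_smul, smul_eq_mul]
    rw [h3, chartDeriv_mul i hopen hc contMDiffOn_const (P.mem_chart x hxW) (P.mem_chart x hxW),
      chartDeriv_coord (P.mem_chart x hxW), chartDeriv_const, Algebra.algebraMap_eq_smul_one,
      map_smul]
    simp
  rw [coeffDeriv_congr (P.mem_chart x hxW) h1, h2, AlgHom.commutes]

theorem evenDer_oddCoord (i : Fin s) (k) : P.evenDer i (P.oddCoord k) = 0 := by
  refine Subtype.ext (funext fun x => ?_)
  rw [evenDer_apply]
  by_cases hx : P.χ x = 0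
  · rw [hx, zero_smul]; rfl
  have hxW := P.mem_of_χ_ne hx
  have h1 : (fun y => localRep F V (P.j x) y ((P.oddCoord k).1 y)) =ᶠ[𝓝 x]
      fun _ => ExteriorAlgebra.ι ℝ (Module.finBasis ℝ (Module.Dual ℝ F) k) := by
    filter_upwards [P.j_eventually x hxW, P.θ_one x hx,
      (trivializationAt F V (P.j x)).open_baseSet.mem_nhds (P.mem_base x hxW)] with y h2 h3 h4
    rw [oddCoord_apply, h2, h3, one_smul, localRep_localCorep h4]
  rw [coeffDeriv_congr (P.mem_chart x hxW) h1, coeffDeriv_const, map_zero, smul_zero]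
  rfl

theorem oddDer_evenCoord (k) (i : Fin s) : P.oddDer k (P.evenCoord i) = 0 := by
  refine Subtype.ext (funext fun x => ?_)
  rw [oddDer_apply, evenCoord_apply, AlgHom.commutes, CliffordAlgebra.contractLeft_algebraMap,
    map_zero, smul_zero]
  rfl

theorem oddDer_oddCoord (k l) : P.oddDer k (P.oddCoord l) =
    if k = l then scalarSection P.χ P.contMDiff_χ else 0 := by
  refine Subtype.ext (funext fun x => ?_)
  rw [oddDer_apply]
  have hrhs : (if k = l then scalarSection P.χ P.contMDiff_χ else 0 : exteriorSections s F V).1 x =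
      P.χ x • algebraMap ℝ _ (if k = l then 1 else 0) := by
    split_ifs
    · simp [scalarSection, Algebra.algebraMap_eq_smul_one]
    · simp
  rw [hrhs]
  by_cases hx : P.χ x = 0
  · simp only [hx, zero_smul]
  have hxW := P.mem_of_χ_ne hx
  rw [oddCoord_apply, (P.θ_one x hx).self_of_nhds, one_smul,
    localRep_localCorep (P.mem_base x hxW), CliffordAlgebra.contractLeft_ι, AlgHom.commutes]
  congr 2
  rw [Module.Basis.coord_apply, Module.Basis.repr_self, Finsupp.single_apply]
  simp only [eq_comm]

end FramePatch

end PatchFrames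

/-! ### Expansion of superderivations in the coordinate vector fields of a patch -/

theorem smul_mem_homogeneousDer {A : Type*} [Ring A] [Algebra ℝ A] {𝒜 : ZMod 2 → Submodule ℝ A}
    (hmul : ∀ {i j : ZMod 2} {a b : A}, a ∈ 𝒜 i → b ∈ 𝒜 j → a * b ∈ 𝒜 (i + j))
    (hcomm : ∀ {i j : ZMod 2} {a b : A}, a ∈ 𝒜 i → b ∈ 𝒜 j → a * b = superSign i j • (b * a))
    {i j : ZMod 2} {a : A} (ha : a ∈ 𝒜 i) {X : Module.End ℝ A} (hX : X ∈ homogeneousDer 𝒜 j) :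
    a • X ∈ homogeneousDer 𝒜 (i + j) := by
  refine ⟨fun k b hb => ?_, fun k b hb c => ?_⟩
  · rw [LinearMap.smul_apply, smul_eq_mul, add_assoc]
    exact hmul ha (hX.1 k b hb)
  · simp only [LinearMap.smul_apply, smul_eq_mul]
    rw [hX.2 k b hb, mul_add, mul_smul_comm, ← mul_assoc, ← mul_assoc, hcomm ha hb, smul_mul_assoc,
      smul_smul, mul_assoc, mul_assoc]
    congr 2
    rcases parity_cases i with rfl | rfl <;> rcases parity_cases j with rfl | rfl <;>
      rcases parity_cases k with rfl | rfl <;> simp [parity_one_add_one]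

/-- The difference between a superderivation `X` and its expansion with respect to coordinates
`y`, `η` and vector fields `D`, `E` is a superderivation. It kills the coordinates if `D`, `E` are
`χ` times the dual frame. -/
theorem exists_expansion_remainder {A : Type*} [Ring A] [Algebra ℝ A]
    {𝒜 : ZMod 2 → Submodule ℝ A}
    (hmul : ∀ {i j : ZMod 2} {a b : A}, a ∈ 𝒜 i → b ∈ 𝒜 j → a * b ∈ 𝒜 (i + j))
    (hcomm : ∀ {i j : ZMod 2} {a b : A}, a ∈ 𝒜 i → b ∈ 𝒜 j → a * b = superSign i j • (b * a))
    {ι κ : Type*} [Fintype ι] [DecidableEq ι] [Fintype κ] [DecidableEq κ] {χ : A} (hχ : χ ∈ 𝒜 0)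
    (hχc : ∀ a, a * χ = χ * a) {y : ι → A} (hy : ∀ l, y l ∈ 𝒜 0) {η : κ → A}
    (hη : ∀ k, η k ∈ 𝒜 1) {D : ι → Module.End ℝ A} (hD : ∀ l, D l ∈ homogeneousDer 𝒜 0)
    {E : κ → Module.End ℝ A} (hE : ∀ k, E k ∈ homogeneousDer 𝒜 1)
    (hDy : ∀ l m, D l (y m) = if l = m then χ else 0) (hDη : ∀ l m, D l (η m) = 0)
    (hEy : ∀ l m, E l (y m) = 0) (hEη : ∀ l m, E l (η m) = if l = m then χ else 0)
    {i : ZMod 2} {X : Module.End ℝ A} (hX : X ∈ homogeneousDer 𝒜 i) :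
    ∃ R ∈ homogeneousDer 𝒜 i,
      (∀ a, R a = χ * X a - (∑ l, X (y l) * D l a + ∑ k, X (η k) * E k a)) ∧
      (∀ l, R (y l) = 0) ∧ ∀ k, R (η k) = 0 := by
  have key : ∀ a, (χ • X - (∑ l, X (y l) • D l + ∑ k, X (η k) • E k)) a =
      χ * X a - (∑ l, X (y l) * D l a + ∑ k, X (η k) * E k a) := fun a => by
    simp only [LinearMap.sub_apply, LinearMap.add_apply, LinearMap.sum_apply,
      LinearMap.smul_apply, smul_eq_mul]
  refine ⟨χ • X - (∑ l, X (y l) • D l + ∑ k, X (η k) • E k), ?_, key, fun l => ?_, fun k => ?_⟩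
  · refine sub_mem ?_ (add_mem (Submodule.sum_mem _ fun l _ => ?_)
      (Submodule.sum_mem _ fun k _ => ?_))
    · simpa using smul_mem_homogeneousDer hmul hcomm hχ hX
    · simpa using smul_mem_homogeneousDer hmul hcomm (hX.1 0 _ (hy l)) (hD l)
    · have h := smul_mem_homogeneousDer hmul hcomm (hX.1 1 _ (hη k)) (hE k)
      rwa [add_assoc, parity_one_add_one, add_zero] at h
  · simp [key, hDy, hEy, hχc]
  · simp [key, hDη, hEη, hχc]

section GlobalFrames

open Bundle Set Filter Topology

variable {s : ℕ} {M : Type*} [TopologicalSpace M] [ChartedSpace (EuclideanSpace ℝ (Fin s)) M]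
  {F : Type*} [NormedAddCommGroup F] [NormedSpace ℝ F] [FiniteDimensional ℝ F]
  {V : M → Type*} [∀ x, AddCommGroup (V x)] [∀ x, Module ℝ (V x)]
  [TopologicalSpace (TotalSpace F V)] [∀ x, TopologicalSpace (V x)] [FiberBundle F V]
  [VectorBundle ℝ F V]

/-- The value of a section at a point. -/
def evalSection (x : M) :
    exteriorSections s F V →ₗ[ℝ] ExteriorAlgebra ℝ (Module.Dual ℝ (V x)) where
  toFun a := a.1 x
  map_add' _ _ := rfl
  map_smul' _ _ := rfl

theorem evalSection_apply (x : M) (a : exteriorSections s F V) : evalSection x a = a.1 x := rfl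

theorem evalSection_mul (x : M) (a b : exteriorSections s F V) :
    evalSection x (a * b) = evalSection x a * evalSection x b := rfl

theorem evalSection_one (x : M) : evalSection x (1 : exteriorSections s F V) = 1 := rfl

theorem evalSection_scalarSection (x : M) (f : M → ℝ) (hf : ContMDiff (𝓡 s) 𝓘(ℝ, ℝ) ∞ f) :
    evalSection x (scalarSection (F := F) (V := V) f hf) = algebraMap ℝ _ (f x) := rfl

theorem one_mem_sectionParity : (1 : exteriorSections s F V) ∈ sectionParity s F V 0 := fun x => by
  have h := algebraMap_mem_extParity (W := Module.Dual ℝ (V x)) 1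
  rwa [map_one] at h

theorem homogeneousDer_sectionParity_one {i : ZMod 2} {X : Module.End ℝ (exteriorSections s F V)}
    (hX : X ∈ homogeneousDer (sectionParity s F V) i) : X 1 = 0 := by
  have h := hX.2 0 1 one_mem_sectionParity 1
  simpa using h

theorem mul_scalarSection (f : M → ℝ) (hf : ContMDiff (𝓡 s) 𝓘(ℝ, ℝ) ∞ f)
    (a : exteriorSections s F V) : a * scalarSection f hf = scalarSection f hf * a :=
  Subtype.ext (funext fun x => (Algebra.commutes (f x) (a.1 x)).symm)

variable [IsManifold (𝓡 s) ∞ M] [T2Space M] [SecondCountableTopology M]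

/-- Superderivations are local operators, as multiplication with a cutoff function shows. -/
theorem homogeneousDer_apply_congr {i : ZMod 2} {R : Module.End ℝ (exteriorSections s F V)}
    (hR : R ∈ homogeneousDer (sectionParity s F V) i) {a b : exteriorSections s F V} {x : M}
    (h : ∀ᶠ y in 𝓝 x, a.1 y = b.1 y) : (R a).1 x = (R b).1 x := by
  suffices H : ∀ c : exteriorSections s F V, (∀ᶠ y in 𝓝 x, c.1 y = 0) → (R c).1 x = 0 by
    have h1 := H (a - b) (by
      filter_upwards [h] with y hy
      exact sub_eq_zero.2 hy)
    rw [map_sub] at h1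
    exact sub_eq_zero.1 h1
  intro c hc
  obtain ⟨O, hOs, hO, hxO⟩ := eventually_nhds_iff.1 hc
  obtain ⟨χ, h1, h2, h3⟩ := exists_cutoff s hO isClosed_singleton (singleton_subset_iff.2 hxO)
  have hχx : χ x = 1 := (h3.self_of_nhdsSet x rfl)
  have hzero : scalarSection χ h1 * c = 0 := by
    refine Subtype.ext (funext fun y => ?_)
    change algebraMap ℝ _ (χ y) * c.1 y = 0
    by_cases hy : y ∈ O
    · rw [hOs y hy, mul_zero]
    · rw [h2.self_of_nhdsSet y hy, map_zero, zero_mul]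
  have h4 := hR.2 0 _ (scalarSection_mem χ h1) c
  rw [hzero, map_zero, superSign_zero_right, one_smul] at h4
  have h5 := congrFun (congrArg Subtype.val h4) x
  change 0 = (R (scalarSection χ h1)).1 x * c.1 x + algebraMap ℝ _ (χ x) * (R c).1 x at h5
  rw [hOs x hxO, mul_zero, zero_add, hχx, map_one, one_mul] at h5
  exact h5.symm

variable [ContMDiffVectorBundle ∞ F V (𝓡 s)]

namespace FramePatch

variable (P : FramePatch s F V)

/-- A superderivation that kills the even coordinates of a patch at `x` kills all functions at
`x`, by Hadamard's lemma. -/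
theorem homogeneousDer_scalarSection_eq_zero {x : M} (hx : x ∈ P.W)
    (hθ : ∀ᶠ y in 𝓝 x, P.θ y = 1)
    {i : ZMod 2} {R : Module.End ℝ (exteriorSections s F V)}
    (hR : R ∈ homogeneousDer (sectionParity s F V) i)
    (h1 : ∀ l, evalSection x (R (P.evenCoord l)) = 0)
    (f : M → ℝ) (hf : ContMDiff (𝓡 s) 𝓘(ℝ, ℝ) ∞ f) :
    evalSection x (R (scalarSection f hf)) = 0 := by
  have hconst : ∀ c : ℝ, R (c • 1) = 0 := fun c => by
    rw [map_smul, homogeneousDer_sectionParity_one hR, smul_zero]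
  obtain ⟨g, hg, hfg⟩ := exists_hadamard isOpen_univ (mem_univ x) (P.mem_chart x hx)
    (hf.contMDiffOn (s := univ))
  obtain ⟨y, hy⟩ : ∃ y : Fin s → exteriorSections s F V,
    ∀ l, y l = P.evenCoord l - chartCoord (P.j x) l x • 1 := ⟨_, fun _ => rfl⟩
  obtain ⟨b, hb⟩ : ∃ b : exteriorSections s F V,
    b = f x • 1 + ∑ l, y l * scalarSection (g l) (hg l) := ⟨_, rfl⟩
  have hloc : ∀ᶠ z in 𝓝 x, (scalarSection (F := F) (V := V) f hf).1 z = b.1 z := by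
    filter_upwards [hfg, hθ, P.j_eventually x hx] with z h3 h4 h5
    rw [← evalSection_apply, ← evalSection_apply, hb, map_add, map_sum, map_smul,
      evalSection_one, evalSection_scalarSection, h3, map_add, map_sum,
      Algebra.algebraMap_eq_smul_one]
    congr 1
    refine Finset.sum_congr rfl fun l _ => ?_
    rw [evalSection_mul, evalSection_scalarSection, hy, map_sub, map_smul, evalSection_one,
      evalSection_apply, evenCoord_apply, h4, h5, one_mul, map_mul, map_sub,
      Algebra.algebraMap_eq_smul_one (chartCoord (P.j x) l x)]
  rw [evalSection_apply, homogeneousDer_apply_congr hR hloc, ← evalSection_apply, hb, map_add,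
    hconst, zero_add, map_sum, map_sum]
  refine Finset.sum_eq_zero fun l _ => ?_
  have hyl : y l ∈ sectionParity s F V 0 := by
    rw [hy]
    exact sub_mem (P.evenCoord_mem l) (Submodule.smul_mem _ _ one_mem_sectionParity)
  have hRy : evalSection x (R (y l)) = 0 := by
    rw [hy, map_sub, hconst, sub_zero, h1]
  have hyx : evalSection x (y l) = 0 := by
    rw [hy, map_sub, map_smul, evalSection_one, evalSection_apply, evenCoord_apply,
      hθ.self_of_nhds, one_mul, Algebra.algebraMap_eq_smul_one, sub_self]
  rw [hR.2 0 _ hyl, superSign_zero_right, one_smul, map_add, evalSection_mul, evalSection_mul,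
    hRy, hyx, zero_mul, zero_mul, add_zero]

/-- Around `x`, every form with constant coefficients in the odd coordinates is the restriction
of a section killed at `x` by each superderivation that kills the odd coordinates at `x`. -/
theorem exists_eventually_localCorep {x : M} (hx : x ∈ P.W)
    (hθ : ∀ᶠ y in 𝓝 x, P.θ y = 1)
    {i : ZMod 2} {R : Module.End ℝ (exteriorSections s F V)}
    (hR : R ∈ homogeneousDer (sectionParity s F V) i)
    (h2 : ∀ k, evalSection x (R (P.oddCoord k)) = 0)
    (w : ExteriorAlgebra ℝ (Module.Dual ℝ F)) : ∃ b : exteriorSections s F V,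
      (∀ᶠ y in 𝓝 x, b.1 y = localCorep F V (P.j x) y w) ∧ evalSection x (R b) = 0 := by
  have hconst : ∀ c : ℝ, R (c • 1) = 0 := fun c => by
    rw [map_smul, homogeneousDer_sectionParity_one hR, smul_zero]
  induction w using CliffordAlgebra.left_induction with
  | algebraMap r =>
    refine ⟨r • 1, Eventually.of_forall fun y => ?_, by rw [hconst, map_zero]⟩
    rw [AlgHom.commutes, Algebra.algebraMap_eq_smul_one]
    rfl
  | add u v hu hv =>
    obtain ⟨b, hb1, hb2⟩ := hu
    obtain ⟨c, hc1, hc2⟩ := hv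
    refine ⟨b + c, ?_, by rw [map_add, map_add, hb2, hc2, add_zero]⟩
    filter_upwards [hb1, hc1] with y hy1 hy2
    rw [extAlgHom_add, ← hy1, ← hy2]
    rfl
  | ι_mul u m hu =>
    obtain ⟨b, hb1, hb2⟩ := hu
    obtain ⟨η, hη⟩ : ∃ η : exteriorSections s F V, η = ∑ k,
      (Module.finBasis ℝ (Module.Dual ℝ F)).repr m k • P.oddCoord k := ⟨_, rfl⟩
    have hη1 : η ∈ sectionParity s F V 1 := by
      rw [hη]
      exact Submodule.sum_mem _ fun k _ => Submodule.smul_mem _ _ (P.oddCoord_mem k)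
    have hηx : evalSection x (R η) = 0 := by
      rw [hη, map_sum, map_sum]
      refine Finset.sum_eq_zero fun k _ => ?_
      rw [map_smul, map_smul, h2, smul_zero]
    refine ⟨η * b, ?_, ?_⟩
    · filter_upwards [hb1, hθ, P.j_eventually x hx] with y hy1 hy2 hy3
      rw [← evalSection_apply, evalSection_mul, map_mul, evalSection_apply y b, hy1]
      congr 1
      rw [hη, map_sum]
      conv_rhs => rw [← (Module.finBasis ℝ (Module.Dual ℝ F)).sum_repr m]
      refine Eq.trans ?_ (map_sum ((localCorep F V (P.j x) y).toLinearMap ∘ₗ ExteriorAlgebra.ι ℝ)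
        _ _).symm
      refine Finset.sum_congr rfl fun k _ => ?_
      rw [map_smul, map_smul, evalSection_apply, oddCoord_apply, hy2, hy3, one_smul]
      rfl
    · rw [hR.2 1 _ hη1, map_add, map_smul, evalSection_mul, evalSection_mul, hηx, hb2, zero_mul,
        mul_zero, smul_zero, add_zero]

/-- A superderivation that kills the coordinates of a patch at a point `x` vanishes at `x`, as every
section is near `x` a combination of forms with constant coefficients. -/
theorem homogeneousDer_apply_eq_zero {x : M} (hx : x ∈ P.W) (hθ : ∀ᶠ y in 𝓝 x, P.θ y = 1)
    {i : ZMod 2} {R : Module.End ℝ (exteriorSections s F V)}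
    (hR : R ∈ homogeneousDer (sectionParity s F V) i)
    (h1 : ∀ l, evalSection x (R (P.evenCoord l)) = 0)
    (h2 : ∀ k, evalSection x (R (P.oddCoord k)) = 0)
    (a : exteriorSections s F V) : evalSection x (R a) = 0 := by
  choose e he1 he2 using P.exists_eventually_localCorep hx hθ hR h2
  have hbase := P.mem_base x hx
  have hopen := (trivializationAt F V (P.j x)).open_baseSet
  choose c hc hce using fun k => exists_contMDiff_eventuallyEq hopen hbase
    (a.2 (P.j x) ((extBasis F).coord k))
  obtain ⟨b, hb⟩ : ∃ b : exteriorSections s F V,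
    b = ∑ k, scalarSection (c k) (hc k) * e (extBasis F k) := ⟨_, rfl⟩
  have hloc : ∀ᶠ y in 𝓝 x, a.1 y = b.1 y := by
    filter_upwards [eventually_all.2 hce, eventually_all.2 fun k => he1 (extBasis F k),
      hopen.mem_nhds hbase] with y h3 h4 h5
    rw [← evalSection_apply y b, hb, map_sum, ← localCorep_localRep h5 (a.1 y)]
    conv_lhs => rw [← (extBasis F).sum_repr (localRep F V (P.j x) y (a.1 y))]
    refine (map_sum (localCorep F V (P.j x) y).toLinearMap _ _).trans
      (Finset.sum_congr rfl fun k _ => ?_)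
    rw [map_smul, evalSection_mul, evalSection_scalarSection, h3, evalSection_apply, h4,
      ← Algebra.smul_def]
    rfl
  rw [evalSection_apply, homogeneousDer_apply_congr hR hloc, ← evalSection_apply, hb, map_sum,
    map_sum]
  refine Finset.sum_eq_zero fun k _ => ?_
  rw [hR.2 0 _ (scalarSection_mem _ _), superSign_zero_right, one_smul, map_add, evalSection_mul,
    evalSection_mul, P.homogeneousDer_scalarSection_eq_zero hx hθ hR h1, he2, zero_mul, mul_zero,
    add_zero]

/-- The expansion of a superderivation in the coordinate vector fields of a patch, which contain the
weight `χ`. -/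
theorem expansion {i : ZMod 2} {X : Module.End ℝ (exteriorSections s F V)}
    (hX : X ∈ homogeneousDer (sectionParity s F V) i) (a : exteriorSections s F V) :
    scalarSection P.χ P.contMDiff_χ * X a = ∑ l, X (P.evenCoord l) * P.evenDer l a +
      ∑ k, X (P.oddCoord k) * P.oddDer k a := by
  obtain ⟨R, hR, hRa, hRy, hRη⟩ := exists_expansion_remainder
    (A := exteriorSections s F V) (𝒜 := sectionParity s F V)
    (χ := scalarSection P.χ P.contMDiff_χ) (y := P.evenCoord) (η := P.oddCoord) (D := P.evenDer)
    (E := P.oddDer) sectionParity_mul_mem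
    sectionParity_mul_comm (scalarSection_mem P.χ P.contMDiff_χ)
    (mul_scalarSection _ _) P.evenCoord_mem
    P.oddCoord_mem P.evenDer_mem P.oddDer_mem P.evenDer_evenCoord P.evenDer_oddCoord
    P.oddDer_evenCoord P.oddDer_oddCoord hX
  rw [← sub_eq_zero, ← hRa]
  refine Subtype.ext (funext fun x => ?_)
  change evalSection x (R a) = 0
  by_cases hx : P.χ x = 0
  · rw [hRa, map_sub, map_add, map_sum, map_sum, evalSection_mul, evalSection_scalarSection, hx,
      map_zero, zero_mul, zero_sub, neg_eq_zero, Finset.sum_eq_zero, Finset.sum_eq_zero, add_zero]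
    · intro k _
      rw [evalSection_mul, evalSection_apply x (P.oddDer k a), oddDer_apply, hx, zero_smul,
        mul_zero]
    · intro k _
      rw [evalSection_mul, evalSection_apply x (P.evenDer k a), evenDer_apply, hx, zero_smul,
        mul_zero]
  · exact P.homogeneousDer_apply_eq_zero (P.mem_of_χ_ne hx) (P.θ_one x hx) hR
      (fun l => by rw [hRy, map_zero]) (fun k => by rw [hRη, map_zero]) a

end FramePatch

end GlobalFrames

/-! ### Euler frames -/

open Polynomial in
/-- The algebraic properties of functions on a supermanifold of dimension `(s, r)` with an Euler
operator `e` on which everything depends: homogeneous even and odd coordinates `y` and `η`, finite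
in number, with vector fields `D` and `E` such that `X = ∑ X(y) D + ∑ X(η) E` for all vector
fields `X`. The coordinates are not independent, but the traces `∑ D(y)` and `∑ E(η)` still are
`s` and `r`. -/
structure EulerFrame {A : Type*} [Ring A] [Algebra ℝ A] (𝒜 : ZMod 2 → Submodule ℝ A)
    (e : Module.End ℝ A) (ι κ : Type) [Fintype ι] [Fintype κ] (s r : ℕ) where
  /-- the even coordinates -/
  y : ι → A
  /-- the odd coordinates -/
  η : κ → A
  /-- the even coordinate vector fields -/
  D : ι → Module.End ℝ A
  /-- the odd coordinate vector fields -/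
  E : κ → Module.End ℝ A
  mul_comm' : ∀ {i j : ZMod 2} {a b : A}, a ∈ 𝒜 i → b ∈ 𝒜 j → a * b = superSign i j • (b * a)
  e_mem : e ∈ homogeneousDer 𝒜 0
  aeval_e : aeval e (∏ k ∈ Finset.range (r + 1), (X - C (k : ℝ))) = 0
  mem_of_e_eq : ∀ {k : ℤ} {a : A}, e a = (k : ℝ) • a → a ∈ 𝒜 k
  eq_zero_of_mul_self : ∀ {a : A}, e a = 0 → a * a = 0 → a = 0
  y_mem : ∀ l, y l ∈ 𝒜 0
  η_mem : ∀ k, η k ∈ 𝒜 1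
  e_y : ∀ l, e (y l) = 0
  e_η : ∀ k, e (η k) = η k
  D_mem : ∀ l, D l ∈ homogeneousDer 𝒜 0
  E_mem : ∀ k, E k ∈ homogeneousDer 𝒜 1
  e_D : ∀ l a, e (D l a) = D l (e a)
  e_E : ∀ k a, e (E k a) = E k (e a) - E k a
  expansion : ∀ {i : ZMod 2} {X : Module.End ℝ A}, X ∈ homogeneousDer 𝒜 i →
    ∀ a, X a = ∑ l, X (y l) * D l a + ∑ k, X (η k) * E k a
  sum_D : ∑ l, D l (y l) = (s : ℝ) • 1
  sum_E : ∑ k, E k (η k) = (r : ℝ) • 1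

/-- A map that intertwines two operators intertwines polynomials in them. -/
theorem apply_aeval_of_comm {M N : Type*} [AddCommGroup M] [Module ℝ M] [AddCommGroup N]
    [Module ℝ N] (T : M →ₗ[ℝ] N) {f : Module.End ℝ M} {g : Module.End ℝ N}
    (h : ∀ a, T (f a) = g (T a)) (p : Polynomial ℝ) (a : M) :
    T (Polynomial.aeval f p a) = Polynomial.aeval g p (T a) := by
  induction p using Polynomial.induction_on' with
  | add p q hp hq => rw [map_add, map_add, LinearMap.add_apply, LinearMap.add_apply, map_add,
      hp, hq]
  | monomial n c =>
    rw [Polynomial.aeval_monomial, Polynomial.aeval_monomial]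
    have h1 : ∀ n : ℕ, T ((f ^ n) a) = (g ^ n) (T a) := by
      intro n
      induction n with
      | zero => rfl
      | succ n ih => rw [pow_succ', pow_succ', Module.End.mul_apply, Module.End.mul_apply, h, ih]
    simp [h1]

/-- The superderivations correspond to each other under an isomorphism of superalgebras. -/
theorem conj_mem_homogeneousDer {A B : Type*} [Ring A] [Algebra ℝ A] [Ring B] [Algebra ℝ B]
    {𝒜 : ZMod 2 → Submodule ℝ A} {ℬ : ZMod 2 → Submodule ℝ B} (f : A ≃ₐ[ℝ] B)
    (hf : ∀ (i : ZMod 2) (a : A), f a ∈ ℬ i ↔ a ∈ 𝒜 i) {i : ZMod 2} {X : Module.End ℝ B}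
    (hX : X ∈ homogeneousDer ℬ i) :
    f.symm.toLinearMap ∘ₗ X ∘ₗ f.toLinearMap ∈ homogeneousDer 𝒜 i := by
  refine ⟨fun j a ha => ?_, fun j a ha b => ?_⟩
  · rw [← hf]
    simpa using hX.1 j _ ((hf j a).2 ha)
  · apply f.injective
    simpa using hX.2 j _ ((hf j a).2 ha) (f b)

/-- Transport of an Euler frame along an isomorphism of superalgebras. -/
def EulerFrame.transport {A B : Type*} [Ring A] [Algebra ℝ A] [Ring B] [Algebra ℝ B]
    {𝒜 : ZMod 2 → Submodule ℝ A} {ℬ : ZMod 2 → Submodule ℝ B} (f : A ≃ₐ[ℝ] B)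
    (hf : ∀ (i : ZMod 2) (a : A), f a ∈ ℬ i ↔ a ∈ 𝒜 i) {e : Module.End ℝ B} {ι κ : Type}
    [Fintype ι] [Fintype κ] {s r : ℕ} (P : EulerFrame ℬ e ι κ s r) :
    EulerFrame 𝒜 (f.symm.toLinearMap ∘ₗ e ∘ₗ f.toLinearMap) ι κ s r where
  y l := f.symm (P.y l)
  η k := f.symm (P.η k)
  D l := f.symm.toLinearMap ∘ₗ P.D l ∘ₗ f.toLinearMap
  E k := f.symm.toLinearMap ∘ₗ P.E k ∘ₗ f.toLinearMap
  mul_comm' {i j a b} ha hb := by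
    apply f.injective
    rw [map_mul, map_smul, map_mul]
    exact P.mul_comm' ((hf i a).2 ha) ((hf j b).2 hb)
  e_mem := conj_mem_homogeneousDer f hf P.e_mem
  aeval_e := by
    refine LinearMap.ext fun a => f.injective ?_
    have h := apply_aeval_of_comm f.toLinearMap (g := e)
      (f := f.symm.toLinearMap ∘ₗ e ∘ₗ f.toLinearMap) (fun a => by simp)
      (∏ k ∈ Finset.range (r + 1), (Polynomial.X - Polynomial.C (k : ℝ))) a
    rw [P.aeval_e] at h
    simpa only [LinearMap.zero_apply, map_zero, AlgEquiv.toLinearMap_apply] using h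
  mem_of_e_eq {k a} h := by
    rw [← hf]
    refine P.mem_of_e_eq ?_
    have := congrArg f h
    simpa using this
  eq_zero_of_mul_self {a} h1 h2 := by
    apply f.injective
    rw [map_zero]
    refine P.eq_zero_of_mul_self ?_ ?_
    · simpa using congrArg f h1
    · simpa using congrArg f h2
  y_mem l := by
    rw [← hf]
    simpa using P.y_mem l
  η_mem k := by
    rw [← hf]
    simpa using P.η_mem k
  e_y l := by simp [P.e_y]
  e_η k := by simp [P.e_η]
  D_mem l := conj_mem_homogeneousDer f hf (P.D_mem l)
  E_mem k := conj_mem_homogeneousDer f hf (P.E_mem k)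
  e_D l a := by simp [P.e_D]
  e_E k a := by simp [P.e_E]
  expansion {i X} hX a := by
    have h := P.expansion (conj_mem_homogeneousDer (X := X) f.symm (fun i b => by
      rw [← hf, AlgEquiv.apply_symm_apply]) hX) (f a)
    apply f.injective
    simpa using h
  sum_D := by
    apply f.injective
    simpa using P.sum_D
  sum_E := by
    apply f.injective
    simpa using P.sum_E

section GlobalFrames

open Bundle Set Filter Topology

variable (s : ℕ) {M : Type*} [TopologicalSpace M] [ChartedSpace (EuclideanSpace ℝ (Fin s)) M]
  (F : Type*) [NormedAddCommGroup F] [NormedSpace ℝ F] [FiniteDimensional ℝ F]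
  (V : M → Type*) [∀ x, AddCommGroup (V x)] [∀ x, Module ℝ (V x)]
  [TopologicalSpace (TotalSpace F V)] [∀ x, TopologicalSpace (V x)] [FiberBundle F V]
  [VectorBundle ℝ F V]

/-- The degrees of the sections of `⋀ V*` range from `0` to the rank of `V`. -/
theorem aeval_sectionDegreeOp :
    Polynomial.aeval (sectionDegreeOp s F V) (∏ k ∈ Finset.range (Module.finrank ℝ F + 1),
      (Polynomial.X - Polynomial.C (k : ℝ))) = 0 := by
  refine LinearMap.ext fun a => Subtype.ext (funext fun x => ?_)
  have e := (trivializationAt F V x).linearEquivAt ℝ x (mem_baseSet_trivializationAt F V x)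
  have : FiniteDimensional ℝ (V x) := e.symm.finiteDimensional
  have h := apply_aeval_of_comm (evalSection x) (f := sectionDegreeOp s F V)
    (g := degreeOp (Module.Dual ℝ (V x))) (fun _ => rfl)
    (∏ k ∈ Finset.range (Module.finrank ℝ F + 1), (Polynomial.X - Polynomial.C (k : ℝ))) a
  rw [aeval_degreeOp_eq_zero (by rw [Subspace.dual_finrank_eq, e.finrank_eq])] at h
  exact h

variable [IsManifold (𝓡 s) ∞ M] [T2Space M] [SecondCountableTopology M]

/-- Finitely many patches suffice to decompose `1` into their weights, although `M` need not be
compact. -/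
theorem exists_framePatches : ∃ P : Fin (s + 1) → FramePatch s F V, ∀ x, ∑ c, (P c).χ x = 1 := by
  have : LocallyCompactSpace M := ChartedSpace.locallyCompactSpace (EuclideanSpace ℝ (Fin s)) M
  obtain ⟨W, j, hW, hj, hcover⟩ := exists_finite_colouring (s := s)
    (O := fun x : M =>
      (chartAt (EuclideanSpace ℝ (Fin s)) x).source ∩ (trivializationAt F V x).baseSet)
    fun x => inter_mem ((chartAt (EuclideanSpace ℝ (Fin s)) x).open_source.mem_nhds
      (mem_chart_source _ x)) ((trivializationAt F V x).open_baseSet.mem_nhds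
      (FiberBundle.mem_baseSet_trivializationAt F V x))
  obtain ⟨ρ, hρ⟩ := SmoothPartitionOfUnity.exists_isSubordinate (𝓡 s) (isClosed_univ (X := M)) W hW
    hcover.ge
  choose θ hθ hθ0 hθ1 using fun c => exists_cutoff s (hW c) (isClosed_tsupport (ρ c)) (hρ c)
  refine ⟨fun c => show FramePatch s F V from
    { W := W c
      j := j c
      mem_chart := fun x hx => (hj c x hx).1.1
      mem_base := fun x hx => (hj c x hx).1.2
      j_eventually := fun x hx => (hj c x hx).2
      χ := ρ c
      θ := θ c
      contMDiff_χ := (ρ c).contMDiff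
      contMDiff_θ := hθ c
      χ_zero := ?_
      θ_zero := hθ0 c
      θ_one := fun x hx => eventually_nhdsSet_iff_forall.1 (hθ1 c) x (subset_tsupport _ hx) },
    fun x => ?_⟩
  · filter_upwards [(isClosed_tsupport (ρ c)).isOpen_compl.mem_nhdsSet.2
      (compl_subset_compl.2 (hρ c))] with x hx
    exact image_eq_zero_of_notMem_tsupport hx
  · have h := ρ.sum_eq_one (mem_univ x)
    rwa [finsum_eq_sum_of_fintype] at h

variable [ContMDiffVectorBundle ∞ F V (𝓡 s)]

/-- The coordinates of `s + 1` patches together form an Euler frame. The traces are `s` and `r`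
because the weights of the patches add up to `1`. -/
theorem exists_eulerFrame_sections : Nonempty (EulerFrame (sectionParity s F V)
    (sectionDegreeOp s F V) (Fin (s + 1) × Fin s)
    (Fin (s + 1) × Fin (Module.finrank ℝ (Module.Dual ℝ F))) s (Module.finrank ℝ F)) := by
  obtain ⟨P, hP⟩ := exists_framePatches s F V
  have hsum : ∑ c, scalarSection (F := F) (V := V) (P c).χ (P c).contMDiff_χ = 1 := by
    refine Subtype.ext (funext fun x => ?_)
    change evalSection x (∑ c, scalarSection (F := F) (V := V) (P c).χ (P c).contMDiff_χ) =
      evalSection x (1 : exteriorSections s F V)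
    rw [map_sum, evalSection_one]
    simp only [evalSection_scalarSection]
    rw [← map_sum, hP, map_one]
  have hdouble : ∀ n : ℕ, ∑ c, ∑ _ : Fin n,
      scalarSection (F := F) (V := V) (P c).χ (P c).contMDiff_χ = (n : ℝ) • 1 := fun n => by
    rw [Finset.sum_comm, Finset.sum_congr rfl fun _ _ => hsum, Finset.sum_const, Finset.card_univ,
      Fintype.card_fin, Nat.cast_smul_eq_nsmul]
  exact ⟨{
    y := fun l => (P l.1).evenCoord l.2
    η := fun k => (P k.1).oddCoord k.2
    D := fun l => (P l.1).evenDer l.2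
    E := fun k => (P k.1).oddDer k.2
    mul_comm' := sectionParity_mul_comm
    e_mem := ⟨fun j a ha x => by
        rw [zero_add]
        exact degreeOp_mem_extParity (ha x), fun j a _ b => by
        rw [superSign_zero_left, one_smul]
        exact Subtype.ext (funext fun x => degreeOp_mul _ _)⟩
    aeval_e := aeval_sectionDegreeOp s F V
    mem_of_e_eq := fun h x => mem_extParity_of_degreeOp_eq (congrArg (evalSection x) h)
    eq_zero_of_mul_self := fun h1 h2 => Subtype.ext (funext fun x =>
      eq_zero_of_degreeOp_eq_zero_of_mul_self (congrArg (evalSection x) h1)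
        (congrArg (evalSection x) h2))
    y_mem := fun l => (P l.1).evenCoord_mem l.2
    η_mem := fun k => (P k.1).oddCoord_mem k.2
    e_y := fun l => (P l.1).degreeOp_evenCoord l.2
    e_η := fun k => (P k.1).degreeOp_oddCoord k.2
    D_mem := fun l => (P l.1).evenDer_mem l.2
    E_mem := fun k => (P k.1).oddDer_mem k.2
    e_D := fun l => (P l.1).degreeOp_evenDer l.2
    e_E := fun k => (P k.1).degreeOp_oddDer k.2
    expansion := fun {i X} hX a => by
      rw [Fintype.sum_prod_type, Fintype.sum_prod_type, ← Finset.sum_add_distrib,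
        ← one_mul (X a), ← hsum, Finset.sum_mul]
      exact Finset.sum_congr rfl fun c _ => (P c).expansion hX a
    sum_D := by
      simp only [Fintype.sum_prod_type, FramePatch.evenDer_evenCoord, if_true]
      exact hdouble s
    sum_E := by
      simp only [Fintype.sum_prod_type, FramePatch.oddDer_oddCoord, if_true]
      rw [← Subspace.dual_finrank_eq (K := ℝ) (V := F)]
      exact hdouble _ }⟩

variable {s F V}

theorem Splitting.exists_eulerFrame {A : Type*} [Ring A] [Algebra ℝ A]
    {𝒜 : ZMod 2 → Submodule ℝ A} (φ : Splitting s F V 𝒜) :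
    Nonempty (EulerFrame 𝒜 (φ.eulerField : Module.End ℝ A) (Fin (s + 1) × Fin s)
      (Fin (s + 1) × Fin (Module.finrank ℝ (Module.Dual ℝ F))) s (Module.finrank ℝ F)) :=
  (exists_eulerFrame_sections s F V).map (EulerFrame.transport φ.iso φ.mem_parity_iff)

end GlobalFrames

/-! ### Functions and superderivations of homogeneous degree -/

section HomogeneousParts

variable {A : Type*} [Ring A] [Algebra ℝ A]

/-- The elements `a` of degree `k` with respect to an Euler operator: `e a = k a`. -/
def eulerFn (e : Module.End ℝ A) (k : ℤ) : Submodule ℝ A where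
  carrier := {a | e a = (k : ℝ) • a}
  zero_mem' := by simp
  add_mem' {a b} ha hb := by
    simp only [Set.mem_ofPred_eq] at ha hb ⊢
    rw [map_add, ha, hb, smul_add]
  smul_mem' c a ha := by
    simp only [Set.mem_ofPred_eq] at ha ⊢
    rw [map_smul, ha, smul_comm]

theorem mem_eulerFn {e : Module.End ℝ A} {k : ℤ} {a : A} :
    a ∈ eulerFn e k ↔ e a = (k : ℝ) • a := Iff.rfl

/-- The superderivations of degree `k` with respect to an Euler operator `e`: those of parity `k`
with `e X - X e = k X`. -/
def eulerDer (𝒜 : ZMod 2 → Submodule ℝ A) (e : Module.End ℝ A) (k : ℤ) :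
    Submodule ℝ (Module.End ℝ A) where
  carrier := {X | X ∈ homogeneousDer 𝒜 k ∧ ∀ a, e (X a) = X (e a) + (k : ℝ) • X a}
  zero_mem' := ⟨zero_mem _, by simp⟩
  add_mem' {X Y} hX hY := ⟨add_mem hX.1 hY.1, fun a => by
    rw [LinearMap.add_apply, map_add, hX.2, hY.2, LinearMap.add_apply, smul_add]
    abel⟩
  smul_mem' c X hX := ⟨Submodule.smul_mem _ c hX.1, fun a => by
    rw [LinearMap.smul_apply, map_smul, hX.2, LinearMap.smul_apply, smul_add,
      smul_comm c (k : ℝ)]⟩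

variable {𝒜 : ZMod 2 → Submodule ℝ A} {e : Module.End ℝ A}

theorem apply_mem_eulerFn {j k l : ℤ} {X : Module.End ℝ A} (hX : X ∈ eulerDer 𝒜 e j) {a : A}
    (ha : a ∈ eulerFn e k) (h : l = j + k := by omega) : X a ∈ eulerFn e l := by
  subst h
  rw [mem_eulerFn, hX.2, mem_eulerFn.1 ha, map_smul, ← add_smul]
  push_cast
  rw [add_comm]

theorem homogeneousDer_mul_of_even {i : ZMod 2} {X : Module.End ℝ A} (hX : X ∈ homogeneousDer 𝒜 i)
    {a : A} (ha : a ∈ 𝒜 0) (b : A) : X (a * b) = X a * b + a * X b := by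
  rw [hX.2 0 a ha, superSign_zero_right, one_smul]

theorem homogeneousDer_zero_mul {X : Module.End ℝ A} (hX : X ∈ homogeneousDer 𝒜 0)
    {i : ZMod 2} {a : A} (ha : a ∈ 𝒜 i) (b : A) : X (a * b) = X a * b + a * X b := by
  rw [hX.2 i a ha, superSign_zero_left, one_smul]

theorem homogeneousDer_mul_of_odd {X : Module.End ℝ A} (hX : X ∈ homogeneousDer 𝒜 1)
    {a : A} (ha : a ∈ 𝒜 1) (b : A) : X (a * b) = X a * b - a * X b := by
  rw [hX.2 1 a ha, superSign_one_one, neg_one_smul, sub_eq_add_neg]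

end HomogeneousParts

namespace EulerFrame

variable {A : Type*} [Ring A] [Algebra ℝ A] {𝒜 : ZMod 2 → Submodule ℝ A} [GradedAlgebra 𝒜]
  {e : Module.End ℝ A} {ι κ : Type} [Fintype ι] [Fintype κ] {s r : ℕ}
  (P : EulerFrame 𝒜 e ι κ s r)

include P in
theorem eulerFn_le {k : ℤ} {a : A} (ha : a ∈ eulerFn e k) : a ∈ 𝒜 k := P.mem_of_e_eq ha

include P in
theorem mem_even_of_zero {a : A} (ha : a ∈ eulerFn e 0) : a ∈ 𝒜 0 := by
  simpa using P.eulerFn_le ha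

include P in
theorem mem_even_of_two {a : A} (ha : a ∈ eulerFn e 2) : a ∈ 𝒜 0 := P.eulerFn_le ha

include P in
theorem mem_odd_of_one {a : A} (ha : a ∈ eulerFn e 1) : a ∈ 𝒜 1 := by
  simpa using P.eulerFn_le ha

include P in
theorem comm_of_even {a : A} (ha : a ∈ 𝒜 0) (b : A) : a * b = b * a := by
  induction b using DirectSum.Decomposition.inductionOn 𝒜 with
  | zero => simp
  | homogeneous b => rw [P.mul_comm' ha b.2, superSign_zero_left, one_smul]
  | add b c hb hc => rw [mul_add, add_mul, hb, hc]

include P in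
theorem anticomm_of_odd {a b : A} (ha : a ∈ 𝒜 1) (hb : b ∈ 𝒜 1) : a * b = -(b * a) := by
  rw [P.mul_comm' ha hb, superSign_one_one, neg_one_smul]

include P in
theorem mul_mem_eulerFn {j k l : ℤ} {a b : A} (ha : a ∈ eulerFn e j) (hb : b ∈ eulerFn e k)
    (h : l = j + k := by omega) : a * b ∈ eulerFn e l := by
  subst h
  rw [mem_eulerFn, homogeneousDer_zero_mul P.e_mem (P.eulerFn_le ha), mem_eulerFn.1 ha,
    mem_eulerFn.1 hb, smul_mul_assoc, mul_smul_comm, ← add_smul]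
  push_cast
  rfl

include P in
theorem smul_mem_eulerDer {j k l : ℤ} {a : A} (ha : a ∈ eulerFn e j) {X : Module.End ℝ A}
    (hX : X ∈ eulerDer 𝒜 e k) (h : l = j + k := by omega) : a • X ∈ eulerDer 𝒜 e l := by
  subst h
  refine ⟨?_, fun b => ?_⟩
  · rw [Int.cast_add]
    exact smul_mem_homogeneousDer (fun ha hb => SetLike.mul_mem_graded ha hb) P.mul_comm'
      (P.eulerFn_le ha) hX.1
  · simp only [LinearMap.smul_apply, smul_eq_mul]
    rw [homogeneousDer_zero_mul P.e_mem (P.eulerFn_le ha), mem_eulerFn.1 ha, hX.2, mul_add,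
      smul_mul_assoc, mul_smul_comm, Int.cast_add, add_smul]
    abel

theorem y_mem_eulerFn (l : ι) : P.y l ∈ eulerFn e 0 := by
  rw [mem_eulerFn, P.e_y]; simp

theorem η_mem_eulerFn (k : κ) : P.η k ∈ eulerFn e 1 := by
  rw [mem_eulerFn, P.e_η]; simp

theorem D_mem_eulerDer (l : ι) : P.D l ∈ eulerDer 𝒜 e 0 :=
  ⟨by simpa using P.D_mem l, fun a => by simp [P.e_D]⟩

theorem E_mem_eulerDer (k : κ) : P.E k ∈ eulerDer 𝒜 e (-1) :=
  ⟨by simpa using P.E_mem k, fun a => by simp [P.e_E, sub_eq_add_neg]⟩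

include P in
theorem e_mem_eulerDer : e ∈ eulerDer 𝒜 e 0 := ⟨by simpa using P.e_mem, fun a => by simp⟩

include P in
theorem one_mem_eulerFn : (1 : A) ∈ eulerFn e 0 := by
  have h := homogeneousDer_mul_of_even P.e_mem (SetLike.one_mem_graded 𝒜) 1
  rw [mem_eulerFn]
  simpa using h

include P in
theorem pow_mem_eulerFn {a : A} (ha : a ∈ eulerFn e 0) (n : ℕ) : a ^ n ∈ eulerFn e 0 := by
  induction n with
  | zero => simpa using P.one_mem_eulerFn
  | succ n ih => rw [pow_succ]; exact P.mul_mem_eulerFn ih ha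

include P in
/-- The functions of degree `0` form a reduced ring. -/
theorem eq_zero_of_pow_eq_zero {a : A} (ha : a ∈ eulerFn e 0) {n : ℕ} (h : a ^ n = 0) : a = 0 := by
  have h2 : ∀ m : ℕ, a ^ 2 ^ m = 0 → a = 0 := by
    intro m
    induction m with
    | zero => simp
    | succ m ih =>
      intro h
      refine ih (P.eq_zero_of_mul_self ?_ ?_)
      · simpa using mem_eulerFn.1 (P.pow_mem_eulerFn ha (2 ^ m))
      · rw [← pow_add, ← two_mul, ← pow_succ', h]
  exact h2 n (pow_eq_zero_of_le Nat.lt_two_pow_self.le h)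

/-- The commutator `X Y - Y X` is the superbracket, as `X` is even. -/
theorem commutator_mem_eulerDer {j k l : ℤ} (hj : (j : ZMod 2) = 0) {X Y : Module.End ℝ A}
    (hX : X ∈ eulerDer 𝒜 e j) (hY : Y ∈ eulerDer 𝒜 e k) (h : l = j + k := by omega) :
    X * Y - Y * X ∈ eulerDer 𝒜 e l := by
  subst h
  refine ⟨?_, fun a => ?_⟩
  · have h := superComm_mem hX.1 hY.1
    rwa [superComm_apply hX.1 hY.1, hj, superSign_zero_left, one_smul, zero_add,
      ← zero_add (k : ZMod 2), ← hj, ← Int.cast_add] at h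
  · simp only [LinearMap.sub_apply, Module.End.mul_apply, map_sub, hX.2, hY.2, map_add, map_smul,
      Int.cast_add, add_smul, smul_sub]
    abel

open Polynomial in
include P in
theorem eulerFn_eq_zero {k : ℤ} (hk : k < 0 ∨ (r : ℤ) < k) {a : A} (ha : a ∈ eulerFn e k) :
    a = 0 := by
  by_contra h0
  have h := Module.End.aeval_apply_of_hasEigenvector (f := e) (μ := (k : ℝ))
    (p := ∏ k ∈ Finset.range (r + 1), (X - C (k : ℝ)))
    ⟨Module.End.mem_eigenspace_iff.2 ha, h0⟩
  rw [P.aeval_e, LinearMap.zero_apply, eval_prod] at h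
  refine smul_ne_zero (Finset.prod_ne_zero_iff.2 fun l hl => ?_) h0 h.symm
  rw [eval_sub, eval_X, eval_C, sub_ne_zero]
  have := Finset.mem_range.1 hl
  intro h
  have : k = (l : ℤ) := by exact_mod_cast h
  omega

open Polynomial in
/-- If a product of distinct linear factors in an operator kills a vector, then the vector is a sum
of eigenvectors. -/
theorem mem_iSup_eulerFn {S : Finset ℕ} {a : A}
    (h : aeval e (∏ k ∈ S, (X - C (k : ℝ))) a = 0) : a ∈ ⨆ k : ℤ, eulerFn e k := by
  classical
  induction S using Finset.induction_on generalizing a with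
  | empty =>
    rw [Finset.prod_empty, map_one, Module.End.one_apply] at h
    rw [h]
    exact zero_mem _
  | insert l S hl ih =>
    have hc : IsCoprime (X - C (l : ℝ)) (∏ k ∈ S, (X - C (k : ℝ))) :=
      IsCoprime.prod_right fun k hk => isCoprime_X_sub_C_of_isUnit_sub (IsUnit.mk0 _ (by
        rw [sub_ne_zero]
        exact fun h => hl (by rwa [Nat.cast_injective h])))
    rw [Finset.prod_insert hl, ← LinearMap.mem_ker,
      ← sup_ker_aeval_eq_ker_aeval_mul_of_coprime e hc] at h
    obtain ⟨b, hb, c, hcc, rfl⟩ := Submodule.mem_sup.1 h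
    refine add_mem ?_ (ih hcc)
    refine Submodule.mem_iSup_of_mem (l : ℤ) ?_
    rw [LinearMap.mem_ker, map_sub, aeval_X, aeval_C, LinearMap.sub_apply, sub_eq_zero] at hb
    rw [mem_eulerFn, hb, Module.algebraMap_end_apply, Int.cast_natCast]

include P in
theorem iSup_eulerFn : ⨆ k : ℤ, eulerFn e k = ⊤ :=
  eq_top_iff.2 fun a _ => mem_iSup_eulerFn (by rw [P.aeval_e, LinearMap.zero_apply])

theorem eulerDer_expansion {i : ZMod 2} {X : Module.End ℝ A} (hX : X ∈ homogeneousDer 𝒜 i) :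
    X = ∑ l, X (P.y l) • P.D l + ∑ k, X (P.η k) • P.E k :=
  LinearMap.ext fun a => by
    rw [P.expansion hX]
    simp [LinearMap.sum_apply]

include P in
theorem eulerDer_eq_zero {k : ℤ} (hk : k < -1 ∨ (r : ℤ) < k) {X : Module.End ℝ A}
    (hX : X ∈ eulerDer 𝒜 e k) : X = 0 := by
  rw [P.eulerDer_expansion hX.1, Finset.sum_eq_zero, Finset.sum_eq_zero, add_zero]
  · intro l _
    rw [P.eulerFn_eq_zero (k := k + 1) (by omega) (apply_mem_eulerFn hX (P.η_mem_eulerFn l)),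
      zero_smul]
  · intro l _
    rw [P.eulerFn_eq_zero (k := k) (by omega) (apply_mem_eulerFn hX (P.y_mem_eulerFn l)),
      zero_smul]

/-- The vector fields of degree `k` are generated over the functions by the coordinate vector
fields. -/
theorem eulerDer_le {k : ℤ} {B : Submodule ℝ (Module.End ℝ A)}
    (hD : ∀ l, ∀ a ∈ eulerFn e k, a • P.D l ∈ B)
    (hE : ∀ l, ∀ a ∈ eulerFn e (k + 1), a • P.E l ∈ B) : eulerDer 𝒜 e k ≤ B := by
  intro X hX
  rw [P.eulerDer_expansion hX.1]
  exact add_mem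
    (Submodule.sum_mem _ fun l _ => hD l _ (apply_mem_eulerFn hX (P.y_mem_eulerFn l)))
    (Submodule.sum_mem _ fun l _ => hE l _ (apply_mem_eulerFn hX (P.η_mem_eulerFn l)))

include P in
theorem smul_mem_iSup_eulerDer (a : A) {k : ℤ} {X : Module.End ℝ A} (hX : X ∈ eulerDer 𝒜 e k) :
    a • X ∈ ⨆ k : ℤ, eulerDer 𝒜 e k := by
  have ha : a ∈ ⨆ k : ℤ, eulerFn e k := by rw [P.iSup_eulerFn]; trivial
  induction ha using Submodule.iSup_induction' with
  | mem j a ha => exact Submodule.mem_iSup_of_mem (j + k) (P.smul_mem_eulerDer ha hX)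
  | zero => rw [zero_smul]; exact zero_mem _
  | add a b _ _ ha hb => rw [add_smul]; exact add_mem ha hb

include P in
theorem superDer_le_iSup_eulerDer : superDer 𝒜 ≤ ⨆ k : ℤ, eulerDer 𝒜 e k := by
  have h : ∀ i, homogeneousDer 𝒜 i ≤ ⨆ k : ℤ, eulerDer 𝒜 e k := fun i X hX => by
    rw [P.eulerDer_expansion hX]
    exact add_mem
      (Submodule.sum_mem _ fun l _ => P.smul_mem_iSup_eulerDer _ (P.D_mem_eulerDer l))
      (Submodule.sum_mem _ fun l _ => P.smul_mem_iSup_eulerDer _ (P.E_mem_eulerDer l))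
  exact sup_le (h 0) (h 1)

end EulerFrame

/-! ### Brackets with vector fields of degree two -/

/-- The span of the commutators of superderivations of degree `2` and `q`. As the former are even,
these are the superbrackets. -/
def commutatorSpan {A : Type*} [Ring A] [Algebra ℝ A] (𝒜 : ZMod 2 → Submodule ℝ A)
    (e : Module.End ℝ A) (q : ℤ) : Submodule ℝ (Module.End ℝ A) :=
  Submodule.span ℝ {Z | ∃ X ∈ eulerDer 𝒜 e 2, ∃ Y ∈ eulerDer 𝒜 e q, X * Y - Y * X = Z}

/-- The map `a ↦ a X` for a fixed endomorphism `X`, linear in the function `a`. -/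
def smulEnd {A : Type*} [Ring A] [Algebra ℝ A] (X : Module.End ℝ A) : A →ₗ[ℝ] Module.End ℝ A where
  toFun a := a • X
  map_add' a b := add_smul a b X
  map_smul' c a := smul_assoc c a X

theorem sub_smul_end {A : Type*} [Ring A] [Algebra ℝ A] (a b : A) (X : Module.End ℝ A) :
    (a - b) • X = a • X - b • X := map_sub (smulEnd X) a b

theorem neg_smul_end {A : Type*} [Ring A] [Algebra ℝ A] (a : A) (X : Module.End ℝ A) :
    (-a) • X = -(a • X) := map_neg (smulEnd X) a

theorem commutator_mem_commutatorSpan {A : Type*} [Ring A] [Algebra ℝ A]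
    {𝒜 : ZMod 2 → Submodule ℝ A} {e : Module.End ℝ A} {q : ℤ} {X Y : Module.End ℝ A}
    (hX : X ∈ eulerDer 𝒜 e 2) (hY : Y ∈ eulerDer 𝒜 e q) :
    X * Y - Y * X ∈ commutatorSpan 𝒜 e q := Submodule.subset_span ⟨X, hX, Y, hY, rfl⟩

section Parity

variable {A : Type*} [Ring A] [Algebra ℝ A] {𝒜 : ZMod 2 → Submodule ℝ A} {e : Module.End ℝ A}

theorem odd_of_mem_eulerDer_neg_one {X : Module.End ℝ A} (hX : X ∈ eulerDer 𝒜 e (-1)) :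
    X ∈ homogeneousDer 𝒜 1 := hX.1

theorem even_of_mem_eulerDer_zero {X : Module.End ℝ A} (hX : X ∈ eulerDer 𝒜 e 0) :
    X ∈ homogeneousDer 𝒜 0 := by simpa using hX.1

theorem apply_e_of_neg_one {X : Module.End ℝ A} (hX : X ∈ eulerDer 𝒜 e (-1)) (a : A) :
    e (X a) = X (e a) - X a := by
  rw [hX.2]
  simp [sub_eq_add_neg]

end Parity

namespace EulerFrame

variable {A : Type*} [Ring A] [Algebra ℝ A] {𝒜 : ZMod 2 → Submodule ℝ A} [GradedAlgebra 𝒜]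
  {e : Module.End ℝ A} {ι κ : Type} [Fintype ι] [Fintype κ] {s r : ℕ}
  (P : EulerFrame 𝒜 e ι κ s r)

include P

/-- The Euler operator is `∑ η E`. -/
theorem sum_η_mul_E (a : A) : ∑ k, P.η k * P.E k a = e a := by
  rw [P.expansion P.e_mem a]
  simp [P.e_y, P.e_η]

/-- The contraction of the odd coordinates against the odd vector fields multiplies a function of
degree `d` by `r - d`. -/
theorem sum_E_η_mul (a : A) : ∑ k, P.E k (P.η k * a) = (r : ℝ) • a - e a := by
  simp only [fun k => homogeneousDer_mul_of_odd (P.E_mem k) (P.η_mem k) a]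
  rw [Finset.sum_sub_distrib, ← Finset.sum_mul, P.sum_E, P.sum_η_mul_E, smul_mul_assoc, one_mul]

/-- The functions of degree `k + 1` are sums of products of functions of degree `1` and `k`. -/
theorem eulerFn_succ_le {k l : ℤ} (hk : 0 ≤ k) {B : Submodule ℝ A}
    (h : ∀ a ∈ eulerFn e 1, ∀ b ∈ eulerFn e k, a * b ∈ B) (hl : l = k + 1 := by omega) :
    eulerFn e l ≤ B := by
  subst hl
  intro u hu
  have h1 : ((k + 1 : ℤ) : ℝ) ≠ 0 := by
    have : (k + 1 : ℤ) ≠ 0 := by omega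
    exact_mod_cast this
  have h2 : u = ((k + 1 : ℤ) : ℝ)⁻¹ • ∑ j, P.η j * P.E j u := by
    rw [P.sum_η_mul_E, mem_eulerFn.1 hu, smul_smul, inv_mul_cancel₀ h1, one_smul]
  rw [h2]
  exact Submodule.smul_mem _ _ (Submodule.sum_mem _ fun j _ =>
    h _ (P.η_mem_eulerFn j) _ (apply_mem_eulerFn (P.E_mem_eulerDer j) hu))

theorem eulerFn_add_two_le {k l : ℤ} (hk : 0 ≤ k) {B : Submodule ℝ A}
    (h : ∀ a ∈ eulerFn e 2, ∀ b ∈ eulerFn e k, a * b ∈ B) (hl : l = k + 2 := by omega) :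
    eulerFn e l ≤ B := by
  refine P.eulerFn_succ_le (k := k + 1) (by omega) fun a ha b hb => ?_
  refine P.eulerFn_succ_le (k := k) hk (B := B.comap (LinearMap.mulLeft ℝ a)) (fun c hc d hd => ?_)
    rfl hb
  rw [Submodule.mem_comap, LinearMap.mulLeft_apply, ← mul_assoc]
  exact h _ (P.mul_mem_eulerFn ha hc) _ hd

/-- Superderivations of degree `-1` anticommute, as there are none of degree `-2`. -/
theorem anticomm_of_neg_one {X Y : Module.End ℝ A} (hX : X ∈ eulerDer 𝒜 e (-1))
    (hY : Y ∈ eulerDer 𝒜 e (-1)) (a : A) : X (Y a) = -Y (X a) := by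
  have h : X * Y + Y * X ∈ eulerDer 𝒜 e (-2) := by
    refine ⟨?_, fun a => ?_⟩
    · have h := superComm_mem (odd_of_mem_eulerDer_neg_one hX) (odd_of_mem_eulerDer_neg_one hY)
      have h2 : X * Y + Y * X = X * Y - superSign 1 1 • (Y * X) :=
        LinearMap.ext fun a => by simp
      rwa [superComm_apply (odd_of_mem_eulerDer_neg_one hX) (odd_of_mem_eulerDer_neg_one hY),
        ← h2] at h
    · simp only [LinearMap.add_apply, Module.End.mul_apply, map_add, hX.2, hY.2, map_smul,
        Int.cast_neg, Int.cast_one, Int.cast_ofNat]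
      module
  have h2 := LinearMap.congr_fun (P.eulerDer_eq_zero (by omega) h) a
  exact eq_neg_of_add_eq_zero_left h2

theorem apply_eq_zero_of_neg_one {X : Module.End ℝ A} (hX : X ∈ eulerDer 𝒜 e (-1)) {a : A}
    (ha : a ∈ eulerFn e 0) : X a = 0 :=
  P.eulerFn_eq_zero (k := -1) (by omega) (apply_mem_eulerFn hX ha)

variable {q : ℤ}

/-- The bracket `[w e, v e] = (q - 2) w v e`. -/
theorem mul_smul_e_mem {w v : A} (hw : w ∈ eulerFn e 2) (hv : v ∈ eulerFn e q) (hq : q ≠ 2) :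
    (w * v) • e ∈ commutatorSpan 𝒜 e q := by
  have h := commutator_mem_commutatorSpan (P.smul_mem_eulerDer hw P.e_mem_eulerDer)
    (P.smul_mem_eulerDer hv P.e_mem_eulerDer (l := q))
  have h2 : (w • e) * (v • e) - (v • e) * (w • e) = ((q : ℝ) - 2) • ((w * v) • e) := by
    refine LinearMap.ext fun a => ?_
    simp only [LinearMap.sub_apply, Module.End.mul_apply, LinearMap.smul_apply, smul_eq_mul,
      homogeneousDer_zero_mul P.e_mem (P.eulerFn_le hw),
      homogeneousDer_zero_mul P.e_mem (P.eulerFn_le hv), mem_eulerFn.1 hw, mem_eulerFn.1 hv,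
      mul_add, mul_smul_comm, smul_mul_assoc, ← mul_assoc, P.comm_of_even (P.mem_even_of_two hw) v,
      Int.cast_ofNat]
    module
  rw [h2] at h
  have h3 : (q : ℝ) - 2 ≠ 0 := by
    rw [sub_ne_zero]
    exact_mod_cast hq
  exact (Submodule.smul_mem_iff _ h3).1 h

/-- The bracket `[w e, v D] = q w v D - v D(w) e`. -/
theorem smul_sub_smul_e_mem {w v : A} (hw : w ∈ eulerFn e 2) (hv : v ∈ eulerFn e (q + 1))
    {D : Module.End ℝ A} (hD : D ∈ eulerDer 𝒜 e (-1)) :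
    (q : ℝ) • ((w * v) • D) - (v * D w) • e ∈ commutatorSpan 𝒜 e q := by
  have h := commutator_mem_commutatorSpan (P.smul_mem_eulerDer hw P.e_mem_eulerDer)
    (P.smul_mem_eulerDer hv hD (l := q))
  have h2 : (w • e) * (v • D) - (v • D) * (w • e) =
      (q : ℝ) • ((w * v) • D) - (v * D w) • e := by
    refine LinearMap.ext fun a => ?_
    simp only [LinearMap.sub_apply, Module.End.mul_apply, LinearMap.smul_apply, smul_eq_mul,
      homogeneousDer_mul_of_even hD.1 (P.mem_even_of_two hw), apply_e_of_neg_one hD,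
      homogeneousDer_zero_mul P.e_mem (P.eulerFn_le hv), mem_eulerFn.1 hv,
      mul_add, mul_sub, mul_smul_comm, smul_mul_assoc, ← mul_assoc,
      P.comm_of_even (P.mem_even_of_two hw) v, Int.cast_add, Int.cast_one]
    module
  rwa [h2] at h

/-- The bracket `[w D, v D'] = w D(v) D' - v D'(w) D`. -/
theorem smul_sub_smul_mem {w v : A} (hw : w ∈ eulerFn e 3) (hv : v ∈ eulerFn e (q + 1))
    {D D' : Module.End ℝ A} (hD : D ∈ eulerDer 𝒜 e (-1)) (hD' : D' ∈ eulerDer 𝒜 e (-1)) :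
    (w * D v) • D' - (v * D' w) • D ∈ commutatorSpan 𝒜 e q := by
  have h := commutator_mem_commutatorSpan (P.smul_mem_eulerDer hw hD)
    (P.smul_mem_eulerDer hv hD' (l := q))
  have hw1 : w ∈ 𝒜 1 := P.eulerFn_le hw
  have h2 : (w • D) * (v • D') - (v • D') * (w • D) = (w * D v) • D' - (v * D' w) • D := by
    refine LinearMap.ext fun a => ?_
    simp only [LinearMap.sub_apply, Module.End.mul_apply, LinearMap.smul_apply, smul_eq_mul,
      homogeneousDer_mul_of_odd (odd_of_mem_eulerDer_neg_one hD') hw1,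
      (odd_of_mem_eulerDer_neg_one hD).2 _ v (P.eulerFn_le hv), mul_sub, mul_add, mul_smul_comm,
      ← mul_assoc, P.mul_comm' hw1 (P.eulerFn_le hv), smul_mul_assoc, smul_smul,
      P.anticomm_of_neg_one hD hD' a]
    rcases parity_cases ((q + 1 : ℤ) : ZMod 2) with h | h <;> rw [h] <;> simp <;> abel
  rwa [h2] at h

/-- The contraction of `smul_sub_smul_mem` with the odd coordinates: replacing `w` by `w η` and `D'`
by `E` and summing over all `η` and `E` produces the Euler operator and the factor `r - 2`. -/
theorem smul_e_sub_smul_mem {w v : A} (hw : w ∈ eulerFn e 2) (hv : v ∈ eulerFn e (q + 1))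
    {D : Module.End ℝ A} (hD : D ∈ eulerDer 𝒜 e (-1)) :
    superSign 1 q • ((w * D v) • e) - ((r : ℝ) - 2) • ((w * v) • D) ∈ commutatorSpan 𝒜 e q := by
  have h : ∑ k, ((w * P.η k * D v) • P.E k - (v * P.E k (w * P.η k)) • D) ∈
      commutatorSpan 𝒜 e q := Submodule.sum_mem _ fun k _ =>
    P.smul_sub_smul_mem (P.mul_mem_eulerFn hw (P.η_mem_eulerFn k)) hv hD (P.E_mem_eulerDer k)
  have hDv : D v ∈ 𝒜 q := P.eulerFn_le (apply_mem_eulerFn hD hv (l := q))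
  have h2 : ∑ k, ((w * P.η k * D v) • P.E k - (v * P.E k (w * P.η k)) • D) =
      superSign 1 q • ((w * D v) • e) - ((r : ℝ) - 2) • ((w * v) • D) := by
    refine LinearMap.ext fun a => ?_
    rw [Finset.sum_sub_distrib]
    simp only [LinearMap.sub_apply, LinearMap.sum_apply, LinearMap.smul_apply, smul_eq_mul]
    congr 1
    · simp only [mul_assoc w, fun k => P.mul_comm' (P.η_mem k) hDv, mul_smul_comm, smul_mul_assoc]
      rw [← Finset.smul_sum, ← P.sum_η_mul_E a, Finset.mul_sum]
      simp only [mul_assoc, Finset.mul_sum]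
    · simp only [P.comm_of_even (P.mem_even_of_two hw) (P.η _)]
      rw [← Finset.sum_mul, ← Finset.mul_sum, P.sum_E_η_mul, mem_eulerFn.1 hw, ← sub_smul,
        mul_smul_comm, smul_mul_assoc, P.comm_of_even (P.mem_even_of_two hw) v, Int.cast_ofNat]
  rwa [h2] at h

/-- The difference of brackets `[u X, f Y] - [f u X, Y] = u X(f) Y + Y(f) u X`. -/
theorem smul_add_smul_mem {u f : A} (hu : u ∈ eulerFn e 2) (hf : f ∈ eulerFn e 0)
    {X Y : Module.End ℝ A} (hX : X ∈ eulerDer 𝒜 e 0) (hY : Y ∈ eulerDer 𝒜 e q) :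
    (u * X f) • Y + (Y f * u) • X ∈ commutatorSpan 𝒜 e q := by
  have h := sub_mem (commutator_mem_commutatorSpan (P.smul_mem_eulerDer hu hX)
    (P.smul_mem_eulerDer hf hY (l := q)))
    (commutator_mem_commutatorSpan (P.smul_mem_eulerDer (P.mul_mem_eulerFn hf hu (l := 2)) hX) hY)
  have hu0 := P.mem_even_of_two hu
  have hf0 := P.mem_even_of_zero hf
  have h2 : (u • X) * (f • Y) - (f • Y) * (u • X) - (((f * u) • X) * Y - Y * ((f * u) • X)) =
      (u * X f) • Y + (Y f * u) • X := by
    refine LinearMap.ext fun a => ?_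
    simp only [LinearMap.sub_apply, Module.End.mul_apply, LinearMap.smul_apply, smul_eq_mul,
      LinearMap.add_apply, homogeneousDer_mul_of_even hX.1 hf0,
      homogeneousDer_mul_of_even hY.1 hf0, homogeneousDer_mul_of_even hY.1 hu0, mul_add, mul_assoc]
    rw [← mul_assoc u f, ← P.comm_of_even hf0 u, mul_assoc]
    abel
  rwa [h2] at h

end EulerFrame

namespace EulerFrame

variable {A : Type*} [Ring A] [Algebra ℝ A] {𝒜 : ZMod 2 → Submodule ℝ A} [GradedAlgebra 𝒜]
  {e : Module.End ℝ A} {ι κ : Type} [Fintype ι] [Fintype κ] {s r : ℕ}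
  (P : EulerFrame 𝒜 e ι κ s r)

include P

/-- In degree `2` the coefficient in `mul_smul_e_mem` vanishes, and `(w v D(c)) e` is compared with
`(w v c) D` instead. -/
theorem smul_e_sub_smul_mem_two {w v c : A} (hw : w ∈ eulerFn e 2) (hv : v ∈ eulerFn e 2)
    (hc : c ∈ eulerFn e 1) {D : Module.End ℝ A} (hD : D ∈ eulerDer 𝒜 e (-1)) :
    (w * v * D c) • e - (r : ℝ) • ((w * v * c) • D) ∈ commutatorSpan 𝒜 e 2 := by
  have h1 := P.smul_e_sub_smul_mem hv (P.mul_mem_eulerFn hw hc (l := 2 + 1)) hD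
  have h2 := P.smul_sub_smul_e_mem hw (P.mul_mem_eulerFn hc hv (l := 2 + 1)) hD
  have hw0 := P.mem_even_of_two hw
  have hv0 := P.mem_even_of_two hv
  have hDw : D w ∈ 𝒜 1 := P.mem_odd_of_one (apply_mem_eulerFn hD hw)
  have h3 : v * D (w * c) = w * v * D c - c * v * D w := by
    rw [homogeneousDer_mul_of_even hD.1 hw0, mul_add, P.anticomm_of_odd hDw (P.mem_odd_of_one hc),
      mul_neg, ← mul_assoc, ← mul_assoc, P.comm_of_even hv0 w, P.comm_of_even hv0 c]
    abel
  have h4 : v * (w * c) = w * v * c := by rw [← mul_assoc, P.comm_of_even hv0 w]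
  have h5 : w * (c * v) = w * v * c := by rw [← P.comm_of_even hv0 c, mul_assoc]
  have h6 : superSign 1 ((2 : ℤ) : ZMod 2) = 1 := superSign_zero_right 1
  rw [h3, h4, h6, one_smul, sub_smul_end] at h1
  rw [h5] at h2
  convert sub_mem h1 h2 using 1
  generalize (w * v * D c) • e = Y₁, (c * v * D w) • e = Y₂, (w * v * c) • D = Z
  push_cast
  module

/-- Let `Z = (a b c v) D`. Modulo commutators, `2 Z` is `(c v D(a b)) e`, which by
`smul_e_sub_smul_mem_two`, applied with `D(a)` and with `D(b)`, is `-2 r Z`. -/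
theorem smul_mem_commutatorSpan_two {a b c v : A} (ha : a ∈ eulerFn e 1) (hb : b ∈ eulerFn e 1)
    (hc : c ∈ eulerFn e 1) (hv : v ∈ eulerFn e 2)
    {D : Module.End ℝ A} (hD : D ∈ eulerDer 𝒜 e (-1)) :
    (a * b * (c * v)) • D ∈ commutatorSpan 𝒜 e 2 := by
  have hv0 := P.mem_even_of_two hv
  have ho : ∀ {a b : A}, a ∈ eulerFn e 1 → b ∈ eulerFn e 1 → a * b = -(b * a) := fun ha hb =>
    P.anticomm_of_odd (P.mem_odd_of_one ha) (P.mem_odd_of_one hb)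
  have hm : ∀ {a b : A}, a ∈ eulerFn e 1 → b ∈ eulerFn e 1 → a * b ∈ eulerFn e 2 :=
    fun ha hb => P.mul_mem_eulerFn ha hb
  have he : ∀ {a b : A}, a ∈ eulerFn e 1 → b ∈ eulerFn e 1 → ∀ z, a * b * z = z * (a * b) :=
    fun ha hb => P.comm_of_even (P.mem_even_of_two (hm ha hb))
  have hd : ∀ {a : A}, a ∈ eulerFn e 1 → ∀ z, D a * z = z * D a := fun ha =>
    P.comm_of_even (P.mem_even_of_zero (apply_mem_eulerFn hD ha))
  have h1 := P.smul_e_sub_smul_mem_two (hm hb hc) hv ha hD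
  have h2 := P.smul_e_sub_smul_mem_two (hm hc ha) hv hb hD
  have h3 := P.smul_sub_smul_e_mem (hm ha hb) (P.mul_mem_eulerFn hc hv (l := 2 + 1)) hD
  have e1 : b * c * v * a = a * b * (c * v) := by
    rw [mul_assoc, P.comm_of_even hv0 a, he hb hc, mul_assoc a v, ← he hb hc v, mul_assoc b,
      ← mul_assoc a b]
  have e2 : c * a * v * b = a * b * (c * v) := by
    rw [mul_assoc, P.comm_of_even hv0 b, ← mul_assoc, mul_assoc c, he ha hb c |>.symm, mul_assoc]
  have e3 : c * v * D (a * b) = -(b * c * v * D a) - c * a * v * D b := by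
    have hD1 := odd_of_mem_eulerDer_neg_one hD
    rw [homogeneousDer_mul_of_odd hD1 (P.mem_odd_of_one ha), mul_sub, hd ha b,
      ← mul_assoc (c * v), mul_assoc c v b, P.comm_of_even hv0 b, ← mul_assoc c b, ho hc hb,
      ← mul_assoc (c * v), mul_assoc c v a, P.comm_of_even hv0 a, ← mul_assoc c a, neg_mul, neg_mul]
  rw [e1] at h1
  rw [e2] at h2
  rw [e3, sub_smul_end, neg_smul_end] at h3
  have h4 := sub_mem (sub_mem h3 h1) h2
  have h5 : (2 + 2 * (r : ℝ)) • ((a * b * (c * v)) • D) ∈ commutatorSpan 𝒜 e 2 := by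
    convert h4 using 1
    generalize (b * c * v * D a) • e = Y₁, (c * a * v * D b) • e = Y₂, (a * b * (c * v)) • D = Z
    push_cast
    module
  exact (Submodule.smul_mem_iff _ (by positivity)).1 h5

variable {q : ℤ}

/-- If `q ≠ 2`, the term with `e` in `smul_e_sub_smul_mem` is a commutator by `mul_smul_e_mem`, and
`r - 2` can be cancelled. -/
theorem smul_mem_commutatorSpan_of_two_lt (hr : 2 < r) (hq : -1 ≤ q) {w v : A}
    (hw : w ∈ eulerFn e 2) (hv : v ∈ eulerFn e (q + 1))
    {D : Module.End ℝ A} (hD : D ∈ eulerDer 𝒜 e (-1)) :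
    (w * v) • D ∈ commutatorSpan 𝒜 e q := by
  by_cases h2 : q = 2
  · subst h2
    refine P.eulerFn_succ_le (k := 1) (by omega)
      (B := (commutatorSpan 𝒜 e 2).comap (smulEnd D ∘ₗ LinearMap.mulRight ℝ v))
      (fun a ha b hb => ?_) (by omega) hw
    refine P.eulerFn_succ_le (k := 2) (by omega)
      (B := (commutatorSpan 𝒜 e 2).comap (smulEnd D ∘ₗ LinearMap.mulLeft ℝ (a * b)))
      (fun c hc v hv => ?_) (by omega) hv
    exact P.smul_mem_commutatorSpan_two ha hb hc hv hD
  · have h1 := P.smul_e_sub_smul_mem hw hv hD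
    have h3 := P.mul_smul_e_mem hw (apply_mem_eulerFn hD hv (l := q)) h2
    have h4 : ((r : ℝ) - 2) • ((w * v) • D) ∈ commutatorSpan 𝒜 e q := by
      convert sub_mem (Submodule.smul_mem _ (superSign 1 q) h3) h1 using 1
      generalize (w * D v) • e = Y, (w * v) • D = Z
      module
    refine (Submodule.smul_mem_iff _ ?_).1 h4
    have : (2 : ℝ) < r := by exact_mod_cast hr
    exact (sub_pos.2 this).ne'

/-- The sum of `smul_add_smul_mem` over all pairs of an even coordinate `y` and its vector field,
with `v D` for `Y`: the functions `D(y)` have degree `-1` and vanish, and the trace is `s`. -/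
theorem smul_mem_commutatorSpan_of_pos (hs : 0 < s) {w v : A}
    (hw : w ∈ eulerFn e 2) (hv : v ∈ eulerFn e (q + 1))
    {D : Module.End ℝ A} (hD : D ∈ eulerDer 𝒜 e (-1)) :
    (w * v) • D ∈ commutatorSpan 𝒜 e q := by
  have h : ∑ l, ((w * P.D l (P.y l)) • (v • D) + ((v • D) (P.y l) * w) • P.D l) ∈
      commutatorSpan 𝒜 e q := Submodule.sum_mem _ fun l _ =>
    P.smul_add_smul_mem hw (P.y_mem_eulerFn l) (P.D_mem_eulerDer l) (P.smul_mem_eulerDer hv hD)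
  have h2 : ∑ l, ((w * P.D l (P.y l)) • (v • D) + ((v • D) (P.y l) * w) • P.D l) =
      (s : ℝ) • ((w * v) • D) := by
    simp only [LinearMap.smul_apply, P.apply_eq_zero_of_neg_one hD (P.y_mem_eulerFn _), smul_zero,
      zero_mul, zero_smul, add_zero]
    rw [← Finset.sum_smul, ← Finset.mul_sum, P.sum_D, smul_smul, mul_smul_comm, mul_one,
      smul_mul_assoc, smul_assoc]
  rw [h2] at h
  exact (Submodule.smul_mem_iff _ (by exact_mod_cast hs.ne')).1 h

theorem smul_mem_commutatorSpan_of_neg_one (hr : 2 < r ∨ (0 < s ∧ 1 < r)) (hq : -1 ≤ q) {u : A}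
    (hu : u ∈ eulerFn e (q + 3)) {D : Module.End ℝ A} (hD : D ∈ eulerDer 𝒜 e (-1)) :
    u • D ∈ commutatorSpan 𝒜 e q := by
  refine P.eulerFn_add_two_le (k := q + 1) (by omega)
    (B := (commutatorSpan 𝒜 e q).comap (smulEnd D)) (fun w hw v hv => ?_) (by omega) hu
  rcases hr with hr | ⟨hs, -⟩
  · exact P.smul_mem_commutatorSpan_of_two_lt hr hq hw hv hD
  · exact P.smul_mem_commutatorSpan_of_pos hs hw hv hD

/-- For `q = -1`, summation of `[(η u) X, E]` over the odd coordinates produces the trace `r - 1`.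
For `q ≥ 0`, summation of `smul_add_smul_mem` over the even coordinates, with `v X` for `Y`,
produces `s + 1`: the trace gives `s`, and the expansion of `X` gives one more. In both cases only
multiples of vector fields of degree `-1` are left. -/
theorem smul_mem_commutatorSpan_of_zero (hr : 2 < r ∨ (0 < s ∧ 1 < r)) (hq : -1 ≤ q) {u : A}
    (hu : u ∈ eulerFn e (q + 2)) {X : Module.End ℝ A} (hX : X ∈ eulerDer 𝒜 e 0) :
    u • X ∈ commutatorSpan 𝒜 e q := by
  have hX0 := even_of_mem_eulerDer_zero hX
  by_cases hq1 : q = -1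
  · subst hq1
    have h : ∑ k, (((P.η k * u) • X) * P.E k - P.E k * ((P.η k * u) • X)) ∈
        commutatorSpan 𝒜 e (-1) := Submodule.sum_mem _ fun k _ =>
      commutator_mem_commutatorSpan (P.smul_mem_eulerDer
        (P.mul_mem_eulerFn (P.η_mem_eulerFn k) hu (l := 2)) hX) (P.E_mem_eulerDer k)
    have h1 : ∑ k, (P.η k * u) • (X * P.E k - P.E k * X) ∈ commutatorSpan 𝒜 e (-1) :=
      Submodule.sum_mem _ fun k _ => P.smul_mem_commutatorSpan_of_neg_one hr (by omega)
        (P.mul_mem_eulerFn (P.η_mem_eulerFn k) hu (l := -1 + 3))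
        (commutator_mem_eulerDer rfl hX (P.E_mem_eulerDer k))
    have h2 : ((r : ℝ) - 1) • (u • X) =
        ∑ k, (P.η k * u) • (X * P.E k - P.E k * X) -
        ∑ k, (((P.η k * u) • X) * P.E k - P.E k * ((P.η k * u) • X)) := by
      refine LinearMap.ext fun a => ?_
      have h3 : ((r : ℝ) - 1) • u = ∑ k, P.E k (P.η k * u) := by
        rw [P.sum_E_η_mul, mem_eulerFn.1 hu, sub_smul]
        norm_num
      rw [← smul_assoc, h3, Finset.sum_smul, ← Finset.sum_sub_distrib, LinearMap.sum_apply,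
        LinearMap.sum_apply]
      refine Finset.sum_congr rfl fun k _ => ?_
      have hku : P.η k * u ∈ 𝒜 0 := P.mem_even_of_two
        (P.mul_mem_eulerFn (P.η_mem_eulerFn k) hu)
      simp only [LinearMap.sub_apply, LinearMap.smul_apply, Module.End.mul_apply, smul_eq_mul,
        homogeneousDer_mul_of_even (P.E_mem k) hku, mul_sub]
      abel
    have h4 := sub_mem h1 h
    rw [← h2] at h4
    refine (Submodule.smul_mem_iff _ ?_).1 h4
    have h5 : 1 < r := by omega
    have : (1 : ℝ) < r := by exact_mod_cast h5
    exact (sub_pos.2 this).ne'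
  · refine P.eulerFn_add_two_le (k := q) (by omega)
      (B := (commutatorSpan 𝒜 e q).comap (smulEnd X)) (fun w hw v hv => ?_) (by omega) hu
    change (w * v) • X ∈ commutatorSpan 𝒜 e q
    have hw0 := P.mem_even_of_two hw
    have h : ∑ l, ((w * P.D l (P.y l)) • (v • X) + ((v • X) (P.y l) * w) • P.D l) ∈
        commutatorSpan 𝒜 e q := Submodule.sum_mem _ fun l _ =>
      P.smul_add_smul_mem hw (P.y_mem_eulerFn l) (P.D_mem_eulerDer l) (P.smul_mem_eulerDer hv hX)
    have h1 : ∑ k, (w * v * X (P.η k)) • P.E k ∈ commutatorSpan 𝒜 e q :=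
      Submodule.sum_mem _ fun k _ => P.smul_mem_commutatorSpan_of_neg_one hr (by omega)
        (P.mul_mem_eulerFn (P.mul_mem_eulerFn hw hv (l := q + 2))
          (apply_mem_eulerFn hX (P.η_mem_eulerFn k) (l := 1))) (P.E_mem_eulerDer k)
    have h2 : ((s : ℝ) + 1) • ((w * v) • X) =
        ∑ l, ((w * P.D l (P.y l)) • (v • X) + ((v • X) (P.y l) * w) • P.D l) +
        ∑ k, (w * v * X (P.η k)) • P.E k := by
      refine LinearMap.ext fun a => ?_
      rw [Finset.sum_add_distrib, ← Finset.sum_smul, ← Finset.mul_sum, P.sum_D]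
      simp only [LinearMap.add_apply, LinearMap.sum_apply, LinearMap.smul_apply, smul_eq_mul,
        P.comm_of_even hw0 _ |>.symm]
      simp only [mul_assoc, ← Finset.mul_sum]
      rw [add_assoc, ← mul_add, ← mul_add, ← mul_add, ← P.expansion hX0]
      rw [smul_mul_assoc, one_mul, mul_add, mul_smul_comm, add_smul, one_smul]
    have h4 := add_mem h h1
    rw [← h2] at h4
    exact (Submodule.smul_mem_iff _ (by positivity)).1 h4

/-- Every vector field of degree `q + 2` is a sum of brackets of vector fields of degree `2` and
`q`. -/
theorem eulerDer_add_two_le (hr : 2 < r ∨ (0 < s ∧ 1 < r)) (hq : -1 ≤ q) :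
    eulerDer 𝒜 e (q + 2) ≤ commutatorSpan 𝒜 e q :=
  P.eulerDer_le
    (fun l _ ha => P.smul_mem_commutatorSpan_of_zero hr hq ha (P.D_mem_eulerDer l))
    (fun l _ ha => P.smul_mem_commutatorSpan_of_neg_one hr hq
      (by rwa [show q + 3 = q + 2 + 1 by ring]) (P.E_mem_eulerDer l))

end EulerFrame

/-! ### Ad-nilpotent ideals and degree zero -/

/-- The operator `Y ↦ X Y - Y X`. -/
def adEnd {A : Type*} [Ring A] [Algebra ℝ A] (X : Module.End ℝ A) :
    Module.End ℝ (Module.End ℝ A) where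
  toFun Y := X * Y - Y * X
  map_add' Y Z := by rw [mul_add, add_mul]; abel
  map_smul' c Y := by rw [mul_smul_comm, smul_mul_assoc, ← smul_sub]; rfl

theorem adEnd_apply {A : Type*} [Ring A] [Algebra ℝ A] (X Y : Module.End ℝ A) :
    adEnd X Y = X * Y - Y * X := rfl

namespace EulerFrame

variable {A : Type*} [Ring A] [Algebra ℝ A] {𝒜 : ZMod 2 → Submodule ℝ A} [GradedAlgebra 𝒜]
  {e : Module.End ℝ A} {ι κ : Type} [Fintype ι] [Fintype κ] {s r : ℕ}
  (P : EulerFrame 𝒜 e ι κ s r)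

include P

theorem adEnd_pow_smul_e {X : Module.End ℝ A} (hX : X ∈ eulerDer 𝒜 e 0) (n : ℕ) {f : A}
    (hf : f ∈ eulerFn e 0) :
    (X ^ n) f ∈ eulerFn e 0 ∧ (adEnd X ^ n) (f • e) = (X ^ n) f • e := by
  induction n generalizing f with
  | zero => exact ⟨hf, rfl⟩
  | succ n ih =>
    have h : adEnd X (f • e) = X f • e := by
      refine LinearMap.ext fun a => ?_
      simp only [adEnd_apply, LinearMap.sub_apply, Module.End.mul_apply, LinearMap.smul_apply,
        smul_eq_mul, homogeneousDer_mul_of_even hX.1 (P.mem_even_of_zero hf), hX.2, Int.cast_zero,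
        zero_smul, add_zero, add_sub_cancel_right]
    rw [pow_succ, pow_succ, Module.End.mul_apply, Module.End.mul_apply, h]
    exact ih (apply_mem_eulerFn hX hf)

/-- The nilpotency of `ad X`, tested on the vector fields `f e`, is that of `X` on functions of
degree `0`. Here `r > 0` is needed, as otherwise `e` vanishes. -/
theorem pow_apply_eq_zero (hr : 0 < r) {X : Module.End ℝ A} (hX : X ∈ eulerDer 𝒜 e 0) {m : ℕ}
    (hm : ∀ Y ∈ superDer 𝒜, (adEnd X ^ m) Y = 0) {f : A} (hf : f ∈ eulerFn e 0) :
    (X ^ m) f = 0 := by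
  obtain ⟨h1, h2⟩ := P.adEnd_pow_smul_e hX m hf
  rw [hm (f • e) (homogeneousDer_le 𝒜 _ (P.smul_mem_eulerDer hf P.e_mem_eulerDer (l := 0)).1)] at h2
  have h3 := P.sum_E_η_mul ((X ^ m) f)
  rw [mem_eulerFn.1 h1, Finset.sum_eq_zero, Int.cast_zero, zero_smul, sub_zero] at h3
  · exact (smul_eq_zero.1 h3.symm).resolve_left (by exact_mod_cast hr.ne')
  · intro k _
    have h4 := LinearMap.congr_fun h2 (P.η k)
    rw [LinearMap.smul_apply, smul_eq_mul, P.e_η, P.comm_of_even (P.mem_even_of_zero h1)] at h4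
    rw [← h4, LinearMap.zero_apply, map_zero]

/-- A superderivation of degree `0` that is nilpotent on the functions of degree `0` vanishes
there: if `X² g = 0`, then `Xᵐ (gᵐ) = m! (X g)ᵐ`. -/
theorem apply_eq_zero_of_pow {X : Module.End ℝ A} (hX : X ∈ eulerDer 𝒜 e 0) {m : ℕ}
    (hm : ∀ f ∈ eulerFn e 0, (X ^ m) f = 0) {f : A} (hf : f ∈ eulerFn e 0) : X f = 0 := by
  have key : ∀ g ∈ eulerFn e 0, X (X g) = 0 → X g = 0 := by
    intro g hg h0
    have hg0 := P.mem_even_of_zero hg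
    have hXg := apply_mem_eulerFn hX hg (l := 0)
    have hX1 : X 1 = 0 := by
      simpa using homogeneousDer_mul_of_even hX.1 (SetLike.one_mem_graded 𝒜) 1
    have h1 : ∀ n : ℕ, X (g ^ (n + 1)) = ((n + 1 : ℕ) : ℝ) • (X g * g ^ n) := by
      intro n
      induction n with
      | zero => simp
      | succ n ih =>
        rw [pow_succ', homogeneousDer_mul_of_even hX.1 hg0, ih, mul_smul_comm, ← mul_assoc,
          P.comm_of_even hg0, mul_assoc, ← pow_succ']
        push_cast
        module
    have h2 : ∀ n : ℕ, ∀ b, (X ^ n) (X g * b) = X g * (X ^ n) b := by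
      intro n
      induction n with
      | zero => simp
      | succ n ih =>
        intro b
        rw [pow_succ, Module.End.mul_apply, Module.End.mul_apply,
          homogeneousDer_mul_of_even hX.1 (P.mem_even_of_zero hXg), h0, zero_mul, zero_add, ih]
    have h3 : ∀ n : ℕ, (X ^ n) (g ^ n) = (n.factorial : ℝ) • (X g) ^ n := by
      intro n
      induction n with
      | zero => simp
      | succ n ih =>
        rw [pow_succ X, Module.End.mul_apply, h1, map_smul, h2, ih, mul_smul_comm, smul_smul,
          ← pow_succ', Nat.factorial_succ, Nat.cast_mul]
    have h4 := h3 m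
    rw [hm _ (P.pow_mem_eulerFn hg m)] at h4
    exact P.eq_zero_of_pow_eq_zero hXg
      ((smul_eq_zero.1 h4.symm).resolve_left (by exact_mod_cast m.factorial_ne_zero))
  have hpow : ∀ n : ℕ, ∀ g ∈ eulerFn e 0, (X ^ (n + 1)) g = 0 → X g = 0 := by
    intro n
    induction n with
    | zero => intro g _ h; simpa using h
    | succ n ih =>
      intro g hg h
      rw [pow_succ, Module.End.mul_apply] at h
      exact key g hg (ih _ (apply_mem_eulerFn hX hg) h)
  exact hpow m f hf (by rw [pow_succ', Module.End.mul_apply, hm f hf, map_zero])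

/-- The functions of degree `1` are separated by the superderivations of degree `-1`. -/
theorem eq_zero_of_forall_neg_one {x : A} (hx : x ∈ eulerFn e 1)
    (h : ∀ D ∈ eulerDer 𝒜 e (-1), D x = 0) : x = 0 := by
  have h1 := P.sum_η_mul_E x
  rw [mem_eulerFn.1 hx, Int.cast_one, one_smul] at h1
  rw [← h1]
  exact Finset.sum_eq_zero fun k _ => by rw [h _ (P.E_mem_eulerDer k), mul_zero]

/-- The nilpotency of `ad T`, tested on the vector fields of degree `-1`, is that of `T` on
functions of degree `1`. -/
theorem pow_apply_eq_zero_of_one {T : Module.End ℝ A} (hT : T ∈ eulerDer 𝒜 e 0)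
    (hT0 : ∀ f ∈ eulerFn e 0, T f = 0) {m : ℕ}
    (hm : ∀ Y ∈ superDer 𝒜, (adEnd T ^ m) Y = 0) {x : A} (hx : x ∈ eulerFn e 1) :
    (T ^ m) x = 0 := by
  have hTx : ∀ n : ℕ, (T ^ n) x ∈ eulerFn e 1 := by
    intro n
    induction n with
    | zero => exact hx
    | succ n ih => rw [pow_succ', Module.End.mul_apply]; exact apply_mem_eulerFn hT ih
  have key : ∀ n : ℕ, ∀ D ∈ eulerDer 𝒜 e (-1),
      (adEnd T ^ n) D x = (-1 : ℝ) ^ n • D ((T ^ n) x) := by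
    intro n
    induction n with
    | zero => simp
    | succ n ih =>
      intro D hD
      rw [pow_succ, Module.End.mul_apply, adEnd_apply, ih _ (commutator_mem_eulerDer rfl hT hD),
        LinearMap.sub_apply, Module.End.mul_apply, Module.End.mul_apply,
        hT0 _ (apply_mem_eulerFn hD (hTx n)), zero_sub, pow_succ' T, Module.End.mul_apply,
        pow_succ, mul_neg_one, neg_smul, smul_neg]
  refine P.eq_zero_of_forall_neg_one (hTx m) fun D hD => ?_
  have h1 := key m D hD
  rw [hm D (homogeneousDer_le 𝒜 _ hD.1), LinearMap.zero_apply] at h1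
  exact (smul_eq_zero.1 h1.symm).resolve_left (pow_ne_zero _ (by norm_num))

/-- An ideal of the even superderivations that consists of ad-nilpotent elements contains no
superderivation `X` of degree `0` except zero. By nilpotency, elements of the ideal vanish on
functions of degree `0`. If `X² a = 0` for `a` of degree `1`, then `[a D, X]` belongs to the ideal
and multiplies `X a` by `-D(X a)`; this function is nilpotent, hence zero, for every `D`, and
`X a = 0`. -/
theorem eq_zero_of_mem_adNilpotent (hr : 0 < r) {J : Submodule ℝ (Module.End ℝ A)}
    (hJ : ∀ X ∈ eulerDer 𝒜 e 0, ∀ Y ∈ J, X * Y - Y * X ∈ J)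
    (hnil : ∀ X ∈ J, ∃ m : ℕ, ∀ Y ∈ superDer 𝒜, (adEnd X ^ m) Y = 0)
    {X : Module.End ℝ A} (hX : X ∈ eulerDer 𝒜 e 0) (hXJ : X ∈ J) : X = 0 := by
  have h0 : ∀ T ∈ eulerDer 𝒜 e 0, T ∈ J → ∀ f ∈ eulerFn e 0, T f = 0 := by
    intro T hT hTJ f hf
    obtain ⟨m, hm⟩ := hnil T hTJ
    exact P.apply_eq_zero_of_pow hT (fun f hf => P.pow_apply_eq_zero hr hT hm hf) hf
  have hX0 := h0 X hX hXJ
  have key : ∀ a ∈ eulerFn e 1, X (X a) = 0 → X a = 0 := by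
    intro a ha h2
    have hb := apply_mem_eulerFn hX ha (l := 1)
    refine P.eq_zero_of_forall_neg_one hb fun D hD => ?_
    have hDb := apply_mem_eulerFn hD hb (l := 0)
    -- `T = [a D, X]` multiplies `X a` by the function `-D (X a)`
    obtain ⟨T, hTdef⟩ : ∃ T, T = (a • D) * X - X * (a • D) := ⟨_, rfl⟩
    have haD := P.smul_mem_eulerDer ha hD (l := 0)
    have hTJ : T ∈ J := hTdef ▸ hJ _ haD _ hXJ
    have hT : T ∈ eulerDer 𝒜 e 0 := hTdef ▸ commutator_mem_eulerDer rfl haD hX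
    have hT0 := h0 T hT hTJ
    obtain ⟨m, hm⟩ := hnil T hTJ
    have hTb : T (X a) = -D (X a) * X a := by
      rw [hTdef, LinearMap.sub_apply, Module.End.mul_apply, Module.End.mul_apply, h2, map_zero,
        LinearMap.smul_apply, smul_eq_mul,
        homogeneousDer_zero_mul (even_of_mem_eulerDer_zero hX) (P.mem_odd_of_one ha), hX0 _ hDb,
        mul_zero, add_zero, zero_sub, ← P.comm_of_even (P.mem_even_of_zero hDb), neg_mul]
    have hc : -D (X a) ∈ eulerFn e 0 := neg_mem hDb
    have hTn : ∀ n : ℕ, (T ^ n) (X a) = (-D (X a)) ^ n * X a := by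
      intro n
      induction n with
      | zero => simp
      | succ n ih =>
        have hp := P.pow_mem_eulerFn hc n
        rw [pow_succ', Module.End.mul_apply, ih,
          homogeneousDer_mul_of_even hT.1 (P.mem_even_of_zero hp), hT0 _ hp, zero_mul, zero_add,
          hTb, pow_succ, mul_assoc]
    have h3 := hTn m
    rw [P.pow_apply_eq_zero_of_one hT hT0 hm hb] at h3
    have h4 := congrArg D h3
    have hp := P.pow_mem_eulerFn hc m
    rw [map_zero, homogeneousDer_mul_of_even hD.1 (P.mem_even_of_zero hp),
      P.apply_eq_zero_of_neg_one hD hp, zero_mul, zero_add] at h4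
    have h5 : (-D (X a)) ^ (m + 1) = 0 := by rw [pow_succ, mul_neg, ← h4, neg_zero]
    exact neg_eq_zero.1 (P.eq_zero_of_pow_eq_zero hc h5)
  obtain ⟨m, hm⟩ := hnil X hXJ
  have hpow : ∀ n : ℕ, ∀ a ∈ eulerFn e 1, (X ^ (n + 1)) a = 0 → X a = 0 := by
    intro n
    induction n with
    | zero => intro g _ h; simpa using h
    | succ n ih =>
      intro g hg h
      rw [pow_succ, Module.End.mul_apply] at h
      exact key g hg (ih _ (apply_mem_eulerFn hX hg) h)
  rw [P.eulerDer_expansion hX.1, Finset.sum_eq_zero, Finset.sum_eq_zero, add_zero]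
  · intro k _
    rw [hpow m _ (P.η_mem_eulerFn k) (by rw [pow_succ', Module.End.mul_apply,
      P.pow_apply_eq_zero_of_one hX hX0 hm (P.η_mem_eulerFn k), map_zero]), zero_smul]
  · intro l _
    rw [hX0 _ (P.y_mem_eulerFn l), zero_smul]

end EulerFrame

/-! ### Lie superalgebras graded by an Euler element -/

/-- An independent family that contains, member by member, a family spanning the whole space
coincides with it. -/
theorem eq_of_iSupIndep_of_iSup_eq_top {L ι : Type*} [AddCommGroup L] [Module ℝ L]
    {G H : ι → Submodule ℝ L} (hH : iSupIndep H) (hle : ∀ k, G k ≤ H k) (hG : ⨆ k, G k = ⊤) :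
    H = G := by
  funext k
  refine le_antisymm (fun x hx => ?_) (hle k)
  have h1 : G k ⊔ ⨆ (j) (_ : j ≠ k), H j = ⊤ := by
    rw [eq_top_iff, ← hG]
    refine iSup_le fun j => ?_
    by_cases hj : j = k
    · rw [hj]
      exact le_sup_left
    · exact le_sup_of_le_right ((hle j).trans (le_iSup₂_of_le j hj le_rfl))
  obtain ⟨g, hg, h, hh, rfl⟩ := Submodule.mem_sup.1 (h1.ge (Submodule.mem_top (x := x)))
  have h2 : h ∈ H k := by simpa using sub_mem hx (hle k hg)
  rw [Submodule.disjoint_def.1 (hH k) h h2 hh, add_zero]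
  exact hg

/-- A grading `G` of a Lie superalgebra by the eigenvalues of `ad ε`, with the properties of the
grading of the vector fields of a supermanifold of odd dimension `r` from which the canonical
filtration is determined. -/
structure EulerGrading {L : Type*} [AddCommGroup L] [Module ℝ L] (S : LieSuperalgebra L) (ε : L)
    (r : ℕ) (G : ℤ → Submodule ℝ L) : Prop where
  le_parity : ∀ k : ℤ, G k ≤ S.parity k
  bracket_mem : ∀ {j k : ℤ} {X Y : L}, X ∈ G j → Y ∈ G k → S.bracket X Y ∈ G (j + k)
  iSup_eq_top : ⨆ k : ℤ, G k = ⊤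
  euler_mem : ε ∈ S.parity 0
  euler_bracket : ∀ {k : ℤ} {X : L}, X ∈ G k → S.bracket ε X = (k : ℝ) • X
  eq_bot : ∀ {k : ℤ}, k < -1 ∨ (r : ℤ) < k → G k = ⊥
  le_map₂ : ∀ {q : ℤ}, -1 ≤ q → G (q + 2) ≤ Submodule.map₂ S.bracket (G 2) (G q)
  eq_zero_of_mem : ∀ {J : Submodule ℝ L}, S.IsAdNilpotentIdeal J → ∀ X ∈ J, X ∈ G 0 → X = 0

/-- The sum of the components of degree `p`, `p + 2`, `p + 4`, …. -/
def tail {L : Type*} [AddCommGroup L] [Module ℝ L] (G : ℤ → Submodule ℝ L) (p : ℤ) :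
    Submodule ℝ L := ⨆ i : ℕ, G (p + 2 * (i : ℤ))

theorem le_tail {L : Type*} [AddCommGroup L] [Module ℝ L] {G : ℤ → Submodule ℝ L} {p k : ℤ}
    (i : ℕ) (h : k = p + 2 * (i : ℤ)) : G k ≤ tail G p := by
  subst h
  exact le_iSup (fun i : ℕ => G (p + 2 * (i : ℤ))) i

theorem tail_add_two_le {L : Type*} [AddCommGroup L] [Module ℝ L] {G : ℤ → Submodule ℝ L}
    (p : ℤ) : tail G (p + 2) ≤ tail G p :=
  iSup_le fun i => le_tail (i + 1) (by push_cast; ring)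

theorem intCast_add_two_mul (p i : ℤ) : ((p + 2 * i : ℤ) : ZMod 2) = p := by
  have : (2 : ZMod 2) = 0 := rfl
  push_cast
  rw [this, zero_mul, add_zero]

namespace EulerGrading

variable {L : Type*} [AddCommGroup L] [Module ℝ L] {S : LieSuperalgebra L} {ε : L} {r : ℕ}
  {G : ℤ → Submodule ℝ L} (E : EulerGrading S ε r G)

include E

theorem tail_le_parity (p : ℤ) : tail G p ≤ S.parity p :=
  iSup_le fun i => by
    rw [← intCast_add_two_mul p i]
    exact E.le_parity _

theorem bracket_mem_tail {p q : ℤ} {X Y : L} (hX : X ∈ tail G p) (hY : Y ∈ tail G q) :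
    S.bracket X Y ∈ tail G (p + q) := by
  have h : Submodule.map₂ S.bracket (tail G p) (tail G q) ≤ tail G (p + q) := by
    rw [tail, tail, Submodule.map₂_iSup_left]
    refine iSup_le fun i => ?_
    rw [Submodule.map₂_iSup_right]
    refine iSup_le fun j => Submodule.map₂_le.2 fun X hX Y hY => ?_
    exact le_tail (i + j) (by push_cast; ring) (E.bracket_mem hX hY)
  exact h (Submodule.apply_mem_map₂ _ hX hY)

theorem tail_eq_bot {p : ℤ} (hp : (r : ℤ) < p) : tail G p = ⊥ :=
  (iSup_eq_bot).2 fun i => E.eq_bot (Or.inr (by omega))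

/-- The components are the full eigenspaces of `ad ε`. -/
theorem eigenspace_eq :
    (fun k : ℤ => Module.End.eigenspace (S.bracket ε : Module.End ℝ L) (k : ℝ)) = G :=
  eq_of_iSupIndep_of_iSup_eq_top
    ((Module.End.eigenspaces_iSupIndep (S.bracket ε : Module.End ℝ L)).comp
      (f := fun k : ℤ => (k : ℝ)) Int.cast_injective)
    (fun _ _ hX => Module.End.mem_eigenspace_iff.2 (E.euler_bracket hX)) E.iSup_eq_top

theorem mem_iff {k : ℤ} {X : L} : X ∈ G k ↔ S.bracket ε X = (k : ℝ) • X := by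
  rw [← congrFun E.eigenspace_eq k, Module.End.mem_eigenspace_iff]

theorem iSupIndep : iSupIndep G := by
  rw [← E.eigenspace_eq]
  exact (Module.End.eigenspaces_iSupIndep (S.bracket ε : Module.End ℝ L)).comp
    (f := fun k : ℤ => (k : ℝ)) Int.cast_injective

theorem isZGrading : S.IsZGrading G where
  isInternal := DirectSum.isInternal_submodule_of_iSupIndep_of_iSup_eq_top E.iSupIndep E.iSup_eq_top
  le_parity := E.le_parity
  bracket_mem := E.bracket_mem

/-- As there are no components below degree `-1`, the tails that begin at `p ≤ 0` are the even and
the odd part. -/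
theorem parity_eq_tail {p : ℤ} (hp : p ≤ 0) :
    S.parity (p : ZMod 2) = tail G p := by
  refine le_antisymm (fun X hX => ?_) (E.tail_le_parity p)
  have h1 : ⨆ k : ℤ, G k ≤
      tail G p ⊔ S.parity ((p + 1 : ℤ) : ZMod 2) := by
    refine iSup_le fun k => ?_
    rcases Int.even_or_odd (k - p) with ⟨i, hi⟩ | ⟨i, hi⟩
    · by_cases h0 : 0 ≤ i
      · refine le_sup_of_le_left (le_tail i.toNat ?_)
        rw [Int.toNat_of_nonneg h0]
        omega
      · rw [E.eq_bot (Or.inl (by omega))]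
        exact bot_le
    · refine le_sup_of_le_right ((E.le_parity k).trans (le_of_eq ?_))
      have h2 : (2 : ZMod 2) = 0 := rfl
      rw [show k = 2 * i + (p + 1) by omega, Int.cast_add, Int.cast_mul, Int.cast_ofNat, h2,
        zero_mul, zero_add]
  rw [E.iSup_eq_top] at h1
  obtain ⟨Y, hY, Z, hZ, rfl⟩ := Submodule.mem_sup.1 (h1 (Submodule.mem_top (x := X)))
  have hZ' : Z ∈ S.parity (p : ZMod 2) := by
    simpa using sub_mem hX (E.tail_le_parity p hY)
  have hZ0 : Z = 0 := by
    have hd := S.isCompl_parity.disjoint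
    push_cast at hZ
    rcases parity_cases (p : ZMod 2) with h | h <;> rw [h] at hZ hZ'
    · exact Submodule.disjoint_def.1 hd Z hZ' (by simpa using hZ)
    · exact Submodule.disjoint_def.1 hd Z (by simpa [parity_one_add_one] using hZ) hZ'
  rw [hZ0, add_zero]
  exact hY

theorem parity_zero_eq : S.parity 0 = tail G 0 := by
  have h := E.parity_eq_tail (p := 0) le_rfl
  rwa [Int.cast_zero] at h

theorem parity_one_eq : S.parity 1 = tail G (-1) := by
  have h := E.parity_eq_tail (p := -1) (by omega)
  rwa [show ((-1 : ℤ) : ZMod 2) = 1 from rfl] at h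

/-- The adjoint action of an element raises degrees by at least `2`, and there are only finitely
many degrees. -/
theorem isAdNilpotentIdeal_tail :
    S.IsAdNilpotentIdeal (tail G 2) where
  le_even := by
    have h := E.tail_le_parity 2
    rwa [show ((2 : ℤ) : ZMod 2) = 0 from rfl] at h
  bracket_mem X hX Y hY := by
    rw [E.parity_zero_eq] at hX
    have h := E.bracket_mem_tail hX hY
    rwa [zero_add] at h
  nilpotent X hX := by
    have h : ∀ n : ℕ, ∀ p : ℤ, ∀ Y ∈ tail G p,
        (S.bracket X ^ n) Y ∈ tail G (2 * n + p) := by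
      intro n p Y hY
      induction n with
      | zero => simpa using hY
      | succ n ih =>
        rw [pow_succ', Module.End.mul_apply]
        have := E.bracket_mem_tail hX ih
        rwa [show (2 : ℤ) * ((n + 1 : ℕ) : ℤ) + p = 2 + (2 * n + p) by push_cast; ring]
    have h0 : ∀ p : ℤ, -1 ≤ p → ∀ Y ∈ tail G p,
        (S.bracket X ^ (r + 1)) Y = 0 := by
      intro p hp Y hY
      have h1 := h (r + 1) p Y hY
      rw [E.tail_eq_bot (by push_cast; omega)] at h1
      exact (Submodule.mem_bot ℝ).1 h1
    refine ⟨r + 1, fun Y => ?_⟩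
    have htop := S.isCompl_parity.sup_eq_top
    rw [E.parity_zero_eq, E.parity_one_eq] at htop
    obtain ⟨Y0, hY0, Y1, hY1, rfl⟩ := Submodule.mem_sup.1 (htop.ge (Submodule.mem_top (x := Y)))
    rw [map_add, h0 0 (by omega) _ hY0, h0 (-1) le_rfl _ hY1, add_zero]

open Polynomial in
/-- An ideal is stable under polynomials in `ad ε` and thus contains, with each element, its
component of degree `0`. This component vanishes if the ideal is ad-nilpotent. -/
theorem le_tail_of_isAdNilpotentIdeal {J : Submodule ℝ L}
    (hJ : S.IsAdNilpotentIdeal J) : J ≤ tail G 2 := by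
  intro X hX
  -- the polynomial `p` in `ad ε` projects to the component of degree `0`, up to a constant
  obtain ⟨p, hp⟩ : ∃ p : ℝ[X], p = ∏ k ∈ Finset.range r, (Polynomial.X - C ((k + 1 : ℕ) : ℝ)) :=
    ⟨_, rfl⟩
  have hp0 : p.eval 0 ≠ 0 := by
    rw [hp, eval_prod]
    refine Finset.prod_ne_zero_iff.2 fun k _ => ?_
    rw [eval_sub, eval_X, eval_C, zero_sub, neg_ne_zero]
    exact_mod_cast k.succ_ne_zero
  have hpk : ∀ k : ℕ, 0 < k → k ≤ r → p.eval (k : ℝ) = 0 := by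
    intro k h0 hk
    rw [hp, eval_prod]
    refine Finset.prod_eq_zero (Finset.mem_range.2 (Nat.sub_one_lt_of_le h0 hk)) ?_
    rw [eval_sub, eval_X, eval_C, Nat.sub_add_cancel h0, sub_self]
  obtain ⟨T, hT⟩ : ∃ T : Module.End ℝ L, T = S.bracket ε := ⟨_, rfl⟩
  have haeval : ∀ (k : ℤ), ∀ Y ∈ G k,
      aeval T p Y = p.eval (k : ℝ) • Y := by
    intro k Y hY
    rw [hT]
    by_cases hY0 : Y = 0
    · rw [hY0, map_zero, smul_zero]
    exact Module.End.aeval_apply_of_hasEigenvector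
      ⟨Module.End.mem_eigenspace_iff.2 (E.euler_bracket hY), hY0⟩
  have hXtail : X ∈ tail G 0 := by
    rw [← E.parity_zero_eq]
    exact hJ.le_even hX
  have key : aeval T p X ∈ G 0 ∧
      p.eval 0 • X - aeval T p X ∈ tail G 2 := by
    clear hX
    induction hXtail using Submodule.iSup_induction' with
    | mem i Y hY =>
      rw [haeval _ Y hY]
      rcases Nat.eq_zero_or_pos i with rfl | hi
      · simp only [Nat.cast_zero, mul_zero, add_zero, Int.cast_zero, sub_self] at hY ⊢
        exact ⟨Submodule.smul_mem _ _ hY, zero_mem _⟩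
      · by_cases hir : 2 * i ≤ r
        · have h := hpk (2 * i) (by omega) hir
          have h2 : ((0 + 2 * (i : ℤ) : ℤ) : ℝ) = ((2 * i : ℕ) : ℝ) := by push_cast; ring
          rw [h2, h, zero_smul, sub_zero]
          exact ⟨zero_mem _, Submodule.smul_mem _ _ (le_tail (i - 1) (by omega) hY)⟩
        · rw [E.eq_bot (Or.inr (by omega)), Submodule.mem_bot] at hY
          rw [hY, smul_zero, smul_zero, sub_zero]
          exact ⟨zero_mem _, zero_mem _⟩
    | zero => simp
    | add Y Z _ _ hY hZ =>
      rw [map_add, smul_add, add_sub_add_comm]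
      exact ⟨add_mem hY.1 hZ.1, add_mem hY.2 hZ.2⟩
  have hTJ : aeval T p X ∈ J := by
    have hinv : ∀ Y ∈ J, T Y ∈ J := hT ▸ hJ.bracket_mem ε E.euler_mem
    clear key hXtail haeval hp hpk hp0
    induction p using Polynomial.induction_on' with
    | add p q hp hq => rw [map_add, LinearMap.add_apply]; exact add_mem hp hq
    | monomial n c =>
      rw [aeval_monomial, Module.End.mul_apply, Module.algebraMap_end_apply]
      refine Submodule.smul_mem _ _ ?_
      induction n with
      | zero => exact hX
      | succ n ih => rw [pow_succ', Module.End.mul_apply]; exact hinv _ ih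
  have hzero : aeval T p X = 0 := E.eq_zero_of_mem hJ _ hTJ key.1
  have h := key.2
  rw [hzero, sub_zero] at h
  exact (Submodule.smul_mem_iff _ hp0).1 h

theorem map₂_bracket_tail {q : ℤ} (hq : -1 ≤ q) :
    Submodule.map₂ S.bracket (tail G 2) (tail G q) = tail G (q + 2) := by
  refine le_antisymm (Submodule.map₂_le.2 fun X hX Y hY => ?_) (iSup_le fun i => ?_)
  · rw [add_comm]
    exact E.bracket_mem_tail hX hY
  · rw [show q + 2 + 2 * (i : ℤ) = q + 2 * (i : ℤ) + 2 by ring]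
    exact (E.le_map₂ (by omega)).trans
      (Submodule.map₂_le_map₂ (le_tail 0 (by simp)) (le_tail i rfl))

/-- The filtration built from the ideal `tail G 2` consists of the tails. For `p < -1` both sides
are full parity parts. -/
theorem lower_tail (p : ℤ) :
    S.lower (tail G 2) p = tail G p := by
  have key : ∀ n : ℕ,
      S.lower (tail G 2) (n - 1) = tail G (n - 1) ∧
      S.lower (tail G 2) n = tail G n := by
    intro n
    induction n with
    | zero =>
      rw [Nat.cast_zero, zero_sub, LieSuperalgebra.lower_neg_one, LieSuperalgebra.lower_zero]
      exact ⟨E.parity_one_eq, E.parity_zero_eq⟩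
    | succ n ih =>
      rw [show ((n + 1 : ℕ) : ℤ) - 1 = n by push_cast; ring,
        show ((n + 1 : ℕ) : ℤ) = n - 1 + 2 by push_cast; ring,
        LieSuperalgebra.lower_add_two _ _ (by omega), ih.1, E.map₂_bracket_tail (by omega)]
      exact ⟨ih.2, rfl⟩
  by_cases hp : p < -1
  · rw [LieSuperalgebra.lower, if_pos hp, E.parity_eq_tail (by omega)]
  · have h := (key (p + 1).toNat).1
    rwa [Int.toNat_of_nonneg (by omega), add_sub_cancel_right] at h

end EulerGrading

/-! ### The grading of the vector fields by degree -/

section Parts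

variable {A : Type*} [Ring A] [Algebra ℝ A] (𝒜 : ZMod 2 → Submodule ℝ A)

/-- The vector fields of degree `k` with respect to `e`, inside the Lie superalgebra. The parity of
`k` is part of the definition. -/
def derPart (e : Module.End ℝ A) (k : ℤ) : Submodule ℝ (superDer 𝒜) :=
  (eulerDer 𝒜 e k).submoduleOf (superDer 𝒜)

variable {𝒜} {e : Module.End ℝ A}

theorem mem_derPart {k : ℤ} {X : superDer 𝒜} :
    X ∈ derPart 𝒜 e k ↔ (X : Module.End ℝ A) ∈ eulerDer 𝒜 e k := Iff.rfl

variable [GradedAlgebra 𝒜]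

theorem derPart_le_parity (k : ℤ) : derPart 𝒜 e k ≤ (vectorFields 𝒜).parity k :=
  fun _ hX => hX.1

theorem bracket_coe_of_even {X Y : superDer 𝒜}
    (hX : (X : Module.End ℝ A) ∈ homogeneousDer 𝒜 0) :
    ((vectorFields 𝒜).bracket X Y : Module.End ℝ A) =
      (X : Module.End ℝ A) * Y - (Y : Module.End ℝ A) * X := by
  change superComm 𝒜 X Y = _
  obtain ⟨Y0, hY0, Y1, hY1, h⟩ := Submodule.mem_sup.1 Y.2
  rw [← h, map_add, superComm_apply hX hY0, superComm_apply hX hY1, superSign_zero_left,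
    superSign_zero_left, one_smul, one_smul, mul_add, add_mul]
  abel

theorem bracket_pow_coe_of_even {X : superDer 𝒜}
    (hX : (X : Module.End ℝ A) ∈ homogeneousDer 𝒜 0) (n : ℕ) (Y : superDer 𝒜) :
    ((((vectorFields 𝒜).bracket X ^ n) Y : superDer 𝒜) : Module.End ℝ A) =
      (adEnd (X : Module.End ℝ A) ^ n) Y := by
  induction n with
  | zero => rfl
  | succ n ih =>
    rw [pow_succ', pow_succ', Module.End.mul_apply, Module.End.mul_apply, bracket_coe_of_even hX,
      ih, adEnd_apply]

theorem bracket_mem_derPart {j k l : ℤ} {X Y : superDer 𝒜} (hX : X ∈ derPart 𝒜 e j)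
    (hY : Y ∈ derPart 𝒜 e k) (h : l = j + k := by omega) :
    (vectorFields 𝒜).bracket X Y ∈ derPart 𝒜 e l := by
  subst h
  rw [mem_derPart] at hX hY
  change superComm 𝒜 X Y ∈ eulerDer 𝒜 e _
  refine ⟨?_, fun a => ?_⟩
  · rw [Int.cast_add]
    exact superComm_mem hX.1 hY.1
  · rw [superComm_apply hX.1 hY.1]
    simp only [LinearMap.sub_apply, LinearMap.smul_apply, Module.End.mul_apply, map_sub, map_smul,
      hX.2, hY.2, map_add]
    push_cast
    module

end Parts

namespace EulerFrame

variable {A : Type*} [Ring A] [Algebra ℝ A] {𝒜 : ZMod 2 → Submodule ℝ A} [GradedAlgebra 𝒜]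
  {ε : superDer 𝒜} {ι κ : Type} [Fintype ι] [Fintype κ] {s r : ℕ}
  (P : EulerFrame 𝒜 (ε : Module.End ℝ A) ι κ s r)

include P

theorem derPart_eq_bot {k : ℤ} (hk : k < -1 ∨ (r : ℤ) < k) : derPart 𝒜 ε k = ⊥ :=
  (Submodule.eq_bot_iff _).2 fun _ hX => Subtype.ext (P.eulerDer_eq_zero hk hX)

theorem iSup_derPart : ⨆ k : ℤ, derPart 𝒜 ε k = ⊤ := by
  rw [eq_top_iff]
  rintro ⟨X, hX⟩ -
  have hle : ∀ k : ℤ, eulerDer 𝒜 ε k ≤ superDer 𝒜 := fun k Y hY => homogeneousDer_le 𝒜 _ hY.1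
  have h : ⨆ k : ℤ, eulerDer 𝒜 (ε : Module.End ℝ A) k ≤
      (⨆ k : ℤ, derPart 𝒜 ε k).map (superDer 𝒜).subtype := by
    refine iSup_le fun k Y hY => ?_
    exact ⟨⟨Y, hle k hY⟩, Submodule.mem_iSup_of_mem k hY, rfl⟩
  obtain ⟨Y, hY, hYX⟩ := h (P.superDer_le_iSup_eulerDer hX)
  have : Y = ⟨X, hX⟩ := Subtype.ext hYX
  rwa [← this]

/-- The vector fields of an algebra with an Euler frame satisfy everything that determines the
canonical filtration. -/
theorem eulerGrading (hr : 2 < r ∨ (0 < s ∧ 1 < r)) :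
    EulerGrading (vectorFields 𝒜) ε r (derPart 𝒜 ε) where
  le_parity := derPart_le_parity
  bracket_mem hX hY := bracket_mem_derPart hX hY rfl
  iSup_eq_top := P.iSup_derPart
  euler_mem := P.e_mem
  euler_bracket {k X} hX := by
    refine Subtype.ext (LinearMap.ext fun a => ?_)
    rw [bracket_coe_of_even P.e_mem, LinearMap.sub_apply, Module.End.mul_apply,
      Module.End.mul_apply, (mem_derPart.1 hX).2, add_sub_cancel_left]
    rfl
  eq_bot := P.derPart_eq_bot
  le_map₂ {q} hq X hX := by
    have h : commutatorSpan 𝒜 (ε : Module.End ℝ A) q ≤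
        (Submodule.map₂ (vectorFields 𝒜).bracket (derPart 𝒜 ε 2) (derPart 𝒜 ε q)).map
          (superDer 𝒜).subtype := by
      refine Submodule.span_le.2 ?_
      rintro _ ⟨Y, hY, Z, hZ, rfl⟩
      have hY' : (⟨Y, homogeneousDer_le 𝒜 _ hY.1⟩ : superDer 𝒜) ∈ derPart 𝒜 ε 2 := hY
      have hZ' : (⟨Z, homogeneousDer_le 𝒜 _ hZ.1⟩ : superDer 𝒜) ∈ derPart 𝒜 ε q := hZ
      exact ⟨_, Submodule.apply_mem_map₂ (vectorFields 𝒜).bracket hY' hZ',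
        bracket_coe_of_even (X := ⟨Y, homogeneousDer_le 𝒜 _ hY.1⟩)
          (Y := ⟨Z, homogeneousDer_le 𝒜 _ hZ.1⟩) hY.1⟩
    obtain ⟨Y, hY, hYX⟩ := h (P.eulerDer_add_two_le hr hq hX)
    rwa [← Subtype.ext hYX]
  eq_zero_of_mem {J} hJ X hXJ hX := by
    refine Subtype.ext (P.eq_zero_of_mem_adNilpotent (by omega) (J := J.map (superDer 𝒜).subtype)
      ?_ ?_ hX ⟨_, hXJ, rfl⟩)
    · rintro Y hY _ ⟨Z, hZ, rfl⟩
      have hY0 := even_of_mem_eulerDer_zero hY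
      exact ⟨_, hJ.bracket_mem ⟨Y, homogeneousDer_le 𝒜 _ hY0⟩ hY0 Z hZ, bracket_coe_of_even hY0⟩
    · rintro _ ⟨Z, hZ, rfl⟩
      obtain ⟨m, hm⟩ := hJ.nilpotent Z hZ
      refine ⟨m, fun Y hY => ?_⟩
      have h := bracket_pow_coe_of_even (hJ.le_even hZ) m ⟨Y, hY⟩
      rw [hm] at h
      exact h.symm

end EulerFrame

/-! ### The associated graded Lie superalgebra and its automorphisms -/

theorem isInternal_range_lof (M : ℤ → Type*) [∀ p, AddCommGroup (M p)] [∀ p, Module ℝ (M p)] :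
    DirectSum.IsInternal fun p => LinearMap.range (DirectSum.lof ℝ ℤ M p) := by
  refine DirectSum.isInternal_submodule_of_iSupIndep_of_iSup_eq_top ?_
    DFinsupp.iSup_range_lsingle
  rw [iSupIndep_def]
  intro p
  rw [Submodule.disjoint_def]
  intro x hx hx'
  have h : (⨆ (q) (_ : q ≠ p), LinearMap.range (DirectSum.lof ℝ ℤ M q)) ≤
      LinearMap.ker (DirectSum.component ℝ ℤ M p) := by
    refine iSup₂_le fun q hq => ?_
    rintro _ ⟨z, rfl⟩
    exact DirectSum.of_eq_of_ne _ _ _ hq.symm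
  obtain ⟨z, rfl⟩ := hx
  have h2 : DirectSum.component ℝ ℤ M p (DirectSum.lof ℝ ℤ M p z) = 0 := h hx'
  rw [DirectSum.component.lof_self] at h2
  rw [h2, map_zero]

namespace LieSuperalgebra

namespace Filtration

variable {L : Type*} [AddCommGroup L] [Module ℝ L] {S : LieSuperalgebra L} (𝓕 : S.Filtration)

theorem gr_induction {C : 𝓕.Gr → Prop} (h0 : C 0) (hadd : ∀ x y, C x → C y → C (x + y))
    (hcls : ∀ (p : ℤ) (x : 𝓕.F p), C (𝓕.cls p x)) (x : 𝓕.Gr) : C x := by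
  induction x using DirectSum.induction_on with
  | zero => exact h0
  | add x y hx hy => exact hadd x y hx hy
  | of p x =>
    obtain ⟨y, rfl⟩ := Submodule.mkQ_surjective _ x
    exact hcls p y

theorem mem_grPiece_iff {p : ℤ} {x : 𝓕.Gr} : x ∈ 𝓕.grPiece p ↔ ∃ y : 𝓕.F p, 𝓕.cls p y = x := by
  constructor
  · rintro ⟨z, rfl⟩
    obtain ⟨y, rfl⟩ := Submodule.mkQ_surjective _ z
    exact ⟨y, rfl⟩
  · rintro ⟨y, rfl⟩
    exact ⟨_, rfl⟩

theorem isZGrading_gr : 𝓕.gr.IsZGrading 𝓕.grPiece where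
  isInternal := isInternal_range_lof 𝓕.Piece
  le_parity p x hx := by
    obtain ⟨y, rfl⟩ := 𝓕.mem_grPiece_iff.1 hx
    exact 𝓕.cls_mem_grParity rfl y
  bracket_mem {p q x y} hx hy := by
    obtain ⟨x, rfl⟩ := 𝓕.mem_grPiece_iff.1 hx
    obtain ⟨y, rfl⟩ := 𝓕.mem_grPiece_iff.1 hy
    exact 𝓕.mem_grPiece_iff.2 ⟨_, (𝓕.grBracket_cls x y).symm⟩

/-- A complement of `F (p + 2)` in `F p` is isomorphic to the quotient. -/
def pieceEquiv (p : ℤ) (H : Submodule ℝ L) (hle : H ≤ 𝓕.F p) (hd : Disjoint H (𝓕.F (p + 2)))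
    (hs : 𝓕.F p ≤ H ⊔ 𝓕.F (p + 2)) : H ≃ₗ[ℝ] 𝓕.Piece p :=
  LinearEquiv.ofBijective (Submodule.mkQ _ ∘ₗ Submodule.inclusion hle)
    ⟨by
      refine (injective_iff_map_eq_zero _).2 fun X h => ?_
      rw [LinearMap.comp_apply, Submodule.mkQ_apply, Submodule.Quotient.mk_eq_zero] at h
      exact Subtype.ext (Submodule.disjoint_def.1 hd X X.2 h), by
      intro z
      obtain ⟨⟨X, hX⟩, rfl⟩ := Submodule.mkQ_surjective _ z
      obtain ⟨Y, hY, Z, hZ, rfl⟩ := Submodule.mem_sup.1 (hs hX)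
      refine ⟨⟨Y, hY⟩, ?_⟩
      rw [LinearMap.comp_apply, Submodule.mkQ_apply, Submodule.mkQ_apply, Submodule.Quotient.eq]
      change Y - (Y + Z) ∈ 𝓕.F (p + 2)
      rw [sub_add_cancel_left]
      exact neg_mem hZ⟩

/-- The map of associated graded spaces induced by a linear map that preserves the filtration. -/
def grMap (f : L →ₗ[ℝ] L) (hf : ∀ p, ∀ X ∈ 𝓕.F p, f X ∈ 𝓕.F p) : 𝓕.Gr →ₗ[ℝ] 𝓕.Gr :=
  DirectSum.toModule ℝ ℤ _ fun p => DirectSum.lof ℝ ℤ 𝓕.Piece p ∘ₗ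
    Submodule.mapQ _ _ (f.restrict (hf p)) fun X hX => hf (p + 2) X hX

theorem grMap_cls (f : L →ₗ[ℝ] L) (hf : ∀ p, ∀ X ∈ 𝓕.F p, f X ∈ 𝓕.F p) (p : ℤ) (X : 𝓕.F p) :
    𝓕.grMap f hf (𝓕.cls p X) = 𝓕.cls p ⟨f X, hf p X X.2⟩ := by
  rw [grMap, cls, LinearMap.comp_apply, DirectSum.toModule_lof]
  rfl

variable (h𝓕 : ∀ ψ ∈ S.aut S.parity, ∀ p, ∀ X ∈ 𝓕.F p, ψ X ∈ 𝓕.F p)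

/-- The automorphism of the associated graded space induced by an automorphism. -/
def grEquiv (ψ : S.aut S.parity) : 𝓕.Gr ≃ₗ[ℝ] 𝓕.Gr :=
  LinearEquiv.ofLinearMap (𝓕.grMap ψ.1.toLinearMap (h𝓕 ψ.1 ψ.2))
    (𝓕.grMap (ψ⁻¹).1.toLinearMap (h𝓕 (ψ⁻¹).1 (ψ⁻¹).2))
    (LinearMap.ext fun x => by
      induction x using 𝓕.gr_induction with
      | h0 => simp
      | hadd x y hx hy => rw [map_add, hx, hy, map_add]
      | hcls p x =>
        rw [LinearMap.comp_apply, grMap_cls, grMap_cls]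
        exact 𝓕.cls_congr rfl _ x.2 (ψ.1.apply_symm_apply x))
    (LinearMap.ext fun x => by
      induction x using 𝓕.gr_induction with
      | h0 => simp
      | hadd x y hx hy => rw [map_add, hx, hy, map_add]
      | hcls p x =>
        rw [LinearMap.comp_apply, grMap_cls, grMap_cls]
        exact 𝓕.cls_congr rfl _ x.2 (ψ.1.symm_apply_apply x))

theorem grEquiv_cls (ψ : S.aut S.parity) (p : ℤ) (X : 𝓕.F p) :
    𝓕.grEquiv h𝓕 ψ (𝓕.cls p X) = 𝓕.cls p ⟨ψ.1 X, h𝓕 ψ.1 ψ.2 p X X.2⟩ := 𝓕.grMap_cls _ _ p X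

theorem grEquiv_mul (ψ χ : S.aut S.parity) :
    𝓕.grEquiv h𝓕 (ψ * χ) = 𝓕.grEquiv h𝓕 ψ * 𝓕.grEquiv h𝓕 χ := by
  refine LinearEquiv.ext fun x => ?_
  induction x using 𝓕.gr_induction with
  | h0 => rw [map_zero, map_zero]
  | hadd x y hx hy => rw [map_add, hx, hy, map_add]
  | hcls p x =>
    rw [LinearEquiv.mul_apply, grEquiv_cls, grEquiv_cls, grEquiv_cls]
    rfl

theorem grEquiv_one : 𝓕.grEquiv h𝓕 1 = 1 := by
  refine LinearEquiv.ext fun x => ?_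
  induction x using 𝓕.gr_induction with
  | h0 => rw [map_zero, map_zero]
  | hadd x y hx hy => rw [map_add, hx, hy, map_add]
  | hcls p x =>
    rw [grEquiv_cls]
    rfl

theorem grEquiv_mem_grPiece (ψ : S.aut S.parity) {p : ℤ} {x : 𝓕.Gr} (hx : x ∈ 𝓕.grPiece p) :
    𝓕.grEquiv h𝓕 ψ x ∈ 𝓕.grPiece p := by
  obtain ⟨y, rfl⟩ := 𝓕.mem_grPiece_iff.1 hx
  exact 𝓕.mem_grPiece_iff.2 ⟨_, (𝓕.grEquiv_cls h𝓕 ψ p y).symm⟩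

theorem grEquiv_mem_aut (ψ : S.aut S.parity) : 𝓕.grEquiv h𝓕 ψ ∈ 𝓕.gr.aut 𝓕.grPiece := by
  refine ⟨fun x y => ?_, fun p x => ⟨fun h => ?_, 𝓕.grEquiv_mem_grPiece h𝓕 ψ⟩⟩
  · change 𝓕.grEquiv h𝓕 ψ (𝓕.grBracket x y) =
      𝓕.grBracket (𝓕.grEquiv h𝓕 ψ x) (𝓕.grEquiv h𝓕 ψ y)
    induction x using 𝓕.gr_induction with
    | h0 => simp
    | hadd x x' hx hx' => simp only [map_add, LinearMap.add_apply, hx, hx']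
    | hcls p x =>
      induction y using 𝓕.gr_induction with
      | h0 => simp
      | hadd y y' hy hy' => simp only [map_add, hy, hy']
      | hcls q y =>
        rw [grBracket_cls, grEquiv_cls, grEquiv_cls, grEquiv_cls, grBracket_cls]
        exact 𝓕.cls_congr rfl _ _ (ψ.2.1 x y)
  · have h1 := 𝓕.grEquiv_mem_grPiece h𝓕 ψ⁻¹ h
    rwa [← LinearEquiv.mul_apply, ← grEquiv_mul, inv_mul_cancel, grEquiv_one] at h1

/-- The homomorphism of automorphism groups that sends `ψ` to `[X] ↦ [ψ X]`. -/
def grAut : S.aut S.parity →* 𝓕.gr.aut 𝓕.grPiece where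
  toFun ψ := ⟨𝓕.grEquiv h𝓕 ψ, 𝓕.grEquiv_mem_aut h𝓕 ψ⟩
  map_one' := Subtype.ext (𝓕.grEquiv_one h𝓕)
  map_mul' ψ χ := Subtype.ext (𝓕.grEquiv_mul h𝓕 ψ χ)

end Filtration

end LieSuperalgebra

/-! ### The canonical filtration -/

theorem tail_le_sup {L : Type*} [AddCommGroup L] [Module ℝ L] (G : ℤ → Submodule ℝ L) (p : ℤ) :
    tail G p ≤ G p ⊔ tail G (p + 2) := by
  refine iSup_le fun i => ?_
  cases i with
  | zero => exact le_sup_of_le_left (by simp)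
  | succ i => exact le_sup_of_le_right (le_tail i (by push_cast; ring))

namespace EulerGrading

open LieSuperalgebra

variable {L : Type*} [AddCommGroup L] [Module ℝ L] {S : LieSuperalgebra L} {ε : L} {r : ℕ}
  {G : ℤ → Submodule ℝ L} (E : EulerGrading S ε r G)

include E

theorem maximal_iff {N : Submodule ℝ L} : Maximal S.IsAdNilpotentIdeal N ↔ N = tail G 2 := by
  constructor
  · intro h
    have h1 := E.le_tail_of_isAdNilpotentIdeal h.1
    exact le_antisymm h1 (h.2 E.isAdNilpotentIdeal_tail h1)
  · rintro rfl
    exact ⟨E.isAdNilpotentIdeal_tail, fun J hJ _ => E.le_tail_of_isAdNilpotentIdeal hJ⟩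

/-- The maximal ideal is invariant under automorphisms, as its image is an ideal with the same
property. -/
theorem apply_mem_tail_two {ψ : L ≃ₗ[ℝ] L} (hψ : ψ ∈ S.aut S.parity) {X : L}
    (hX : X ∈ tail G 2) : ψ X ∈ tail G 2 := by
  have hN := E.isAdNilpotentIdeal_tail
  refine E.le_tail_of_isAdNilpotentIdeal (J := (tail G 2).map ψ.toLinearMap) ?_ ⟨X, hX, rfl⟩
  refine ⟨?_, ?_, ?_⟩
  · rintro _ ⟨Y, hY, rfl⟩
    exact (hψ.2 0 Y).2 (hN.le_even hY)
  · rintro Z hZ _ ⟨Y, hY, rfl⟩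
    have hZ' : ψ.symm Z ∈ S.parity 0 := by
      rw [← hψ.2 0, LinearEquiv.apply_symm_apply]
      exact hZ
    refine ⟨_, hN.bracket_mem _ hZ' Y hY, ?_⟩
    have h := hψ.1 (ψ.symm Z) Y
    rwa [LinearEquiv.apply_symm_apply] at h
  · rintro _ ⟨Y, hY, rfl⟩
    obtain ⟨m, hm⟩ := hN.nilpotent Y hY
    refine ⟨m, fun Z => ?_⟩
    have h : ∀ n : ℕ, ∀ Z, (S.bracket (ψ Y) ^ n) (ψ Z) = ψ ((S.bracket Y ^ n) Z) := by
      intro n Z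
      induction n with
      | zero => rfl
      | succ n ih =>
        rw [pow_succ', Module.End.mul_apply, ih, pow_succ', Module.End.mul_apply, hψ.1]
    have h2 := h m (ψ.symm Z)
    rw [hm, map_zero, LinearEquiv.apply_symm_apply] at h2
    exact h2

/-- The tails are obtained from the parity parts by brackets with the maximal ideal, and all of
these are invariant under automorphisms. -/
theorem apply_mem_tail {ψ : L ≃ₗ[ℝ] L} (hψ : ψ ∈ S.aut S.parity) (p : ℤ) {X : L}
    (hX : X ∈ tail G p) : ψ X ∈ tail G p := by
  have key : ∀ n : ℕ, ∀ p : ℤ, p ≤ n → ∀ X ∈ tail G p, ψ X ∈ tail G p := by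
    intro n
    induction n with
    | zero =>
      intro p hp X hX
      rw [← E.parity_eq_tail (by exact_mod_cast hp)] at hX ⊢
      exact (hψ.2 _ X).2 hX
    | succ n ih =>
      intro p hp X hX
      by_cases hp0 : p ≤ 0
      · rw [← E.parity_eq_tail hp0] at hX ⊢
        exact (hψ.2 _ X).2 hX
      · have h1 := E.map₂_bracket_tail (q := p - 2) (by omega)
        rw [sub_add_cancel] at h1
        rw [← h1] at hX ⊢
        have h2 : Submodule.map₂ S.bracket (tail G 2) (tail G (p - 2)) ≤
            (Submodule.map₂ S.bracket (tail G 2) (tail G (p - 2))).comap ψ.toLinearMap :=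
          Submodule.map₂_le.2 fun Y hY Z hZ => by
            rw [Submodule.mem_comap, LinearEquiv.coe_coe, hψ.1]
            exact Submodule.apply_mem_map₂ _ (E.apply_mem_tail_two hψ hY)
              (ih _ (by push_cast at hp; omega) Z hZ)
        exact h2 hX
  exact key p.toNat p (Int.self_le_toNat p) X hX

theorem apply_mem_tail_iff {ψ : L ≃ₗ[ℝ] L} (hψ : ψ ∈ S.aut S.parity) (p : ℤ) {X : L} :
    ψ X ∈ tail G p ↔ X ∈ tail G p := by
  refine ⟨fun h => ?_, E.apply_mem_tail hψ p⟩
  have h1 := E.apply_mem_tail (inv_mem hψ) p h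
  rwa [show ψ⁻¹ (ψ X) = X from ψ.symm_apply_apply X] at h1

/-- The canonical filtration, by the tails. -/
def filtration : S.Filtration where
  F := tail G
  step := tail_add_two_le
  le_parity := E.tail_le_parity
  bracket_mem := E.bracket_mem_tail

/-- The component of degree `p` is isomorphic to the quotient `F p / F (p + 2)`. -/
def pieceEquiv (p : ℤ) : G p ≃ₗ[ℝ] E.filtration.Piece p :=
  E.filtration.pieceEquiv p (G p) (le_tail 0 (by simp))
    ((E.iSupIndep p).mono_right (iSup_le fun i => le_iSup₂_of_le _ (by omega) le_rfl))
    (tail_le_sup G p)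

/-- The isomorphism of the associated graded Lie superalgebra with the original one: it sends the
class of `X ∈ G p` to `X`. -/
def grEquivSelf : E.filtration.Gr ≃ₗ[ℝ] L :=
  (DFinsupp.mapRange.linearEquiv E.pieceEquiv).symm.trans
    (LinearEquiv.ofBijective (DirectSum.coeLinearMap G) E.isZGrading.isInternal)

theorem grEquivSelf_cls {p : ℤ} {X : L} (hX : X ∈ G p) :
    E.grEquivSelf (E.filtration.cls p ⟨X, le_tail 0 (by simp) hX⟩) = X := by
  have h : (DFinsupp.mapRange.linearEquiv E.pieceEquiv) (DirectSum.lof ℝ ℤ (fun p => G p) p ⟨X, hX⟩)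
      = E.filtration.cls p ⟨X, le_tail 0 (by simp) hX⟩ :=
    DFinsupp.mapRange_single (hf := fun i => map_zero (E.pieceEquiv i))
  rw [← h, grEquivSelf, LinearEquiv.trans_apply, LinearEquiv.symm_apply_apply]
  exact DirectSum.coeLinearMap_lof G p ⟨X, hX⟩

theorem exists_cls_eq {p : ℤ} {x : E.filtration.Gr} (hx : x ∈ E.filtration.grPiece p) :
    ∃ (X : L) (hX : X ∈ G p), x = E.filtration.cls p ⟨X, le_tail 0 (by simp) hX⟩ := by
  obtain ⟨z, rfl⟩ := hx
  obtain ⟨⟨X, hX⟩, rfl⟩ := (E.pieceEquiv p).surjective z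
  exact ⟨X, hX, rfl⟩

theorem grEquivSelf_mem {p : ℤ} {x : E.filtration.Gr} :
    E.grEquivSelf x ∈ G p ↔ x ∈ E.filtration.grPiece p := by
  constructor
  · intro h
    rw [← E.grEquivSelf.injective (E.grEquivSelf_cls h)]
    exact ⟨_, rfl⟩
  · intro h
    obtain ⟨X, hX, rfl⟩ := E.exists_cls_eq h
    rw [E.grEquivSelf_cls hX]
    exact hX

theorem gr_induction {C : E.filtration.Gr → Prop} (h0 : C 0)
    (hadd : ∀ x y, C x → C y → C (x + y))
    (hcls : ∀ (p : ℤ) (X : L) (hX : X ∈ G p),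
      C (E.filtration.cls p ⟨X, le_tail 0 (by simp) hX⟩)) (x : E.filtration.Gr) : C x := by
  induction x using E.filtration.gr_induction with
  | h0 => exact h0
  | hadd x y hx hy => exact hadd x y hx hy
  | hcls p x =>
    obtain ⟨X, hX, h⟩ := E.exists_cls_eq (x := E.filtration.cls p x) ⟨_, rfl⟩
    rw [h]
    exact hcls p X hX

theorem grEquivSelf_bracket (x y : E.filtration.Gr) :
    E.grEquivSelf (E.filtration.grBracket x y) =
      S.bracket (E.grEquivSelf x) (E.grEquivSelf y) := by
  induction x using E.gr_induction with
  | h0 => simp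
  | hadd x x' hx hx' => simp only [map_add, LinearMap.add_apply, hx, hx']
  | hcls p X hX =>
    induction y using E.gr_induction with
    | h0 => simp
    | hadd y y' hy hy' => simp only [map_add, hy, hy']
    | hcls q Y hY =>
      rw [Filtration.grBracket_cls, E.grEquivSelf_cls hX, E.grEquivSelf_cls hY]
      exact E.grEquivSelf_cls (E.bracket_mem hX hY)

theorem grEquivSelf_mem_parity {i : ZMod 2} {x : E.filtration.Gr} :
    E.grEquivSelf x ∈ S.parity i ↔ x ∈ E.filtration.grParity i := by
  constructor
  · intro h
    obtain ⟨p, hp, hpi⟩ : ∃ p : ℤ, p ≤ 0 ∧ (p : ZMod 2) = i := by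
      rcases parity_cases i with rfl | rfl
      · exact ⟨0, le_rfl, Int.cast_zero⟩
      · exact ⟨-1, by omega, rfl⟩
    have h2 : tail G p ≤ (E.filtration.grParity i).comap E.grEquivSelf.symm.toLinearMap := by
      refine iSup_le fun k X hX => ?_
      rw [Submodule.mem_comap, LinearEquiv.coe_coe, ← E.grEquivSelf_cls hX,
        LinearEquiv.symm_apply_apply]
      exact E.filtration.cls_mem_grParity (by rw [intCast_add_two_mul, hpi]) _
    rw [← hpi, E.parity_eq_tail hp] at h
    have h3 := h2 h
    rwa [Submodule.mem_comap, LinearEquiv.coe_coe, LinearEquiv.symm_apply_apply] at h3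
  · intro h
    refine E.filtration.grParity_induction (fun x => E.grEquivSelf x ∈ S.parity i) ?_ ?_ ?_ h
    · rw [map_zero]
      exact zero_mem _
    · intro x y hx hy
      rw [map_add]
      exact add_mem hx hy
    · intro p hp x
      rw [← hp]
      exact E.le_parity p (E.grEquivSelf_mem.2 ⟨_, rfl⟩)

/-- Everything that is claimed about the vector fields of a supermanifold holds for a Lie
superalgebra graded by an Euler element. -/
theorem canonical_filtration :
    S.IsZGrading G ∧
    (∃! N, Maximal S.IsAdNilpotentIdeal N) ∧
    ∀ N, Maximal S.IsAdNilpotentIdeal N →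
      (∀ p : ℤ, -1 ≤ p → S.lower N p = ⨆ i : ℕ, G (p + 2 * (i : ℤ))) ∧
      (∀ ψ ∈ S.aut S.parity, ∀ p : ℤ, ∀ X,
        ψ X ∈ S.lower N p ↔ X ∈ S.lower N p) ∧
      ∃ 𝓕 : S.Filtration, (∀ p : ℤ, 𝓕.F p = S.lower N p) ∧
        𝓕.gr.IsZGrading 𝓕.grPiece ∧
        (∃ Φ : 𝓕.Gr ≃ₗ[ℝ] L,
          (∀ x y, Φ (𝓕.gr.bracket x y) = S.bracket (Φ x) (Φ y)) ∧
          (∀ (i : ZMod 2) (x), Φ x ∈ S.parity i ↔ x ∈ 𝓕.gr.parity i) ∧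
          (∀ (p : ℤ) (x), Φ x ∈ G p ↔ x ∈ 𝓕.grPiece p)) ∧
        ∃ P : S.aut S.parity →* 𝓕.gr.aut 𝓕.grPiece,
          ∀ (ψ : S.aut S.parity) (p : ℤ) (X : L)
            (hX : X ∈ 𝓕.F p), ∃ hψX : ψ.1 X ∈ 𝓕.F p,
              (P ψ).1 (𝓕.cls p ⟨X, hX⟩) = 𝓕.cls p ⟨ψ.1 X, hψX⟩ := by
  have hlow := E.lower_tail
  refine ⟨E.isZGrading, ⟨_, E.maximal_iff.2 rfl, fun N hN => E.maximal_iff.1 hN⟩, fun N hN => ?_⟩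
  obtain rfl := E.maximal_iff.1 hN
  simp only [hlow]
  exact ⟨fun p _ => rfl, fun ψ hψ p X => E.apply_mem_tail_iff hψ p, E.filtration, fun p => rfl,
    E.filtration.isZGrading_gr, ⟨E.grEquivSelf, E.grEquivSelf_bracket,
      fun i x => E.grEquivSelf_mem_parity, fun p x => E.grEquivSelf_mem⟩,
    E.filtration.grAut fun ψ hψ p X => E.apply_mem_tail hψ p, fun ψ p X hX =>
      ⟨E.apply_mem_tail ψ.2 p hX, E.filtration.grEquiv_cls _ ψ p ⟨X, hX⟩⟩⟩

end EulerGrading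

end SuperVF

end

theorem mainTheorem6
    {s : ℕ} {M : Type*} [TopologicalSpace M] [T2Space M] [SecondCountableTopology M]
    [ChartedSpace (EuclideanSpace ℝ (Fin s)) M] [IsManifold (𝓡 s) ∞ M]
    {F : Type*} [NormedAddCommGroup F] [NormedSpace ℝ F] [FiniteDimensional ℝ F]
    {V : M → Type*} [∀ x, AddCommGroup (V x)] [∀ x, Module ℝ (V x)]
    [TopologicalSpace (Bundle.TotalSpace F V)] [∀ x, TopologicalSpace (V x)] [FiberBundle F V]
    [VectorBundle ℝ F V] [ContMDiffVectorBundle ∞ F V (𝓡 s)]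
    (hrank : 2 < Module.finrank ℝ F ∨ (0 < s ∧ 1 < Module.finrank ℝ F))
    {A : Type*} [Ring A] [Algebra ℝ A] (𝒜 : ZMod 2 → Submodule ℝ A) [GradedAlgebra 𝒜]
    (φ : Splitting s F V 𝒜) :
    -- the Euler field of the splitting gives a grading of the Lie superalgebra of vector fields
    (vectorFields 𝒜).IsZGrading φ.degreePart ∧
    -- there is exactly one maximal ad-nilpotent ideal of the even part
    (∃! N, Maximal (vectorFields 𝒜).IsAdNilpotentIdeal N) ∧
    ∀ N, Maximal (vectorFields 𝒜).IsAdNilpotentIdeal N →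
      -- the subspaces built from it are sums of homogeneous components
      (∀ p : ℤ, -1 ≤ p → (vectorFields 𝒜).lower N p = ⨆ i : ℕ, φ.degreePart (p + 2 * (i : ℤ))) ∧
      -- they are stable under all automorphisms
      (∀ ψ ∈ (vectorFields 𝒜).aut (vectorFields 𝒜).parity, ∀ p : ℤ, ∀ X,
        ψ X ∈ (vectorFields 𝒜).lower N p ↔ X ∈ (vectorFields 𝒜).lower N p) ∧
      -- they form a filtration compatible with the bracket
      ∃ 𝓕 : (vectorFields 𝒜).Filtration, (∀ p : ℤ, 𝓕.F p = (vectorFields 𝒜).lower N p) ∧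
        -- whose associated graded Lie superalgebra is isomorphic to the one of vector fields
        𝓕.gr.IsZGrading 𝓕.grPiece ∧
        (∃ Φ : 𝓕.Gr ≃ₗ[ℝ] superDer 𝒜,
          (∀ x y, Φ (𝓕.gr.bracket x y) = (vectorFields 𝒜).bracket (Φ x) (Φ y)) ∧
          (∀ (i : ZMod 2) (x), Φ x ∈ (vectorFields 𝒜).parity i ↔ x ∈ 𝓕.gr.parity i) ∧
          (∀ (p : ℤ) (x), Φ x ∈ φ.degreePart p ↔ x ∈ 𝓕.grPiece p)) ∧
        -- and `[X] ↦ [ψ X]` defines a homomorphism of automorphism groups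
        ∃ P : (vectorFields 𝒜).aut (vectorFields 𝒜).parity →* 𝓕.gr.aut 𝓕.grPiece,
          ∀ (ψ : (vectorFields 𝒜).aut (vectorFields 𝒜).parity) (p : ℤ) (X : superDer 𝒜)
            (hX : X ∈ 𝓕.F p), ∃ hψX : ψ.1 X ∈ 𝓕.F p,
              (P ψ).1 (𝓕.cls p ⟨X, hX⟩) = 𝓕.cls p ⟨ψ.1 X, hψX⟩ := by
  obtain ⟨P⟩ := φ.exists_eulerFrame
  have E := P.eulerGrading hrank
  -- the eigenvalue equation that defines `degreePart` determines the parity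
  have hG : derPart 𝒜 (φ.eulerField : Module.End ℝ A) = φ.degreePart :=
    funext fun k => Submodule.ext fun X => E.mem_iff
  exact (hG ▸ E : EulerGrading (vectorFields 𝒜) φ.eulerField _
    φ.degreePart).canonical_filtration
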